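/- Let $M$ be a complex manifold with sheaf of holomorphic functions $\mathcal F$, let $\mathcal G$ be a locally free sheaf of $\mathcal F$-modules of finite rank, and let $(M,\mathcal O)$ with $\mathcal O=\bigwedge_{\mathcal F}\mathcal G$ be the corresponding split supermanifold, with its $\mathbb Z$-grading $\mathcal O=\bigoplus_p\bigwedge^p\mathcal G$, the induced $\mathbb Z/2$-grading, and the sheaf of ideals $\mathcal J\subset\mathcal O$ generated by the odd elements. A sheaf $\mathcal E$ of $\mathbb Z/2$-graded $\mathcal O$-modules is called locally free if it is locally isomorphic to $\mathcal O^{p}\oplus\Pi(\mathcal O)^{q}$ for some $p,q\ge 0$ ($\Pi$ reverses the parity); morphisms preserve the parity. Put $\mathcal E_{(p)}=\mathcal J^p\mathcal E$ and $\operatorname{gr}\mathcal E=\bigoplus_{p\ge0}\mathcal E_{(p)}/\mathcal E_{(p+1)}$, which is a $\mathbb Z$-graded and $\mathbb Z/2$-graded sheaf of $\mathcal O$-modules (as $\operatorname{gr}\mathcal O=\mathcal O$). Let $\mathcal S=\mathcal S_{\bar 0}\oplus\mathcal S_{\bar 1}$ be a locally free $\mathbb Z/2$-graded sheaf of $\mathcal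 F$-modules of rank $p|q$, and let $\mathcal E_{gr}=\mathcal O\otimes_{\mathcal F}\mathcal S$ with the $\mathbb Z$-grading $\bigoplus_p\bigwedge^p\mathcal G\otimes\mathcal S$ and the total $\mathbb Z/2$-grading. Let $\mathcal Aut^{\mathcal O}_{(1)}\mathcal E_{gr}$ be the sheaf of groups of those (even, $\mathcal O$-linear) automorphisms $a$ of $\mathcal E_{gr}$ with $a(v)\equiv v \pmod{(\mathcal E_{gr})_{(1)}}$ for all $v$, and $\mathcal Aut^{\mathcal O}_{0}\mathcal E_{gr}$ the sheaf of groups of those which preserve the $\mathbb Z$-grading. The group $H^0(M,\mathcal Aut^{\mathcal O}_0\mathcal E_{gr})$ acts on the (non-abelian Čech) cohomology set $H^1(M,\mathcal Aut^{\mathcal O}_{(1)}\mathcal E_{gr})$ by conjugation of cocycles, $(g_{ij})\mapsto(a g_{ij}a^{-1})$. Then the isomorphism classes of locally free sheaves $\mathcal E$ of $\mathcal O$-modules with $\operatorname{gr}\mathcal E\simeq\mathcal E_{gr}$ (as $\mathbb Z$- and $\mathbb Z/2$-graded sheaves of $\mathcal O$-modules) are in bijection with the orbit set $$H^1(M,\mathcal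 Aut^{\mathcal O}_{(1)}\mathcal E_{gr})\,/\,H^0(M,\mathcal Aut^{\mathcal O}_{0}\mathcal E_{gr}).$$ Under the bijection the class of $\mathcal E$ corresponds to the orbit of the class of a cocycle $(g_{ij})$ on an open covering $(U_i)$ if and only if there are an isomorphism $\theta:\operatorname{gr}\mathcal E\to\mathcal E_{gr}$ of $\mathbb Z$- and $\mathbb Z/2$-graded sheaves of $\mathcal O$-modules and even isomorphisms $\delta_i:\mathcal E|_{U_i}\to\mathcal E_{gr}|_{U_i}$ inducing $\theta|_{U_i}$ on the associated graded sheaves, with $g_{ij}=\delta_i\circ\delta_j^{-1}$ on $U_i\cap U_j$. Moreover, the unit class $\epsilon\in H^1(M,\mathcal Aut^{\mathcal O}_{(1)}\mathcal E_{gr})$, the class of the trivial cocycle, is a fixed point of this action. -/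

import Mathlib

open TopologicalSpace
open scoped Manifold ContDiff DirectSum TensorProduct

universe u

noncomputable section

namespace SuperSheaf

section Presheaves

variable {X : Type u} [TopologicalSpace X]

/-- A family of abelian groups indexed by the open sets is a presheaf of abelian groups. -/
class AddPsh (P : Opens X → Type u) [∀ U, AddCommGroup (P U)] where
  res : ∀ {U V : Opens X}, V ≤ U → P U →+ P V
  res_self : ∀ {U : Opens X} (a : P U), res (le_refl U) a = a
  res_res : ∀ {U V W : Opens X} (h : V ≤ U) (h' : W ≤ V) (a : P U),
    res h' (res h a) = res (h'.trans h) a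

/-- The restriction map of a presheaf of abelian groups. -/
abbrev res (P : Opens X → Type u) [∀ U, AddCommGroup (P U)] [AddPsh P]
    {U V : Opens X} (h : V ≤ U) : P U →+ P V := AddPsh.res h

theorem res_res (P : Opens X → Type u) [∀ U, AddCommGroup (P U)] [AddPsh P]
    {U V W : Opens X} (h : V ≤ U) (h' : W ≤ V) (a : P U) :
    res P h' (res P h a) = res P (h'.trans h) a := AddPsh.res_res h h' a

theorem res_self (P : Opens X → Type u) [∀ U, AddCommGroup (P U)] [AddPsh P]
    {U : Opens X} (a : P U) : res P (le_refl U) a = a := AddPsh.res_self a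

/-- A presheaf of (not necessarily commutative) rings. -/
class RingPsh (R : Opens X → Type u) [∀ U, Ring (R U)] extends AddPsh R where
  res_one : ∀ {U V : Opens X} (h : V ≤ U), res h (1 : R U) = 1
  res_mul : ∀ {U V : Opens X} (h : V ≤ U) (a b : R U), res h (a * b) = res h a * res h b

/-- The restriction map of a presheaf of rings, as a ring homomorphism. -/
def resRing (R : Opens X → Type u) [∀ U, Ring (R U)] [RingPsh R] {U V : Opens X} (h : V ≤ U) :
    R U →+* R V :=
  { res R h with
    map_one' := RingPsh.res_one h
    map_mul' := RingPsh.res_mul h }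

/-- A presheaf of (left) modules over a presheaf of rings: restriction is semilinear. -/
class ModPsh (R : Opens X → Type u) [∀ U, Ring (R U)] [RingPsh R]
    (P : Opens X → Type u) [∀ U, AddCommGroup (P U)] [AddPsh P] [∀ U, Module (R U) (P U)] :
    Prop where
  res_smul : ∀ {U V : Opens X} (h : V ≤ U) (f : R U) (v : P U),
    res P h (f • v) = res R h f • res P h v

instance (R : Opens X → Type u) [∀ U, Ring (R U)] [RingPsh R] : ModPsh R R :=
  ⟨fun h f v => RingPsh.res_mul h f v⟩

/-- The sheaf condition: compatible families of sections glue uniquely. -/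
def IsSheaf (P : Opens X → Type u) [∀ U, AddCommGroup (P U)] [AddPsh P] : Prop :=
  ∀ {ι : Type u} (U : ι → Opens X) (s : ∀ i, P (U i)),
    (∀ i j, res P (inf_le_left : U i ⊓ U j ≤ U i) (s i) =
      res P (inf_le_right : U i ⊓ U j ≤ U j) (s j)) →
    ∃! t : P (⨆ i, U i), ∀ i, res P (le_iSup U i) t = s i

/-- A subpresheaf of abelian groups. -/
structure SubPsh (P : Opens X → Type u) [∀ U, AddCommGroup (P U)] [AddPsh P] where
  carrier : ∀ U, AddSubgroup (P U)
  res_mem : ∀ {U V : Opens X} (h : V ≤ U) {a : P U}, a ∈ carrier U → res P h a ∈ carrier V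

instance (P : Opens X → Type u) [∀ U, AddCommGroup (P U)] [AddPsh P] :
    CoeFun (SubPsh P) (fun _ => ∀ U, AddSubgroup (P U)) := ⟨SubPsh.carrier⟩

end Presheaves

section Sheafification

variable {X : Type u} [TopologicalSpace X]
variable (P : Opens X → Type u) [∀ U, AddCommGroup (P U)] [AddPsh P]

/-- Sections over an open neighbourhood of `x` (ordered by reverse inclusion). -/
abbrev nhdSec (x : X) (V : (OpenNhdsOf x)ᵒᵈ) : Type u := P (OrderDual.ofDual V).toOpens

/-- Restriction between open neighbourhoods of `x`. -/
abbrev nhdRes (x : X) (V W : (OpenNhdsOf x)ᵒᵈ) (h : V ≤ W) : nhdSec P x V →+ nhdSec P x W :=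
  res P (show (OrderDual.ofDual W).toOpens ≤ (OrderDual.ofDual V).toOpens from h)

instance stalkSystem (x : X) : DirectedSystem (nhdSec P x) (nhdRes P x · · ·) where
  map_self _ a := res_self P a
  map_map _ _ _ _ _ a := res_res P _ _ a

/-- The stalk at `x`: the direct limit of `P V` over the open neighbourhoods `V` of `x`. -/
def Stalk (x : X) : Type u := DirectLimit (nhdSec P x) (nhdRes P x)

instance (x : X) : AddCommGroup (Stalk P x) :=
  inferInstanceAs (AddCommGroup (DirectLimit (nhdSec P x) (nhdRes P x)))

variable {P}

/-- The germ at `x` of a section over an open neighbourhood of `x`. -/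
def germ {V : Opens X} {x : X} (hx : x ∈ V) (a : P V) : Stalk P x :=
  ⟦⟨OrderDual.toDual ⟨V, hx⟩, a⟩⟧

theorem germ_res {V W : Opens X} {x : X} (h : W ≤ V) (hx : x ∈ W) (a : P V) :
    germ hx (res P h a) = germ (h hx) a :=
  DirectLimit.mk_apply (F := nhdSec P x) (f := nhdRes P x)
    (OrderDual.toDual (⟨V, h hx⟩ : OpenNhdsOf x)) (OrderDual.toDual ⟨W, hx⟩) a h

theorem germ_eq {V W : Opens X} {x : X} {hx : x ∈ V} {hx' : x ∈ W} {a : P V} {b : P W}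
    (h : germ hx a = germ hx' b) :
    ∃ (Z : Opens X) (_ : x ∈ Z) (h₁ : Z ≤ V) (h₂ : Z ≤ W), res P h₁ a = res P h₂ b := by
  obtain ⟨Z, h₁, h₂, e⟩ := Quotient.exact h
  exact ⟨(OrderDual.ofDual Z).toOpens, (OrderDual.ofDual Z).mem', h₁, h₂, e⟩

theorem exists_germ {x : X} (σ : Stalk P x) :
    ∃ (V : Opens X) (hx : x ∈ V) (a : P V), σ = germ hx a := by
  obtain ⟨V, a, rfl⟩ := DirectLimit.exists_eq_mk _ σ
  exact ⟨(OrderDual.ofDual V).toOpens, (OrderDual.ofDual V).mem', a, rfl⟩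

theorem germ_add {V : Opens X} {x : X} (hx : x ∈ V) (a b : P V) :
    germ hx (a + b) = germ hx a + germ hx b :=
  (DirectLimit.add_def (G := nhdSec P x) (f := nhdRes P x)
    (OrderDual.toDual (⟨V, hx⟩ : OpenNhdsOf x)) a b).symm

theorem germ_zero {V : Opens X} {x : X} (hx : x ∈ V) : germ hx (0 : P V) = 0 :=
  (DirectLimit.zero_def (G := nhdSec P x) (f := nhdRes P x) (OrderDual.toDual (⟨V, hx⟩ : OpenNhdsOf x))).symm

theorem germ_neg {V : Opens X} {x : X} (hx : x ∈ V) (a : P V) :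
    germ hx (-a) = -germ hx a := rfl

variable {R : Opens X → Type u} [∀ U, Ring (R U)] [RingPsh R]
variable [∀ U, Module (R U) (P U)] [ModPsh R P]

/-- Multiplication of germs of sections of a module by germs of scalars. -/
def stalkSMul (x : X) : Stalk R x → Stalk P x → Stalk P x :=
  DirectLimit.map₂ (F₁ := nhdSec R x) (F₂ := nhdSec P x) (F := nhdSec P x)
    (nhdRes R x) (nhdRes P x) (nhdRes P x) (fun _ f v => f • v) (fun _ _ h f v => ModPsh.res_smul h f v)

theorem germ_smul {V : Opens X} {x : X} (hx : x ∈ V) (f : R V) (v : P V) :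
    stalkSMul x (germ hx f) (germ hx v) = germ hx (f • v) :=
  DirectLimit.map₂_def (F₁ := nhdSec R x) (F₂ := nhdSec P x) (F := nhdSec P x)
    (nhdRes R x) (nhdRes P x) (nhdRes P x) (fun _ f v => f • v) (fun _ _ h f v => ModPsh.res_smul h f v) _ _ _

/-- Two germs have representatives over a common neighbourhood. -/
theorem exists_germ₂ {Q : Opens X → Type u} [∀ U, AddCommGroup (Q U)] [AddPsh Q] {x : X}
    (σ : Stalk P x) (τ : Stalk Q x) :
    ∃ (V : Opens X) (hx : x ∈ V) (a : P V) (b : Q V), σ = germ hx a ∧ τ = germ hx b := by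
  obtain ⟨V, hV, a, rfl⟩ := exists_germ σ
  obtain ⟨W, hW, b, rfl⟩ := exists_germ τ
  exact ⟨V ⊓ W, ⟨hV, hW⟩, res P inf_le_left a, res Q inf_le_right b,
    (germ_res (inf_le_left : V ⊓ W ≤ V) ⟨hV, hW⟩ a).symm,
    (germ_res (inf_le_right : V ⊓ W ≤ W) ⟨hV, hW⟩ b).symm⟩

/-- Three germs have representatives over a common neighbourhood. -/
theorem exists_germ₃ {Q T : Opens X → Type u} [∀ U, AddCommGroup (Q U)] [AddPsh Q]
    [∀ U, AddCommGroup (T U)] [AddPsh T] {x : X}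
    (σ : Stalk P x) (τ : Stalk Q x) (υ : Stalk T x) :
    ∃ (V : Opens X) (hx : x ∈ V) (a : P V) (b : Q V) (c : T V),
      σ = germ hx a ∧ τ = germ hx b ∧ υ = germ hx c := by
  obtain ⟨V, hV, a, b, rfl, rfl⟩ := exists_germ₂ σ τ
  obtain ⟨W, hW, c, rfl⟩ := exists_germ υ
  exact ⟨V ⊓ W, ⟨hV, hW⟩, res P inf_le_left a, res Q inf_le_left b, res T inf_le_right c,
    (germ_res (inf_le_left : V ⊓ W ≤ V) ⟨hV, hW⟩ a).symm,
    (germ_res (inf_le_left : V ⊓ W ≤ V) ⟨hV, hW⟩ b).symm,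
    (germ_res (inf_le_right : V ⊓ W ≤ W) ⟨hV, hW⟩ c).symm⟩

/-- The ring structure of the stalks of a presheaf of rings. -/
instance stalkRing (x : X) : Ring (Stalk R x) :=
  { (inferInstance : AddCommGroup (Stalk R x)) with
    mul := stalkSMul x
    one := germ (Opens.mem_top x) 1
    left_distrib := fun a b c => by
      obtain ⟨V, hx, a, b, c, rfl, rfl, rfl⟩ := exists_germ₃ a b c
      change stalkSMul x _ (_ + _) = stalkSMul x _ _ + stalkSMul x _ _
      simp only [germ_smul, ← germ_add, smul_eq_mul, mul_add]
    right_distrib := fun a b c => by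
      obtain ⟨V, hx, a, b, c, rfl, rfl, rfl⟩ := exists_germ₃ a b c
      change stalkSMul x (_ + _) _ = stalkSMul x _ _ + stalkSMul x _ _
      simp only [germ_smul, ← germ_add, smul_eq_mul, add_mul]
    zero_mul := fun a => by
      obtain ⟨V, hx, a, rfl⟩ := exists_germ a
      change stalkSMul x 0 _ = 0
      simp only [← germ_zero hx, germ_smul, smul_eq_mul, zero_mul]
    mul_zero := fun a => by
      obtain ⟨V, hx, a, rfl⟩ := exists_germ a
      change stalkSMul x _ 0 = 0
      simp only [← germ_zero hx, germ_smul, smul_eq_mul, mul_zero]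
    mul_assoc := fun a b c => by
      obtain ⟨V, hx, a, b, c, rfl, rfl, rfl⟩ := exists_germ₃ a b c
      change stalkSMul x (stalkSMul x _ _) _ = stalkSMul x _ (stalkSMul x _ _)
      simp only [germ_smul, smul_eq_mul, mul_assoc]
    one_mul := fun a => by
      obtain ⟨V, hx, a, rfl⟩ := exists_germ a
      change stalkSMul x (germ _ 1) _ = _
      rw [← germ_res (le_top : V ≤ ⊤) hx, RingPsh.res_one, germ_smul, one_smul]
    mul_one := fun a => by
      obtain ⟨V, hx, a, rfl⟩ := exists_germ a
      change stalkSMul x _ (germ _ 1) = _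
      rw [← germ_res (le_top : V ≤ ⊤) hx, RingPsh.res_one, germ_smul, smul_eq_mul, mul_one] }

theorem germ_mul {V : Opens X} {x : X} (hx : x ∈ V) (a b : R V) :
    germ hx (a * b) = germ hx a * germ hx b := (germ_smul hx a b).symm

theorem germ_one {V : Opens X} {x : X} (hx : x ∈ V) : germ hx (1 : R V) = 1 := by
  rw [← RingPsh.res_one (le_top : V ≤ ⊤)]
  exact germ_res (le_top : V ≤ ⊤) hx 1

/-- The module structure of the stalks of a presheaf of modules. -/
instance stalkModule (x : X) : Module (Stalk R x) (Stalk P x) where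
  smul := stalkSMul x
  one_smul a := by
    obtain ⟨V, hx, a, rfl⟩ := exists_germ a
    change stalkSMul x 1 _ = _
    rw [← germ_one hx, germ_smul, one_smul]
  mul_smul a b c := by
    obtain ⟨V, hx, a, b, c, rfl, rfl, rfl⟩ := exists_germ₃ a b c
    change stalkSMul x (_ * _) _ = stalkSMul x _ (stalkSMul x _ _)
    simp only [germ_smul, ← germ_mul, mul_smul]
  smul_zero a := by
    obtain ⟨V, hx, a, rfl⟩ := exists_germ a
    change stalkSMul x _ 0 = 0
    simp only [← germ_zero hx, germ_smul, smul_zero]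
  smul_add a b c := by
    obtain ⟨V, hx, a, b, c, rfl, rfl, rfl⟩ := exists_germ₃ a b c
    change stalkSMul x _ (_ + _) = stalkSMul x _ _ + stalkSMul x _ _
    simp only [germ_smul, ← germ_add, smul_add]
  add_smul a b c := by
    obtain ⟨V, hx, a, b, c, rfl, rfl, rfl⟩ := exists_germ₃ a b c
    change stalkSMul x (_ + _) _ = stalkSMul x _ _ + stalkSMul x _ _
    simp only [germ_smul, ← germ_add, add_smul]
  zero_smul a := by
    obtain ⟨V, hx, a, rfl⟩ := exists_germ a
    change stalkSMul x 0 _ = 0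
    rw [← germ_zero hx, germ_smul, zero_smul, germ_zero]

theorem germ_smul' {V : Opens X} {x : X} (hx : x ∈ V) (f : R V) (v : P V) :
    germ hx (f • v) = germ hx f • germ hx v := (germ_smul hx f v).symm

/-- A family of germs over `U` is locally represented by sections in the subpresheaf `A`. -/
def LocallyIn (A : SubPsh P) (U : Opens X) (s : ∀ x : U, Stalk P (x : X)) : Prop :=
  ∀ x : U, ∃ (V : Opens X) (_ : (x : X) ∈ V) (h : V ≤ U) (a : P V),
    a ∈ A V ∧ ∀ (y : X) (hy : y ∈ V), s ⟨y, h hy⟩ = germ hy a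

variable (P) in
/-- The whole presheaf as a subpresheaf of itself. -/
def SubPsh.whole : SubPsh P := ⟨fun _ => ⊤, fun _ _ _ => AddSubgroup.mem_top _⟩

/-- The additive group of the families of germs over `U` which are locally represented by sections
in `A`. -/
def locallyIn (A : SubPsh P) (U : Opens X) : AddSubgroup (∀ x : U, Stalk P (x : X)) where
  carrier := {s | LocallyIn A U s}
  zero_mem' x := ⟨U, x.2, le_rfl, 0, zero_mem _, fun _ hy => (germ_zero hy).symm⟩
  add_mem' {s t} hs ht x := by
    obtain ⟨V, hx, h, a, ha, e⟩ := hs x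
    obtain ⟨V', hx', h', a', ha', e'⟩ := ht x
    refine ⟨V ⊓ V', ⟨hx, hx'⟩, inf_le_left.trans h,
      res P inf_le_left a + res P inf_le_right a',
      add_mem (A.res_mem _ ha) (A.res_mem _ ha'), fun y hy => ?_⟩
    rw [germ_add, germ_res (inf_le_left : V ⊓ V' ≤ V) hy a,
      germ_res (inf_le_right : V ⊓ V' ≤ V') hy a', ← e y hy.1, ← e' y hy.2]
    rfl
  neg_mem' {s} hs x := by
    obtain ⟨V, hx, h, a, ha, e⟩ := hs x
    refine ⟨V, hx, h, -a, neg_mem ha, fun y hy => ?_⟩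
    rw [germ_neg, ← e y hy]
    rfl

variable (P) in
/-- The sheaf associated with the presheaf `P`: its sections over `U` are the families of germs
at the points of `U` which are locally given by sections of `P`. -/
def Shf (U : Opens X) : Type u := locallyIn (SubPsh.whole P) U

namespace Shf

instance (U : Opens X) : AddCommGroup (Shf P U) :=
  inferInstanceAs (AddCommGroup (locallyIn (SubPsh.whole P) U))

@[ext] theorem ext {U : Opens X} {s t : Shf P U} (h : ∀ x : U, s.1 x = t.1 x) : s = t :=
  Subtype.ext (funext h)

theorem add_val {U : Opens X} (s t : Shf P U) (x : U) : (s + t).1 x = s.1 x + t.1 x := rfl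
theorem zero_val {U : Opens X} (x : U) : (0 : Shf P U).1 x = 0 := rfl

instance : AddPsh (Shf P) where
  res {U V} h :=
    { toFun := fun s => ⟨fun x => s.1 ⟨x, h x.2⟩, fun x => by
        obtain ⟨W, hx, hW, a, _, e⟩ := s.2 ⟨x, h x.2⟩
        refine ⟨V ⊓ W, ⟨x.2, hx⟩, inf_le_left, res P inf_le_right a, AddSubgroup.mem_top _, fun y hy => ?_⟩
        rw [germ_res (inf_le_right : V ⊓ W ≤ W) hy a]
        exact e y hy.2⟩
      map_zero' := rfl
      map_add' := fun _ _ => rfl }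
  res_self _ := rfl
  res_res _ _ _ := rfl

theorem res_val {U V : Opens X} (h : V ≤ U) (s : Shf P U) (x : V) :
    (res (Shf P) h s).1 x = s.1 ⟨x, h x.2⟩ := rfl

/-- The canonical map from a presheaf to the associated sheaf. -/
def mk (U : Opens X) : P U →+ Shf P U where
  toFun a := ⟨fun x => germ x.2 a, fun x => ⟨U, x.2, le_rfl, a, AddSubgroup.mem_top _, fun _ _ => rfl⟩⟩
  map_zero' := ext fun x => germ_zero x.2
  map_add' a b := ext fun x => germ_add x.2 a b

theorem mk_val {U : Opens X} (a : P U) (x : U) : (mk U a).1 x = germ x.2 a := rfl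

theorem res_mk {U V : Opens X} (h : V ≤ U) (a : P U) :
    res (Shf P) h (mk U a) = mk V (res P h a) :=
  ext fun x => (germ_res h x.2 a).symm

/-- The subsheaf of the associated sheaf generated by a subpresheaf. -/
def sub (A : SubPsh P) : SubPsh (Shf P) where
  carrier U := (locallyIn A U).comap (locallyIn (SubPsh.whole P) U).subtype
  res_mem {U V} h s hs x := by
    obtain ⟨W, hx, hW, a, ha, e⟩ := hs ⟨x, h x.2⟩
    refine ⟨V ⊓ W, ⟨x.2, hx⟩, inf_le_left, res P inf_le_right a, A.res_mem _ ha, fun y hy => ?_⟩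
    rw [germ_res (inf_le_right : V ⊓ W ≤ W) hy a]
    exact e y hy.2

theorem isSheaf : IsSheaf (Shf P) := by
  intro ι U s hs
  have key : ∀ (i j : ι) (x : X) (hi : x ∈ U i) (hj : x ∈ U j),
      (s i).1 ⟨x, hi⟩ = (s j).1 ⟨x, hj⟩ := fun i j x hi hj =>
    congrArg (fun t : Shf P (U i ⊓ U j) => t.1 ⟨x, hi, hj⟩) (hs i j)
  have hm : ∀ x : (⨆ i, U i : Opens X), ∃ i, (x : X) ∈ U i := fun x => Opens.mem_iSup.1 x.2
  choose c hc using hm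
  refine ⟨⟨fun x => (s (c x)).1 ⟨x, hc x⟩, fun x => ?_⟩, fun i => ?_, fun t ht => ?_⟩
  · obtain ⟨V, hx, h, a, _, e⟩ := (s (c x)).2 ⟨x, hc x⟩
    exact ⟨V, hx, h.trans (le_iSup U _), a, AddSubgroup.mem_top _, fun y hy =>
      (key (c ⟨y, _⟩) (c x) y (hc ⟨y, _⟩) (h hy)).trans (e y hy)⟩
  · exact ext fun x => key _ i x _ x.2
  · refine ext fun x => ?_
    exact congrArg (fun r : Shf P (U (c x)) => r.1 ⟨x, hc x⟩) (ht (c x))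

instance (U : Opens X) : Ring (Shf R U) :=
  { (inferInstance : AddCommGroup (Shf R U)) with
    mul := fun s t => ⟨fun x => s.1 x * t.1 x, fun x => by
      obtain ⟨V, hx, h, a, _, e⟩ := s.2 x
      obtain ⟨V', hx', h', a', _, e'⟩ := t.2 x
      refine ⟨V ⊓ V', ⟨hx, hx'⟩, inf_le_left.trans h,
        res R inf_le_left a * res R inf_le_right a', AddSubgroup.mem_top _, fun y hy => ?_⟩
      rw [germ_mul, germ_res (inf_le_left : V ⊓ V' ≤ V) hy a,
        germ_res (inf_le_right : V ⊓ V' ≤ V') hy a', ← e y hy.1, ← e' y hy.2]⟩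
    one := ⟨fun _ => 1, fun x => ⟨U, x.2, le_rfl, 1, AddSubgroup.mem_top _, fun _ hy => (germ_one hy).symm⟩⟩
    left_distrib := fun a b c => ext fun x => mul_add (a.1 x) (b.1 x) (c.1 x)
    right_distrib := fun a b c => ext fun x => add_mul (a.1 x) (b.1 x) (c.1 x)
    zero_mul := fun a => ext fun x => zero_mul (a.1 x)
    mul_zero := fun a => ext fun x => mul_zero (a.1 x)
    mul_assoc := fun a b c => ext fun x => mul_assoc (a.1 x) (b.1 x) (c.1 x)
    one_mul := fun a => ext fun x => one_mul (a.1 x)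
    mul_one := fun a => ext fun x => mul_one (a.1 x) }

theorem mul_val {U : Opens X} (s t : Shf R U) (x : U) : (s * t).1 x = s.1 x * t.1 x := rfl
theorem one_val {U : Opens X} (x : U) : (1 : Shf R U).1 x = 1 := rfl

instance : RingPsh (Shf R) where
  res_one _ := rfl
  res_mul _ _ _ := rfl

instance (U : Opens X) : Module (Shf R U) (Shf P U) where
  smul f s := ⟨fun x => f.1 x • s.1 x, fun x => by
      obtain ⟨V, hx, h, a, _, e⟩ := f.2 x
      obtain ⟨V', hx', h', a', _, e'⟩ := s.2 x
      refine ⟨V ⊓ V', ⟨hx, hx'⟩, inf_le_left.trans h,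
        res R (inf_le_left : V ⊓ V' ≤ V) a • res P (inf_le_right : V ⊓ V' ≤ V') a', AddSubgroup.mem_top _, fun y hy => ?_⟩
      rw [germ_smul', germ_res (inf_le_left : V ⊓ V' ≤ V) hy a,
        germ_res (inf_le_right : V ⊓ V' ≤ V') hy a', ← e y hy.1, ← e' y hy.2]⟩
  one_smul s := ext fun x => one_smul _ (s.1 x)
  mul_smul f g s := ext fun x => mul_smul (f.1 x) (g.1 x) (s.1 x)
  smul_zero f := ext fun x => smul_zero (f.1 x)
  smul_add f s t := ext fun x => smul_add (f.1 x) (s.1 x) (t.1 x)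
  add_smul f g s := ext fun x => add_smul (f.1 x) (g.1 x) (s.1 x)
  zero_smul s := ext fun x => zero_smul _ (s.1 x)

theorem smul_val {U : Opens X} (f : Shf R U) (s : Shf P U) (x : U) :
    (f • s).1 x = f.1 x • s.1 x := rfl

instance : ModPsh (Shf R) (Shf P) := ⟨fun _ _ _ => rfl⟩

/-- The canonical map from a presheaf of rings to the associated sheaf is a ring homomorphism. -/
def mkRing (U : Opens X) : R U →+* Shf R U :=
  { mk U with
    map_one' := ext fun x => germ_one x.2
    map_mul' := fun a b => ext fun x => germ_mul x.2 a b }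

theorem mk_smul {U : Opens X} (f : R U) (v : P U) :
    mk U (f • v) = mkRing U f • mk U v := ext fun x => germ_smul' x.2 f v

/-- Complementary subpresheaves generate complementary subsheaves. -/
theorem isCompl_sub {A B : SubPsh P} (h : ∀ U, IsCompl (A U) (B U)) (U : Opens X) :
    IsCompl (sub A U) (sub B U) := by
  have uniq : ∀ (x : X) (V W : Opens X) (hV : x ∈ V) (hW : x ∈ W) (a b : P V) (a' b' : P W),
      a ∈ A V → b ∈ B V → a' ∈ A W → b' ∈ B W →
      germ hV (a + b) = germ hW (a' + b') → germ hV a = germ hW a' ∧ germ hV b = germ hW b' := by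
    intro x V W hV hW a b a' b' ha hb ha' hb' e
    obtain ⟨Z, hZ, h₁, h₂, e⟩ := germ_eq e
    rw [map_add, map_add] at e
    have e' : res P h₁ a - res P h₂ a' = res P h₂ b' - res P h₁ b := by
      rw [sub_eq_sub_iff_add_eq_add, e]; abel
    have z : res P h₁ a - res P h₂ a' = 0 := by
      have hm : res P h₁ a - res P h₂ a' ∈ A Z ⊓ B Z := AddSubgroup.mem_inf.2
        ⟨sub_mem (A.res_mem _ ha) (A.res_mem _ ha'),
          e' ▸ sub_mem (B.res_mem _ hb') (B.res_mem _ hb)⟩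
      exact AddSubgroup.mem_bot.1 ((h Z).disjoint.le_bot hm)
    have ea := sub_eq_zero.1 z
    have eb := (sub_eq_zero.1 (e' ▸ z)).symm
    constructor
    · rw [← germ_res h₁ hZ, ← germ_res h₂ hZ, ea]
    · rw [← germ_res h₁ hZ, ← germ_res h₂ hZ, eb]
  constructor
  · rw [disjoint_iff_inf_le]
    rintro s ⟨hA, hB⟩
    refine ext fun x => ?_
    obtain ⟨V, hV, h₁, a, ha, e⟩ := hA x
    obtain ⟨W, hW, h₂, b, hb, e'⟩ := hB x
    have e₁ : s.1 x = germ hV a := e x hV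
    have e₂ : s.1 x = germ hW b := e' x hW
    have := uniq x V W hV hW a 0 0 b ha (zero_mem _) (zero_mem _) hb
      (by rw [add_zero, zero_add, ← e₁, ← e₂])
    rw [e₁, this.1, germ_zero, zero_val]
  · rw [codisjoint_iff_le_sup]
    intro s _
    have loc : ∀ x : U, ∃ (V : Opens X) (_ : (x : X) ∈ V) (hVU : V ≤ U) (a b : P V),
        a ∈ A V ∧ b ∈ B V ∧ ∀ (y : X) (hy : y ∈ V), s.1 ⟨y, hVU hy⟩ = germ hy (a + b) := by
      intro x
      obtain ⟨V, hV, h₁, c, _, e⟩ := s.2 x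
      obtain ⟨a, ha, b, hb, rfl⟩ := AddSubgroup.mem_sup.1
        ((h V).codisjoint.top_le (AddSubgroup.mem_top c))
      exact ⟨V, hV, h₁, a, b, ha, hb, e⟩
    choose V hV hVU a b ha hb e using loc
    have eA : ∀ (x : U) (y : X) (hy : y ∈ V x),
        germ (hV ⟨y, hVU x hy⟩) (a ⟨y, hVU x hy⟩) = germ hy (a x) ∧
        germ (hV ⟨y, hVU x hy⟩) (b ⟨y, hVU x hy⟩) = germ hy (b x) := fun x y hy =>
      uniq y _ _ _ _ _ _ _ _ (ha _) (hb _) (ha _) (hb _)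
        ((e ⟨y, hVU x hy⟩ y (hV ⟨y, hVU x hy⟩)).symm.trans (e x y hy))
    refine AddSubgroup.mem_sup.2
      ⟨⟨fun x => germ (hV x) (a x), fun x => ⟨V x, hV x, hVU x, a x, AddSubgroup.mem_top _,
          fun y hy => (eA x y hy).1⟩⟩,
        fun x => ⟨V x, hV x, hVU x, a x, ha x, fun y hy => (eA x y hy).1⟩,
        ⟨fun x => germ (hV x) (b x), fun x => ⟨V x, hV x, hVU x, b x, AddSubgroup.mem_top _,
          fun y hy => (eA x y hy).2⟩⟩,
        fun x => ⟨V x, hV x, hVU x, b x, hb x, fun y hy => (eA x y hy).2⟩, ?_⟩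
    refine ext fun x => ?_
    change germ (hV x) (a x) + germ (hV x) (b x) = s.1 x
    exact ((germ_add (hV x) (a x) (b x)).symm).trans (e x x (hV x)).symm

end Shf

end Sheafification

section Modules

variable {X : Type u} [TopologicalSpace X]

/-- A sheaf of (left) modules over the presheaf of rings `R`. -/
structure ModSheaf (R : Opens X → Type u) [∀ U, Ring (R U)] [RingPsh R] where
  sec : Opens X → Type u
  [grp : ∀ U, AddCommGroup (sec U)]
  [psh : AddPsh sec]
  [mod : ∀ U, Module (R U) (sec U)]
  [lin : ModPsh R sec]
  isSheaf : IsSheaf sec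

attribute [instance] ModSheaf.grp ModSheaf.psh ModSheaf.mod ModSheaf.lin

/-- A `ℤ/2`-grading on a presheaf of rings. -/
class SuperRing (R : Opens X → Type u) [∀ U, Ring (R U)] [RingPsh R] where
  par : ZMod 2 → SubPsh R
  isCompl : ∀ U, IsCompl (par 0 U) (par 1 U)
  one_mem : ∀ U, (1 : R U) ∈ par 0 U
  mul_mem : ∀ {U} {i j : ZMod 2} {a b : R U}, a ∈ par i U → b ∈ par j U → a * b ∈ par (i + j) U

/-- A `ℤ/2`-graded sheaf of modules over a presheaf of `ℤ/2`-graded rings. -/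
structure SuperModSheaf (R : Opens X → Type u) [∀ U, Ring (R U)] [RingPsh R] [SuperRing R]
    extends ModSheaf R where
  par : ZMod 2 → SubPsh sec
  isCompl : ∀ U, IsCompl (par 0 U) (par 1 U)
  smul_mem : ∀ {U} {i j : ZMod 2} {a : R U} {v : sec U},
    a ∈ SuperRing.par i U → v ∈ par j U → a • v ∈ par (i + j) U

/-- Over the whole of `U`, the sections `e i` form a basis: for all open `V ≤ U`, the map
`R V ^ ι → E V` given by the restrictions of the `e i` is bijective. -/
def IsBasisOn {R : Opens X → Type u} [∀ U, Ring (R U)] [RingPsh R] (E : ModSheaf R)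
    {ι : Type} [Fintype ι] {U : Opens X} (e : ι → E.sec U) : Prop :=
  ∀ (V : Opens X) (h : V ≤ U),
    Function.Bijective (fun c : ι → R V => ∑ i, c i • res E.sec h (e i))

/-- `E` is locally free of rank `m`: it is locally isomorphic to `R ^ m`. -/
def ModSheaf.IsLocallyFree {R : Opens X → Type u} [∀ U, Ring (R U)] [RingPsh R] (E : ModSheaf R)
    (m : ℕ) : Prop :=
  ∀ x : X, ∃ (U : Opens X) (_ : x ∈ U) (e : Fin m → E.sec U), IsBasisOn E e

/-- `E` is locally free of rank `p|q`: it is locally isomorphic to `R ^ p ⊕ Π(R) ^ q`, that is,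
locally it has a basis of `p` even and `q` odd sections. -/
def SuperModSheaf.IsLocallyFree {R : Opens X → Type u} [∀ U, Ring (R U)] [RingPsh R]
    [SuperRing R] (E : SuperModSheaf R) (p q : ℕ) : Prop :=
  ∀ x : X, ∃ (U : Opens X) (_ : x ∈ U) (e : Fin p ⊕ Fin q → E.sec U),
    (∀ i, e (Sum.inl i) ∈ E.par 0 U) ∧ (∀ j, e (Sum.inr j) ∈ E.par 1 U) ∧
      IsBasisOn E.toModSheaf e

/-- The sheaf of modules associated with a presheaf of modules, over the associated sheaf of
rings. -/
def Shf.modSheaf (R : Opens X → Type u) [∀ U, Ring (R U)] [RingPsh R]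
    (P : Opens X → Type u) [∀ U, AddCommGroup (P U)] [AddPsh P] [∀ U, Module (R U) (P U)]
    [ModPsh R P] : ModSheaf (Shf R) where
  sec := Shf P
  isSheaf := Shf.isSheaf

/-- An isomorphism `E|_U → E'|_U` of sheaves of modules. -/
@[ext] structure IsoOn {R : Opens X → Type u} [∀ U, Ring (R U)] [RingPsh R]
    (E E' : ModSheaf R) (U : Opens X) where
  app : ∀ V : Opens X, V ≤ U → E.sec V ≃ₗ[R V] E'.sec V
  res_app : ∀ {V W : Opens X} (hV : V ≤ U) (h : W ≤ V) (v : E.sec V),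
    res E'.sec h (app V hV v) = app W (h.trans hV) (res E.sec h v)

namespace IsoOn

variable {R : Opens X → Type u} [∀ U, Ring (R U)] [RingPsh R] {E E' E'' : ModSheaf R}
  {U : Opens X}

/-- The identity. -/
def refl (E : ModSheaf R) (U : Opens X) : IsoOn E E U where
  app _ _ := LinearEquiv.refl _ _
  res_app _ _ _ := rfl

/-- The inverse isomorphism. -/
def symm (φ : IsoOn E E' U) : IsoOn E' E U where
  app V h := (φ.app V h).symm
  res_app {V W} hV h v := by
    rw [LinearEquiv.eq_symm_apply, ← φ.res_app hV h, LinearEquiv.apply_symm_apply]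

/-- First `φ`, then `ψ`. -/
def trans (φ : IsoOn E E' U) (ψ : IsoOn E' E'' U) : IsoOn E E'' U where
  app V h := (φ.app V h).trans (ψ.app V h)
  res_app {V W} hV h v := by
    simp only [LinearEquiv.trans_apply, ψ.res_app hV h, φ.res_app hV h]

/-- Restriction of an isomorphism to a smaller open set. -/
def restrict (φ : IsoOn E E' U) {V : Opens X} (h : V ≤ U) : IsoOn E E' V where
  app W hW := φ.app W (hW.trans h)
  res_app hV h' v := φ.res_app (hV.trans h) h' v

/-- The automorphisms of `E|_U` form a group under composition, `(φ * ψ) v = φ (ψ v)`. -/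
instance : Group (IsoOn E E U) where
  mul φ ψ := ψ.trans φ
  one := refl E U
  inv φ := φ.symm
  mul_assoc _ _ _ := rfl
  one_mul _ := rfl
  mul_one _ := rfl
  inv_mul_cancel φ := by
    ext V h v
    exact (φ.app V h).symm_apply_apply v

theorem mul_app (φ ψ : IsoOn E E U) (V : Opens X) (h : V ≤ U) (v : E.sec V) :
    (φ * ψ).app V h v = φ.app V h (ψ.app V h v) := rfl
theorem one_app (V : Opens X) (h : V ≤ U) (v : E.sec V) :
    (1 : IsoOn E E U).app V h v = v := rfl
theorem inv_app (φ : IsoOn E E U) (V : Opens X) (h : V ≤ U) (v : E.sec V) :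
    φ⁻¹.app V h v = (φ.app V h).symm v := rfl

/-- `φ` identifies the subpresheaf `A` of `E|_U` with the subpresheaf `A'` of `E'|_U`. -/
def Preserves (φ : IsoOn E E' U) (A : SubPsh E.sec) (A' : SubPsh E'.sec) : Prop :=
  ∀ (V : Opens X) (h : V ≤ U) (v : E.sec V), φ.app V h v ∈ A' V ↔ v ∈ A V

theorem Preserves.symm {φ : IsoOn E E' U} {A : SubPsh E.sec} {A' : SubPsh E'.sec}
    (h : φ.Preserves A A') : φ.symm.Preserves A' A := fun V hV v => by
  rw [← h V hV]
  exact iff_of_eq (congrArg (· ∈ A' V) ((φ.app V hV).apply_symm_apply v))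

theorem Preserves.trans {φ : IsoOn E E' U} {ψ : IsoOn E' E'' U} {A : SubPsh E.sec}
    {A' : SubPsh E'.sec} {A'' : SubPsh E''.sec}
    (h : φ.Preserves A A') (h' : ψ.Preserves A' A'') : (φ.trans ψ).Preserves A A'' :=
  fun V hV v => (h' V hV _).trans (h V hV v)

end IsoOn

/-- An isomorphism of `ℤ/2`-graded sheaves of modules: an isomorphism of sheaves of modules which
preserves the parity. -/
def SuperModSheaf.Iso {R : Opens X → Type u} [∀ U, Ring (R U)] [RingPsh R] [SuperRing R]
    (E E' : SuperModSheaf R) : Prop :=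
  ∃ φ : IsoOn E.toModSheaf E'.toModSheaf ⊤, ∀ i, φ.Preserves (E.par i) (E'.par i)

theorem SuperModSheaf.Iso.equivalence {R : Opens X → Type u} [∀ U, Ring (R U)] [RingPsh R]
    [SuperRing R] : Equivalence (SuperModSheaf.Iso (R := R)) where
  refl _ := ⟨IsoOn.refl _ _, fun _ _ _ _ => Iff.rfl⟩
  symm := fun ⟨φ, h⟩ => ⟨φ.symm, fun i => (h i).symm⟩
  trans := fun ⟨φ, h⟩ ⟨ψ, h'⟩ => ⟨φ.trans ψ, fun i => (h i).trans (h' i)⟩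

/-- The left ideal generated by the odd elements. (In a supercommutative ring it is
two-sided.) -/
def oddIdeal (R : Opens X → Type u) [∀ U, Ring (R U)] [RingPsh R] [SuperRing R] (U : Opens X) :
    Ideal (R U) :=
  Ideal.span (SuperRing.par (R := R) 1 U : Set (R U))

section Filtration

variable {R : Opens X → Type u} [∀ U, Ring (R U)] [RingPsh R] [SuperRing R]

theorem res_mem_oddIdeal_pow {U V : Opens X} (h : V ≤ U) (p : ℕ) :
    ∀ {f : R U}, f ∈ oddIdeal R U ^ p → res R h f ∈ oddIdeal R V ^ p := by
  induction p with
  | zero =>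
    intro f _
    rw [Submodule.pow_zero, Ideal.one_eq_top]
    exact Submodule.mem_top
  | succ p ih =>
    intro f hf
    have h1 : oddIdeal R U ≤ (oddIdeal R V).comap (resRing R h) := by
      refine Ideal.span_le.2 fun a ha => Ideal.subset_span ?_
      exact (SuperRing.par (R := R) 1).res_mem h ha
    have h2 : oddIdeal R U ^ (p + 1) ≤ (oddIdeal R V ^ (p + 1)).comap (resRing R h) := by
      rw [Submodule.pow_succ, Submodule.pow_succ]
      refine Ideal.mul_le.2 fun a ha b hb => ?_
      rw [Ideal.mem_comap, map_mul]
      exact Ideal.mul_mem_mul (ih ha) (h1 hb)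
    exact h2 hf

theorem res_mem_pow_smul_top (E : ModSheaf R) {U V : Opens X} (h : V ≤ U) (p : ℕ) {v : E.sec U}
    (hv : v ∈ oddIdeal R U ^ p • (⊤ : Submodule (R U) (E.sec U))) :
    res E.sec h v ∈ oddIdeal R V ^ p • (⊤ : Submodule (R V) (E.sec V)) := by
  refine Submodule.smul_induction_on hv (fun f hf w _ => ?_) (fun a b ha hb => ?_)
  · rw [ModPsh.res_smul (R := R)]
    exact Submodule.smul_mem_smul (res_mem_oddIdeal_pow h p hf) trivial
  · rw [map_add]
    exact add_mem ha hb

/-- The subsheaf `E_(p) = J ^ p E`, where `J` is the sheaf of ideals generated by the odd elements: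
a section belongs to it if locally it is a sum of products of `p` elements of `J` and a section
of `E`. -/
def filt (E : ModSheaf R) (p : ℕ) : SubPsh E.sec where
  carrier U :=
    { carrier := {v | ∀ x ∈ U, ∃ (V : Opens X) (_ : x ∈ V) (h : V ≤ U),
        res E.sec h v ∈ oddIdeal R V ^ p • (⊤ : Submodule (R V) (E.sec V))}
      zero_mem' := fun x hx => ⟨U, hx, le_rfl, by rw [map_zero]; exact zero_mem _⟩
      add_mem' := fun {a b} ha hb x hx => by
        obtain ⟨V, hV, h, m⟩ := ha x hx
        obtain ⟨W, hW, h', m'⟩ := hb x hx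
        refine ⟨V ⊓ W, ⟨hV, hW⟩, inf_le_left.trans h, ?_⟩
        have m₁ := res_mem_pow_smul_top E (inf_le_left : V ⊓ W ≤ V) p m
        have m₂ := res_mem_pow_smul_top E (inf_le_right : V ⊓ W ≤ W) p m'
        rw [res_res] at m₁ m₂
        rw [map_add]
        exact add_mem m₁ m₂
      neg_mem' := fun {a} ha x hx => by
        obtain ⟨V, hV, h, m⟩ := ha x hx
        exact ⟨V, hV, h, by rw [map_neg]; exact neg_mem m⟩ }
  res_mem {U V} h {v} hv x hx := by
    obtain ⟨W, hW, hWU, m⟩ := hv x (h hx)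
    refine ⟨V ⊓ W, ⟨hx, hW⟩, inf_le_left, ?_⟩
    have m₁ := res_mem_pow_smul_top E (inf_le_right : V ⊓ W ≤ W) p m
    rw [res_res] at m₁ ⊢
    exact m₁

theorem smul_mem_filt (E : ModSheaf R) {p q : ℕ} {U : Opens X} {f : R U} {v : E.sec U}
    (hf : f ∈ oddIdeal R U ^ p) (hv : v ∈ filt E q U) : f • v ∈ filt E (p + q) U := by
  intro x hx
  obtain ⟨V, hV, h, m⟩ := hv x hx
  refine ⟨V, hV, h, ?_⟩
  rw [ModPsh.res_smul (R := R)]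
  rcases Nat.eq_zero_or_pos q with rfl | hq
  · exact Submodule.smul_mem_smul (res_mem_oddIdeal_pow h p hf) Submodule.mem_top
  · rw [Submodule.pow_add _ hq.ne', Submodule.mul_smul]
    exact Submodule.smul_mem_smul (res_mem_oddIdeal_pow h p hf) m

theorem IsoOn.preserves_filt {E E' : ModSheaf R} {U : Opens X} (φ : IsoOn E E' U) (p : ℕ) :
    φ.Preserves (filt E p) (filt E' p) := by
  have key : ∀ {E E' : ModSheaf R} (φ : IsoOn E E' U) (V : Opens X) (hV : V ≤ U) (v : E.sec V),
      v ∈ filt E p V → φ.app V hV v ∈ filt E' p V := by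
    intro E E' φ V hV v hv x hx
    obtain ⟨W, hW, h, m⟩ := hv x hx
    refine ⟨W, hW, h, ?_⟩
    rw [φ.res_app hV h]
    have := Submodule.mem_map_of_mem (f := (φ.app W (h.trans hV)).toLinearMap) m
    rw [Submodule.map_smul''] at this
    exact Submodule.smul_mono le_rfl le_top this
  refine fun V hV v => ⟨fun h => ?_, key φ V hV v⟩
  have := key φ.symm V hV _ h
  exact (congrArg (· ∈ filt E p V) ((φ.app V hV).symm_apply_apply v)).mp this

end Filtration

end Modules

section Split

variable {X : Type u} [TopologicalSpace X]

/-- A presheaf of `ℤ/2`-graded rings all of whose elements are even. -/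
class PurelyEven (F : Opens X → Type u) [∀ U, Ring (F U)] [RingPsh F] [SuperRing F] : Prop where
  mem_zero : ∀ {U} (f : F U), f ∈ SuperRing.par 0 U

variable {F : Opens X → Type u} [∀ U, CommRing (F U)] [RingPsh F]

section Exterior

variable (G : ModSheaf F)

/-- The presheaf `U ↦ ⋀_{F(U)} G(U)`. -/
def Ext (U : Opens X) : Type u := ExteriorAlgebra (F U) (G.sec U)

instance (U : Opens X) : Ring (Ext G U) := inferInstanceAs (Ring (ExteriorAlgebra _ _))
instance (U : Opens X) : Algebra (F U) (Ext G U) :=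
  inferInstanceAs (Algebra (F U) (ExteriorAlgebra (F U) (G.sec U)))

/-- The inclusion of `G(U)` in its exterior algebra. -/
def extι (U : Opens X) : G.sec U →ₗ[F U] Ext G U := ExteriorAlgebra.ι (F U)

/-- `⋀ G(V)` as an algebra over `F(U)`, for `V ≤ U`. -/
abbrev extAlgebra {U V : Opens X} (h : V ≤ U) : Algebra (F U) (Ext G V) :=
  ((algebraMap (F V) (Ext G V)).comp (resRing F h)).toAlgebra'
    (fun c x => Algebra.commutes (resRing F h c) x)

/-- The restriction homomorphism of exterior algebras induced by the restriction maps of `F` and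
of `G`. -/
def extRes {U V : Opens X} (h : V ≤ U) : Ext G U →+* Ext G V :=
  letI := extAlgebra G h
  (ExteriorAlgebra.lift (F U) (A := Ext G V)
    ⟨{ toFun := fun g => extι G V (res G.sec h g)
       map_add' := fun a b => by rw [map_add, map_add]
       map_smul' := fun f g => by
        rw [ModPsh.res_smul (R := F), map_smul]
        exact Algebra.smul_def _ _ },
      fun g => ExteriorAlgebra.ι_sq_zero _⟩).toRingHom

theorem extRes_algebraMap {U V : Opens X} (h : V ≤ U) (f : F U) :
    extRes G h (algebraMap (F U) (Ext G U) f) = algebraMap (F V) (Ext G V) (res F h f) :=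
  let := extAlgebra G h
  AlgHom.commutes (ExteriorAlgebra.lift (F U) (A := Ext G V) _) f

theorem extRes_ι {U V : Opens X} (h : V ≤ U) (g : G.sec U) :
    extRes G h (extι G U g) = extι G V (res G.sec h g) :=
  let := extAlgebra G h
  ExteriorAlgebra.lift_ι_apply (F U) (A := Ext G V) _ _ g

theorem ext_induction {U : Opens X} {C : Ext G U → Prop}
    (h₁ : ∀ f, C (algebraMap (F U) (Ext G U) f)) (h₂ : ∀ g, C (extι G U g))
    (h₃ : ∀ a b, C a → C b → C (a * b)) (h₄ : ∀ a b, C a → C b → C (a + b)) (a : Ext G U) :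
    C a :=
  ExteriorAlgebra.induction h₁ h₂ h₃ h₄ a

instance : RingPsh (Ext G) where
  res h := (extRes G h).toAddMonoidHom
  res_self a := by
    refine ext_induction G (C := fun a => extRes G le_rfl a = a) (fun f => ?_) (fun g => ?_)
      (fun a b ha hb => ?_) (fun a b ha hb => ?_) a
    · rw [extRes_algebraMap, res_self]
    · rw [extRes_ι, res_self]
    · rw [map_mul, ha, hb]
    · rw [map_add, ha, hb]
  res_res {U V W} h h' a := by
    refine ext_induction G (C := fun a => extRes G h' (extRes G h a) = extRes G (h'.trans h) a)
      (fun f => ?_) (fun g => ?_) (fun a b ha hb => ?_) (fun a b ha hb => ?_) a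
    · rw [extRes_algebraMap, extRes_algebraMap, extRes_algebraMap, res_res]
    · rw [extRes_ι, extRes_ι, extRes_ι, res_res]
    · rw [map_mul, map_mul, map_mul, ha, hb]
    · rw [map_add, map_add, map_add, ha, hb]
  res_one h := map_one (extRes G h)
  res_mul h := map_mul (extRes G h)

instance : ModPsh F (Ext G) where
  res_smul h f a := by
    rw [Algebra.smul_def, Algebra.smul_def, RingPsh.res_mul]
    congr 1
    exact extRes_algebraMap G h f

/-- The `p`-th exterior power, as a submodule of the exterior algebra. -/
def extPow (p : ℕ) (U : Opens X) : Submodule (F U) (Ext G U) := ⋀[F U]^p (G.sec U)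

instance (U : Opens X) : GradedAlgebra (fun p => extPow G p U) :=
  inferInstanceAs (GradedAlgebra (fun p : ℕ => ⋀[F U]^p (G.sec U)))

theorem extι_mem {U : Opens X} (g : G.sec U) : extι G U g ∈ extPow G 1 U := by
  have h := LinearMap.mem_range_self
    (ExteriorAlgebra.ι (F U) : G.sec U →ₗ[F U] ExteriorAlgebra (F U) (G.sec U)) g
  rw [← pow_one (LinearMap.range _)] at h
  exact h

theorem extRes_mem_extPow {U V : Opens X} (h : V ≤ U) (p : ℕ) :
    ∀ {a : Ext G U}, a ∈ extPow G p U → extRes G h a ∈ extPow G p V := by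
  intro a ha
  refine Submodule.pow_induction_on_left'
    (M := LinearMap.range (ExteriorAlgebra.ι (F U) : G.sec U →ₗ[F U] ExteriorAlgebra _ _))
    (C := fun n b _ => extRes G h b ∈ extPow G n V) (fun f => ?_) (fun a b i _ _ ha hb => ?_)
    (fun g hg i b _ hb => ?_) ha
  · have := extRes_algebraMap G h f
    refine Eq.subst (motive := fun z => z ∈ extPow G 0 V) this.symm ?_
    exact SetLike.algebraMap_mem_graded (fun p => extPow G p V) _
  · exact (map_add (extRes G h) a b) ▸ add_mem ha hb
  · obtain ⟨g, rfl⟩ := hg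
    have e : extRes G h (ExteriorAlgebra.ι (F U) g * b) =
        extι G V (res G.sec h g) * extRes G h b := by
      rw [← extRes_ι]
      exact map_mul (extRes G h) _ _
    refine Eq.subst (motive := fun z => z ∈ extPow G (i + 1) V) e.symm ?_
    have := SetLike.mul_mem_graded (A := fun p => extPow G p V)
      (extι_mem G (res G.sec h g)) hb
    rwa [add_comm] at this

/-- The subpresheaf `U ↦ ⋀^p_{F(U)} G(U)`. -/
def extDeg (p : ℕ) : SubPsh (Ext G) where
  carrier U := (extPow G p U).toAddSubgroup
  res_mem h _ ha := extRes_mem_extPow G h p ha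

/-- The sum of the exterior powers of even (respectively odd) degree. -/
def extEO (i : ZMod 2) (U : Opens X) : Submodule (F U) (Ext G U) :=
  ⨆ j : { n : ℕ // (n : ZMod 2) = i }, extPow G j U

theorem extEO_eq (i : ZMod 2) (U : Opens X) :
    extEO G i U = CliffordAlgebra.evenOdd (0 : QuadraticForm (F U) (G.sec U)) i := rfl

/-- The `ℤ/2`-grading of the presheaf of exterior algebras. -/
def extPar (i : ZMod 2) : SubPsh (Ext G) where
  carrier U := (extEO G i U).toAddSubgroup
  res_mem {U V} h a ha := by
    have ha' : a ∈ ⨆ j : { n : ℕ // (n : ZMod 2) = i }, extPow G j U := ha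
    change extRes G h a ∈ extEO G i V
    induction ha' using Submodule.iSup_induction' with
    | mem j x hx => exact Submodule.mem_iSup_of_mem j (extRes_mem_extPow G h _ hx)
    | zero => rw [map_zero]; exact zero_mem _
    | add x y _ _ hx hy => rw [map_add]; exact add_mem (hx ‹_›) (hy ‹_›)

instance (U : Opens X) : GradedAlgebra (fun i => extEO G i U) :=
  inferInstanceAs (GradedAlgebra (CliffordAlgebra.evenOdd (0 : QuadraticForm (F U) (G.sec U))))

theorem extEO_isCompl (U : Opens X) : IsCompl (extEO G 0 U) (extEO G 1 U) :=
  (DirectSum.Decomposition.isInternal (fun i => extEO G i U)).isCompl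
    (i := 0) (j := 1) (by decide) (Set.eq_univ_of_forall (by decide)).symm

theorem isCompl_toAddSubgroup {A M : Type*} [Ring A] [AddCommGroup M] [Module A M]
    {N N' : Submodule A M} (h : IsCompl N N') : IsCompl N.toAddSubgroup N'.toAddSubgroup := by
  constructor
  · rw [AddSubgroup.disjoint_def]
    intro x hx hx'
    exact Submodule.disjoint_def.1 h.disjoint x hx hx'
  · rw [codisjoint_iff_le_sup]
    intro x _
    obtain ⟨a, ha, b, hb, e⟩ := Submodule.mem_sup.1
      (h.codisjoint.top_le (Submodule.mem_top (x := x)))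
    exact AddSubgroup.mem_sup.2 ⟨a, ha, b, hb, e⟩

theorem extPar_isCompl (U : Opens X) : IsCompl (extPar G 0 U) (extPar G 1 U) := by
  exact isCompl_toAddSubgroup (extEO_isCompl G U)

/-- The structure sheaf `⋀_F G` of the split supermanifold defined by `G`: the sheaf associated
with `U ↦ ⋀_{F(U)} G(U)`. -/
abbrev SplitSheaf (U : Opens X) : Type u := Shf (Ext G) U

instance : SuperRing (Shf (Ext G)) where
  par i := Shf.sub (extPar G i)
  isCompl U := Shf.isCompl_sub (extPar_isCompl G) U
  one_mem U x := ⟨U, x.2, le_rfl, 1, SetLike.one_mem_graded (fun i => extEO G i U),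
    fun y hy => (germ_one hy).symm⟩
  mul_mem {U i j s t} hs ht x := by
    obtain ⟨V, hx, h, a, ha, e⟩ := hs x
    obtain ⟨V', hx', h', a', ha', e'⟩ := ht x
    refine ⟨V ⊓ V', ⟨hx, hx'⟩, inf_le_left.trans h,
      res (Ext G) (inf_le_left : V ⊓ V' ≤ V) a * res (Ext G) (inf_le_right : V ⊓ V' ≤ V') a',
      SetLike.mul_mem_graded (A := fun i => extEO G i (V ⊓ V'))
        ((extPar G i).res_mem inf_le_left ha) ((extPar G j).res_mem inf_le_right ha'),
      fun y hy => ?_⟩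
    rw [germ_mul, germ_res (inf_le_left : V ⊓ V' ≤ V) hy a,
      germ_res (inf_le_right : V ⊓ V' ≤ V') hy a', ← e y hy.1, ← e' y hy.2]
    rfl

end Exterior

section Tensor

variable [SuperRing F] (G : ModSheaf F) (S : SuperModSheaf F)

/-- The presheaf `U ↦ ⋀_{F(U)} G(U) ⊗_{F(U)} S(U)`. -/
def Ten (U : Opens X) : Type u := Ext G U ⊗[F U] S.sec U

instance (U : Opens X) : AddCommGroup (Ten G S U) :=
  inferInstanceAs (AddCommGroup (Ext G U ⊗[F U] S.sec U))
instance (U : Opens X) : Module (Ext G U) (Ten G S U) :=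
  inferInstanceAs (Module (Ext G U) (Ext G U ⊗[F U] S.sec U))

variable {G S} in
/-- The pure tensor `a ⊗ s`. -/
def tmul {U : Opens X} (a : Ext G U) (s : S.sec U) : Ten G S U := a ⊗ₜ[F U] s

theorem ten_induction {U : Opens X} {C : Ten G S U → Prop} (h₀ : C 0)
    (h₁ : ∀ a s, C (tmul a s)) (h₂ : ∀ v w, C v → C w → C (v + w)) (v : Ten G S U) : C v :=
  TensorProduct.induction_on v h₀ h₁ h₂

/-- The restriction maps of the presheaf of tensor products: `a ⊗ s ↦ a|_V ⊗ s|_V`. -/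
def tenRes {U V : Opens X} (h : V ≤ U) : Ten G S U →+ Ten G S V :=
  TensorProduct.liftAddHom
    (AddMonoidHom.mk' (fun a => AddMonoidHom.mk'
        (fun s => (res (Ext G) h a ⊗ₜ[F V] res S.sec h s : Ext G V ⊗[F V] S.sec V))
        (fun s t => by rw [map_add]; exact TensorProduct.tmul_add _ _ _))
      (fun a b => by
        ext s
        change res (Ext G) h (a + b) ⊗ₜ[F V] _ = _
        rw [map_add, TensorProduct.add_tmul]
        rfl))
    (fun f a s => by
      change res (Ext G) h (f • a) ⊗ₜ[F V] _ = _ ⊗ₜ[F V] res S.sec h (f • s)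
      rw [ModPsh.res_smul (R := F), ModPsh.res_smul (R := F)]
      exact TensorProduct.smul_tmul _ _ _)

theorem tenRes_tmul {U V : Opens X} (h : V ≤ U) (a : Ext G U) (s : S.sec U) :
    tenRes G S h (tmul a s) = tmul (res (Ext G) h a) (res S.sec h s) := rfl

instance : AddPsh (Ten G S) where
  res h := tenRes G S h
  res_self {U} a := by
    induction a using ten_induction with
    | h₀ => exact map_zero _
    | h₁ a s => rw [tenRes_tmul, res_self, res_self]
    | h₂ v w hv hw => rw [map_add, hv, hw]
  res_res {U V W} h h' a := by
    induction a using ten_induction with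
    | h₀ => rw [map_zero, map_zero, map_zero]
    | h₁ a s => rw [tenRes_tmul, tenRes_tmul, tenRes_tmul, res_res, res_res]
    | h₂ v w hv hw => rw [map_add, map_add, map_add, hv, hw]

theorem res_tmul {U V : Opens X} (h : V ≤ U) (a : Ext G U) (s : S.sec U) :
    res (Ten G S) h (tmul a s) = tmul (res (Ext G) h a) (res S.sec h s) := rfl

theorem smul_tmul {U : Opens X} (a b : Ext G U) (s : S.sec U) :
    a • tmul b s = tmul (a * b) s := rfl

instance : ModPsh (Ext G) (Ten G S) where
  res_smul {U V} h f v := by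
    induction v using ten_induction with
    | h₀ => rw [smul_zero, map_zero, smul_zero]
    | h₁ a s => rw [smul_tmul, res_tmul, res_tmul, smul_tmul, RingPsh.res_mul]
    | h₂ v w hv hw => rw [smul_add, map_add, map_add, smul_add, hv, hw]

/-- The degree `p` part of the presheaf of tensor products: the image of `⋀^p G ⊗ S`. -/
def tenDeg (p : ℕ) : SubPsh (Ten G S) where
  carrier U := AddSubgroup.closure {v | ∃ a ∈ extDeg G p U, ∃ s, v = tmul a s}
  res_mem {U V} h a ha := by
    induction ha using AddSubgroup.closure_induction with
    | mem v hv =>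
      obtain ⟨a, ha, s, rfl⟩ := hv
      exact AddSubgroup.subset_closure ⟨_, (extDeg G p).res_mem h ha, _, res_tmul G S h a s⟩
    | zero => rw [map_zero]; exact zero_mem _
    | add v w _ _ hv hw => rw [map_add]; exact add_mem hv hw
    | neg v _ hv => rw [map_neg]; exact neg_mem hv

/-- The parity of the presheaf of tensor products: `a ⊗ s` has parity `i + j` if `a` and `s` have
parities `i` and `j`. -/
def tenPar (k : ZMod 2) : SubPsh (Ten G S) where
  carrier U := AddSubgroup.closure
    {v | ∃ i j, i + j = k ∧ ∃ a ∈ extPar G i U, ∃ s ∈ S.par j U, v = tmul a s}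
  res_mem {U V} h a ha := by
    induction ha using AddSubgroup.closure_induction with
    | mem v hv =>
      obtain ⟨i, j, hk, a, ha, s, hs, rfl⟩ := hv
      exact AddSubgroup.subset_closure ⟨i, j, hk, _, (extPar G i).res_mem h ha, _,
        (S.par j).res_mem h hs, res_tmul G S h a s⟩
    | zero => rw [map_zero]; exact zero_mem _
    | add v w _ _ hv hw => rw [map_add]; exact add_mem hv hw
    | neg v _ hv => rw [map_neg]; exact neg_mem hv

theorem smul_mem_tenPar {U : Opens X} {i j : ZMod 2} {a : Ext G U} {v : Ten G S U}
    (ha : a ∈ extPar G i U) (hv : v ∈ tenPar G S j U) : a • v ∈ tenPar G S (i + j) U := by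
  induction hv using AddSubgroup.closure_induction with
  | mem v hv =>
    obtain ⟨k, l, rfl, b, hb, s, hs, rfl⟩ := hv
    exact AddSubgroup.subset_closure ⟨i + k, l, add_assoc _ _ _, a * b,
      SetLike.mul_mem_graded (A := fun i => extEO G i U) ha hb, s, hs, smul_tmul G S a b s⟩
  | zero => rw [smul_zero]; exact zero_mem _
  | add v w _ _ hv hw => rw [smul_add]; exact add_mem hv hw
  | neg v _ hv => rw [smul_neg]; exact neg_mem hv

variable [PurelyEven F]

/-- Over a purely even ring the homogeneous parts are submodules. -/
def parSubmodule (i : ZMod 2) (U : Opens X) : Submodule (F U) (S.sec U) :=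
  { S.par i U with
    smul_mem' := fun f s hs => by
      have := S.smul_mem (PurelyEven.mem_zero f) (show s ∈ S.par i U from hs)
      rwa [zero_add] at this }

theorem parSubmodule_isCompl (U : Opens X) :
    IsCompl (parSubmodule S 0 U) (parSubmodule S 1 U) := by
  constructor
  · rw [Submodule.disjoint_def]
    exact fun x h h' => AddSubgroup.disjoint_def.1 (S.isCompl U).disjoint h h'
  · rw [codisjoint_iff_le_sup]
    intro x _
    obtain ⟨a, ha, b, hb, e⟩ := AddSubgroup.mem_sup.1
      ((S.isCompl U).codisjoint.top_le (AddSubgroup.mem_top x))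
    exact Submodule.mem_sup.2 ⟨a, ha, b, hb, e⟩

theorem tenPar_isCompl (U : Opens X) : IsCompl (tenPar G S 0 U) (tenPar G S 1 U) := by
  let p := Submodule.projection _ _ (extEO_isCompl G U)
  let q := Submodule.projection _ _ (parSubmodule_isCompl S U)
  have hp0 : ∀ a ∈ extPar G 0 U, p a = a := fun a ha =>
    Submodule.projection_apply_left (extEO_isCompl G U) ⟨a, ha⟩
  have hp1 : ∀ a ∈ extPar G 1 U, p a = 0 := fun a ha =>
    (Submodule.projection_apply_eq_zero_iff (extEO_isCompl G U)).2 ha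
  have hq0 : ∀ a ∈ S.par 0 U, q a = a := fun a ha =>
    Submodule.projection_apply_left (parSubmodule_isCompl S U) ⟨a, ha⟩
  have hq1 : ∀ a ∈ S.par 1 U, q a = 0 := fun a ha =>
    (Submodule.projection_apply_eq_zero_iff (parSubmodule_isCompl S U)).2 ha
  let π : Ext G U ⊗[F U] S.sec U →ₗ[F U] Ext G U ⊗[F U] S.sec U :=
    TensorProduct.map p q + TensorProduct.map (LinearMap.id - p) (LinearMap.id - q)
  have hπ : ∀ (a : Ext G U) (s : S.sec U),
      π (a ⊗ₜ s) = p a ⊗ₜ q s + (a - p a) ⊗ₜ (s - q s) := fun _ _ => rfl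
  have cases2 : ∀ i j k : ZMod 2, i + j = k → (k = 0 → (i = 0 ∧ j = 0) ∨ (i = 1 ∧ j = 1)) ∧
      (k = 1 → (i = 0 ∧ j = 1) ∨ (i = 1 ∧ j = 0)) := by decide
  have h0 : ∀ v ∈ tenPar G S 0 U, π v = v := by
    intro v hv
    induction hv using AddSubgroup.closure_induction with
    | mem v hv =>
      obtain ⟨i, j, hk, a, ha, s, hs, rfl⟩ := hv
      rcases (cases2 i j 0 hk).1 rfl with ⟨rfl, rfl⟩ | ⟨rfl, rfl⟩
      · refine (hπ a s).trans ?_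
        rw [hp0 a ha, hq0 s hs, sub_self, TensorProduct.zero_tmul, add_zero]
        rfl
      · refine (hπ a s).trans ?_
        rw [hp1 a ha, hq1 s hs, sub_zero, sub_zero, TensorProduct.zero_tmul, zero_add]
        rfl
    | zero => exact map_zero π
    | add v w _ _ hv hw => exact (map_add π v w).trans (congrArg₂ (· + ·) hv hw)
    | neg v _ hv => exact (map_neg π v).trans (congrArg _ hv)
  have h1 : ∀ v ∈ tenPar G S 1 U, π v = (0 : Ten G S U) := by
    intro v hv
    induction hv using AddSubgroup.closure_induction with
    | mem v hv =>
      obtain ⟨i, j, hk, a, ha, s, hs, rfl⟩ := hv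
      rcases (cases2 i j 1 hk).2 rfl with ⟨rfl, rfl⟩ | ⟨rfl, rfl⟩
      · refine (hπ a s).trans ?_
        rw [hp0 a ha, hq1 s hs, sub_self, TensorProduct.zero_tmul, TensorProduct.tmul_zero,
          add_zero]
        rfl
      · refine (hπ a s).trans ?_
        rw [hp1 a ha, hq0 s hs, sub_self, TensorProduct.zero_tmul, TensorProduct.tmul_zero,
          add_zero]
        rfl
    | zero => exact map_zero π
    | add v w _ _ hv hw =>
      exact (map_add π v w).trans ((congrArg₂ (· + ·) hv hw).trans (add_zero (0 : Ten G S U)))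
    | neg v _ hv =>
      exact (map_neg π v).trans ((congrArg Neg.neg hv).trans (neg_zero (G := Ten G S U)))
  constructor
  · rw [AddSubgroup.disjoint_def]
    intro v hv hv'
    exact (h0 v hv).symm.trans (h1 v hv')
  · rw [codisjoint_iff_le_sup]
    intro v _
    induction v using ten_induction with
    | h₀ => exact zero_mem _
    | h₁ a s =>
      obtain ⟨a₀, ha₀, a₁, ha₁, rfl⟩ := AddSubgroup.mem_sup.1
        ((extPar_isCompl G U).codisjoint.top_le (AddSubgroup.mem_top a))
      obtain ⟨s₀, hs₀, s₁, hs₁, rfl⟩ := AddSubgroup.mem_sup.1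
        ((S.isCompl U).codisjoint.top_le (AddSubgroup.mem_top s))
      have e : tmul (a₀ + a₁) (s₀ + s₁) =
          ((tmul a₀ s₀ + tmul a₁ s₁) + (tmul a₀ s₁ + tmul a₁ s₀) : Ten G S U) := by
        change (a₀ + a₁) ⊗ₜ[F U] (s₀ + s₁) = (a₀ ⊗ₜ[F U] s₀ + a₁ ⊗ₜ[F U] s₁) +
          (a₀ ⊗ₜ[F U] s₁ + a₁ ⊗ₜ[F U] s₀)
        rw [TensorProduct.add_tmul, TensorProduct.tmul_add, TensorProduct.tmul_add]
        abel
      rw [e]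
      exact AddSubgroup.add_mem_sup
        (add_mem (AddSubgroup.subset_closure ⟨0, 0, by decide, a₀, ha₀, s₀, hs₀, rfl⟩)
          (AddSubgroup.subset_closure ⟨1, 1, by decide, a₁, ha₁, s₁, hs₁, rfl⟩))
        (add_mem (AddSubgroup.subset_closure ⟨0, 1, by decide, a₀, ha₀, s₁, hs₁, rfl⟩)
          (AddSubgroup.subset_closure ⟨1, 0, by decide, a₁, ha₁, s₀, hs₀, rfl⟩))
    | h₂ v w hv hw => exact add_mem (hv (AddSubgroup.mem_top _)) (hw (AddSubgroup.mem_top _))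

/-- The sheaf `E_gr = O ⊗_F S`, where `O = ⋀_F G`, with its `ℤ/2`-grading: the sheaf associated
with `U ↦ ⋀_{F(U)} G(U) ⊗_{F(U)} S(U)`. -/
def Egr : SuperModSheaf (Shf (Ext G)) where
  toModSheaf := Shf.modSheaf (Ext G) (Ten G S)
  par k := Shf.sub (tenPar G S k)
  isCompl U := Shf.isCompl_sub (tenPar_isCompl G S) U
  smul_mem {U i j f v} hf hv x := by
    obtain ⟨V, hx, h, a, ha, e⟩ := hf x
    obtain ⟨V', hx', h', a', ha', e'⟩ := hv x
    refine ⟨V ⊓ V', ⟨hx, hx'⟩, inf_le_left.trans h,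
      res (Ext G) (inf_le_left : V ⊓ V' ≤ V) a • res (Ten G S) (inf_le_right : V ⊓ V' ≤ V') a',
      smul_mem_tenPar G S ((extPar G i).res_mem inf_le_left ha)
        ((tenPar G S j).res_mem inf_le_right ha'),
      fun y hy => ?_⟩
    rw [germ_smul', germ_res (inf_le_left : V ⊓ V' ≤ V) hy a,
      germ_res (inf_le_right : V ⊓ V' ≤ V') hy a', ← e y hy.1, ← e' y hy.2]
    rfl

/-- The `ℤ`-grading of `E_gr`: its part of degree `p` is the image of `⋀^p G ⊗ S`. -/
def EgrDeg (p : ℕ) : SubPsh (Egr G S).sec := Shf.sub (tenDeg G S p)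

end Tensor

end Split

section Retract

variable {X : Type u} [TopologicalSpace X] {F : Opens X → Type u} [∀ U, CommRing (F U)]
  [RingPsh F] (G : ModSheaf F)

theorem mkRing_mem_oddIdeal_pow {U : Opens X} {p : ℕ} {a : Ext G U} (ha : a ∈ extPow G p U) :
    Shf.mkRing U a ∈ oddIdeal (Shf (Ext G)) U ^ p := by
  refine Submodule.pow_induction_on_right'
    (M := LinearMap.range (ExteriorAlgebra.ι (F U) : G.sec U →ₗ[F U] ExteriorAlgebra _ _))
    (C := fun n b _ => Shf.mkRing U (b : Ext G U) ∈ oddIdeal (Shf (Ext G)) U ^ n)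
    (fun f => ?_) (fun a b i _ _ ha hb => ?_) (fun i b _ hb g hg => ?_) ha
  · rw [Submodule.pow_zero, Ideal.one_eq_top]
    exact Submodule.mem_top
  · exact (map_add (Shf.mkRing (R := Ext G) U) a b) ▸ add_mem ha hb
  · obtain ⟨g, rfl⟩ := hg
    let b' : Ext G U := b
    have e : Shf.mkRing U (b' * extι G U g) =
      Shf.mkRing U b' * Shf.mkRing U (extι G U g) := map_mul _ _ _
    refine Eq.subst (motive := fun z => z ∈ oddIdeal (Shf (Ext G)) U ^ (i + 1)) e.symm ?_
    rw [Submodule.pow_succ]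
    refine Ideal.mul_mem_mul hb (Ideal.subset_span ?_)
    exact fun x => ⟨U, x.2, le_rfl, extι G U g,
      CliffordAlgebra.ι_mem_evenOdd_one (0 : QuadraticForm (F U) (G.sec U)) g, fun _ _ => rfl⟩

variable {G} (E : SuperModSheaf (Shf (Ext G)))

/-- The quotient `E_(q)(U) / E_(q+1)(U)`. -/
abbrev GrPiece (U : Opens X) (q : ℕ) : Type u :=
  filt E.toModSheaf q U ⧸ (filt E.toModSheaf (q + 1) U).addSubgroupOf (filt E.toModSheaf q U)

variable {E} in
/-- The class in `E_(q)(U) / E_(q+1)(U)` of a section of `E_(q)`. -/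
def GrPiece.mk {U : Opens X} {q : ℕ} (v : filt E.toModSheaf q U) : GrPiece E U q :=
  QuotientAddGroup.mk v

/-- Multiplication by `a ∈ ⋀^p G(U)`, as a map from `E_(q)/E_(q+1)` to `E_(p+q)/E_(p+q+1)`. -/
def grSMul {U : Opens X} {p : ℕ} (a : extPow G p U) (q : ℕ) :
    GrPiece E U q →+ GrPiece E U (p + q) :=
  QuotientAddGroup.map _ _
    (AddMonoidHom.mk' (fun v : filt E.toModSheaf q U =>
        (⟨Shf.mkRing U a.1 • v.1, smul_mem_filt _ (mkRing_mem_oddIdeal_pow G a.2) v.2⟩ :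
          filt E.toModSheaf (p + q) U))
      (fun _ _ => Subtype.ext (smul_add _ _ _)))
    (fun _ hv => smul_mem_filt (p := p) (q := q + 1) _ (mkRing_mem_oddIdeal_pow G a.2) hv)

theorem grSMul_mk {U : Opens X} {p : ℕ} (a : extPow G p U) {q : ℕ} (v : filt E.toModSheaf q U) :
    grSMul E a q (GrPiece.mk v) = GrPiece.mk ⟨Shf.mkRing U a.1 • v.1,
      smul_mem_filt _ (mkRing_mem_oddIdeal_pow G a.2) v.2⟩ := rfl

theorem gr_mk_eq {U : Opens X} {i j : ℕ} (h : i = j) {v : filt E.toModSheaf i U}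
    {w : filt E.toModSheaf j U} (e : v.1 = w.1) :
    GradedMonoid.mk (A := GrPiece E U) i (GrPiece.mk v) = GradedMonoid.mk j (GrPiece.mk w) := by
  subst h
  rw [Subtype.ext e]

instance (U : Opens X) : DirectSum.Gmodule (fun p => extPow G p U) (GrPiece E U) where
  smul {p q} a v := grSMul E a q v
  one_smul := by
    rintro ⟨q, v⟩
    obtain ⟨v, rfl⟩ := QuotientAddGroup.mk_surjective v
    exact gr_mk_eq E (zero_add q)
      ((congrArg (fun z : Shf (Ext G) U => z • v.1) (map_one (Shf.mkRing U))).trans (one_smul _ _))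
  mul_smul := by
    rintro ⟨p, a⟩ ⟨p', a'⟩ ⟨q, v⟩
    obtain ⟨v, rfl⟩ := QuotientAddGroup.mk_surjective v
    exact gr_mk_eq E (add_assoc p p' q)
      ((congrArg (fun z : Shf (Ext G) U => z • v.1)
        (map_mul (Shf.mkRing U) a.1 a'.1)).trans (mul_smul _ _ _))
  smul_add a v w := map_add _ _ _
  smul_zero a := map_zero _
  add_smul a b v := by
    obtain ⟨v, rfl⟩ := QuotientAddGroup.mk_surjective v
    exact congrArg GrPiece.mk (Subtype.ext
      ((congrArg (fun z : Shf (Ext G) U => z • v.1) (map_add (Shf.mkRing U) a.1 b.1)).trans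
        (add_smul _ _ _)))
  zero_smul v := by
    obtain ⟨v, rfl⟩ := QuotientAddGroup.mk_surjective v
    exact congrArg GrPiece.mk (Subtype.ext
      ((congrArg (fun z : Shf (Ext G) U => z • v.1) (map_zero (Shf.mkRing (R := Ext G) U))).trans
        (zero_smul _ _)))

/-- The presheaf `U ↦ ⨁_q E_(q)(U) / E_(q+1)(U)`. -/
def GrPre (U : Opens X) : Type u := ⨁ q, GrPiece E U q

instance (U : Opens X) : AddCommGroup (GrPre E U) :=
  inferInstanceAs (AddCommGroup (⨁ q, GrPiece E U q))

/-- The graded module structure of `⨁_q E_(q)(U) / E_(q+1)(U)` over `⋀ G(U) = ⨁_p ⋀^p G(U)`. -/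
instance (U : Opens X) : Module (Ext G U) (GrPre E U) :=
  letI : Module (⨁ p, extPow G p U) (GrPre E U) :=
    inferInstanceAs (Module (⨁ p, extPow G p U) (⨁ q, GrPiece E U q))
  Module.compHom (GrPre E U)
    (DirectSum.decomposeRingEquiv (fun p => extPow G p U)).toRingHom

variable {E} in
/-- The class in degree `q` of a section of `E_(q)`. -/
def grOf {U : Opens X} {q : ℕ} (v : filt E.toModSheaf q U) : GrPre E U :=
  DirectSum.of (GrPiece E U) q (GrPiece.mk v)

theorem grPre_induction {U : Opens X} {C : GrPre E U → Prop} (h₀ : C 0)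
    (h₁ : ∀ (q : ℕ) (v : filt E.toModSheaf q U), C (grOf v))
    (h₂ : ∀ v w, C v → C w → C (v + w)) (v : GrPre E U) : C v := by
  refine DirectSum.induction_on v h₀ (fun q v => ?_) h₂
  obtain ⟨v, rfl⟩ := QuotientAddGroup.mk_surjective v
  exact h₁ q v

theorem smul_grOf {U : Opens X} {p q : ℕ} (a : extPow G p U) (v : filt E.toModSheaf q U) :
    (a : Ext G U) • grOf v = grOf (⟨Shf.mkRing U a.1 • v.1,
      smul_mem_filt _ (mkRing_mem_oddIdeal_pow G a.2) v.2⟩ : filt E.toModSheaf (p + q) U) := by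
  change (DirectSum.decompose (fun p => extPow G p U) (a : Ext G U)) •
    DirectSum.of (GrPiece E U) q (GrPiece.mk v) = _
  rw [DirectSum.decompose_coe, DirectSum.Gmodule.of_smul_of]
  rfl

/-- The restriction maps of `U ↦ E_(q)(U) / E_(q+1)(U)`. -/
def grPieceRes {U V : Opens X} (h : V ≤ U) (q : ℕ) : GrPiece E U q →+ GrPiece E V q :=
  QuotientAddGroup.map _ _
    (AddMonoidHom.mk' (fun v : filt E.toModSheaf q U =>
        (⟨res E.sec h v.1, (filt E.toModSheaf q).res_mem h v.2⟩ : filt E.toModSheaf q V))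
      (fun _ _ => Subtype.ext (map_add _ _ _)))
    (fun _ hv => (filt E.toModSheaf (q + 1)).res_mem h hv)

/-- The restriction maps of `U ↦ ⨁_q E_(q)(U) / E_(q+1)(U)`. -/
def grRes {U V : Opens X} (h : V ≤ U) : GrPre E U →+ GrPre E V :=
  DirectSum.map (grPieceRes E h)

theorem grRes_grOf {U V : Opens X} (h : V ≤ U) {q : ℕ} (v : filt E.toModSheaf q U) :
    grRes E h (grOf v) = grOf (⟨res E.sec h v.1, (filt E.toModSheaf q).res_mem h v.2⟩ :
      filt E.toModSheaf q V) :=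
  DirectSum.map_of _ _ _

instance : AddPsh (GrPre E) where
  res h := grRes E h
  res_self {U} v := by
    induction v using grPre_induction with
    | h₀ => exact map_zero _
    | h₁ q v => rw [grRes_grOf]; exact congrArg grOf (Subtype.ext (res_self _ _))
    | h₂ v w hv hw => rw [map_add, hv, hw]
  res_res {U V W} h h' v := by
    induction v using grPre_induction with
    | h₀ => rw [map_zero, map_zero, map_zero]
    | h₁ q v =>
      rw [grRes_grOf, grRes_grOf, grRes_grOf]
      exact congrArg grOf (Subtype.ext (res_res _ _ _ _))
    | h₂ v w hv hw => rw [map_add, map_add, map_add, hv, hw]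

theorem res_grOf {U V : Opens X} (h : V ≤ U) {q : ℕ} (v : filt E.toModSheaf q U) :
    res (GrPre E) h (grOf v) = grOf (⟨res E.sec h v.1, (filt E.toModSheaf q).res_mem h v.2⟩ :
      filt E.toModSheaf q V) := grRes_grOf E h v

instance : ModPsh (Ext G) (GrPre E) where
  res_smul {U V} h f v := by
    induction v using grPre_induction with
    | h₀ => rw [smul_zero, map_zero, smul_zero]
    | h₂ v w hv hw => rw [smul_add, map_add, map_add, smul_add, hv, hw]
    | h₁ q v =>
      induction f using DirectSum.Decomposition.inductionOn (fun p => extPow G p U) with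
      | zero => rw [zero_smul, map_zero, map_zero, zero_smul]
      | add a b ha hb => rw [add_smul, map_add, map_add, add_smul, ha, hb]
      | @homogeneous p a =>
        rw [smul_grOf, res_grOf, res_grOf]
        have e := smul_grOf E (⟨res (Ext G) h a.1, (extDeg G p).res_mem h a.2⟩ : extPow G p V)
          (⟨res E.sec h v.1, (filt E.toModSheaf q).res_mem h v.2⟩ : filt E.toModSheaf q V)
        refine Eq.trans ?_ e.symm
        refine congrArg grOf (Subtype.ext ?_)
        refine (ModPsh.res_smul (R := Shf (Ext G)) h _ _).trans ?_
        exact congrArg (fun z : Shf (Ext G) V => z • res E.sec h v.1) (Shf.res_mk h a.1)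

/-- The retract `gr E = ⨁_q E_(q) / E_(q+1)` of `E`, as a sheaf of modules over
`O = ⋀ G = gr O`. -/
def grSheaf : ModSheaf (Shf (Ext G)) := Shf.modSheaf (Ext G) (GrPre E)

/-- The classes of the sections of `E_(q)` lying in the subpresheaf `A` of `E`. -/
def grSub (q : ℕ) (A : SubPsh E.sec) : SubPsh (GrPre E) where
  carrier U := AddSubgroup.closure {w | ∃ v : filt E.toModSheaf q U, v.1 ∈ A U ∧ w = grOf v}
  res_mem {U V} h a ha := by
    induction ha using AddSubgroup.closure_induction with
    | mem w hw =>
      obtain ⟨v, hv, rfl⟩ := hw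
      exact AddSubgroup.subset_closure ⟨_, A.res_mem h hv, res_grOf E h v⟩
    | zero => rw [map_zero]; exact zero_mem _
    | add v w _ _ hv hw => rw [map_add]; exact add_mem hv hw
    | neg v _ hv => rw [map_neg]; exact neg_mem hv

/-- The `ℤ`-grading of `gr E`: its part of degree `q` is `E_(q) / E_(q+1)`. -/
def grDeg (q : ℕ) : SubPsh (grSheaf E).sec := Shf.sub (grSub E q (SubPsh.whole E.sec))

/-- The `ℤ/2`-grading of the presheaf `⨁_q E_(q) / E_(q+1)`, induced by that of `E`. -/
def grPrePar (i : ZMod 2) : SubPsh (GrPre E) where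
  carrier U := ⨆ q, grSub E q (E.par i) U
  res_mem {U V} h a ha := by
    have hle : (⨆ q, grSub E q (E.par i) U) ≤
        (⨆ q, grSub E q (E.par i) V).comap (res (GrPre E) h) :=
      iSup_le fun q v hv => AddSubgroup.mem_iSup_of_mem q ((grSub E q (E.par i)).res_mem h hv)
    exact hle ha

/-- The `ℤ/2`-grading of `gr E`, induced by that of `E`. -/
def grPar (i : ZMod 2) : SubPsh (grSheaf E).sec := Shf.sub (grPrePar E i)

variable {E} in
/-- The class in `E_(q) / E_(q+1)`, the degree `q` part of `gr E`, of a section of `E_(q)`. -/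
def symbol {U : Opens X} {q : ℕ} (v : filt E.toModSheaf q U) : (grSheaf E).sec U :=
  Shf.mk U (grOf v)

variable [SuperRing F] [PurelyEven F] (S : SuperModSheaf F)

/-- An isomorphism `gr E ≃ E_gr = O ⊗_F S` of sheaves of `O`-modules, preserving the `ℤ`-gradings
and the `ℤ/2`-gradings. -/
structure GrIso where
  iso : IsoOn (grSheaf E) (Egr G S).toModSheaf ⊤
  preserves_deg : ∀ q, iso.Preserves (grDeg E q) (EgrDeg G S q)
  preserves_par : ∀ i, iso.Preserves (grPar E i) ((Egr G S).par i)

end Retract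

section Cohomology

open CategoryTheory Opposite

variable {X : Type u} [TopologicalSpace X] (Q : (Opens X)ᵒᵖ ⥤ GrpCat.{u})

/-- The pull-back of a `1`-cocycle along a refinement `W k ≤ U (r k)`. -/
def refineCocycle {Q : (Opens X)ᵒᵖ ⥤ GrpCat.{u}} {ι κ : Type u} {U : ι → Opens X}
    (g : PresheafOfGroups.OneCocycle Q U) (W : κ → Opens X) (r : κ → ι)
    (h : ∀ k, W k ≤ U (r k)) : PresheafOfGroups.OneCocycle Q W where
  ev i j _ a b := g.ev (r i) (r j) (a ≫ homOfLE (h i)) (b ≫ homOfLE (h j))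
  ev_precomp _ _ _ _ f _ _ := g.ev_precomp _ _ f _ _
  ev_trans _ _ _ _ _ _ _ := g.ev_trans _ _ _ _ _ _

/-- A `1`-cocycle `g_{ij}`, `g_{ij} g_{jk} = g_{ik}`, with values in `Q` on some open covering of
`X`. -/
structure Cocycle where
  ι : Type u
  cov : ι → Opens X
  iSup_cov : ⨆ i, cov i = ⊤
  toCocycle : PresheafOfGroups.OneCocycle Q cov

/-- Two cocycles (on possibly different coverings) are equivalent if they become cohomologous
after pulling them back to a common refinement of the coverings. -/
def Cocycle.Equiv (c d : Cocycle Q) : Prop :=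
  ∃ (κ : Type u) (W : κ → Opens X) (_ : ⨆ k, W k = ⊤) (r : κ → c.ι) (s : κ → d.ι)
    (h : ∀ k, W k ≤ c.cov (r k)) (h' : ∀ k, W k ≤ d.cov (s k)),
    (refineCocycle c.toCocycle W r h).IsCohomologous (refineCocycle d.toCocycle W s h')

/-- The first (non-abelian) Cech cohomology set `H¹(X, Q)`. -/
def H1 : Type (u + 1) := Quot (Cocycle.Equiv Q)

/-- The trivial cocycle on the covering of `X` by `X`. -/
def Cocycle.unit : Cocycle Q where
  ι := PUnit
  cov _ := ⊤
  iSup_cov := iSup_const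
  toCocycle := 1

variable {Q} in
/-- The cohomology class of a cocycle. -/
def Cocycle.cls (c : Cocycle Q) : H1 Q := Quot.mk _ c

/-- The unit of `H¹(X, Q)` is the class of the trivial cocycle. -/
instance : One (H1 Q) := ⟨(Cocycle.unit Q).cls⟩

end Cohomology

section Aut

open CategoryTheory Opposite

variable {X : Type u} [TopologicalSpace X] {R : Opens X → Type u} [∀ U, Ring (R U)] [RingPsh R]

namespace IsoOn

/-- Restriction of automorphisms, as a group homomorphism. -/
def restrictHom (E : ModSheaf R) {U V : Opens X} (h : V ≤ U) : IsoOn E E U →* IsoOn E E V where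
  toFun φ := φ.restrict h
  map_one' := rfl
  map_mul' _ _ := rfl

end IsoOn

variable [SuperRing R] (E : SuperModSheaf R)

/-- The group of the automorphisms of the `ℤ/2`-graded sheaf of modules `E|_U`, that is, of the
parity preserving `R`-linear automorphisms of `E|_U`. -/
def SAut (U : Opens X) : Subgroup (IsoOn E.toModSheaf E.toModSheaf U) where
  carrier := {φ | ∀ i, φ.Preserves (E.par i) (E.par i)}
  one_mem' _ _ _ _ := Iff.rfl
  mul_mem' hφ hψ i := (hψ i).trans (hφ i)
  inv_mem' hφ i := (hφ i).symm

/-- Restriction of automorphisms. -/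
def SAut.res {U V : Opens X} (h : V ≤ U) : SAut E U →* SAut E V :=
  ((IsoOn.restrictHom E.toModSheaf h).comp (SAut E U).subtype).codRestrict (SAut E V)
    (fun φ i W hW v => φ.2 i W (hW.trans h) v)

/-- The automorphisms `a` of `E|_U` with `a(v) ≡ v` modulo `E_(p)`. -/
def autFilt (p : ℕ) (U : Opens X) : Subgroup (SAut E U) where
  carrier := {φ | ∀ (V : Opens X) (h : V ≤ U) (v : E.sec V),
    φ.1.app V h v - v ∈ filt E.toModSheaf p V}
  one_mem' V h v := (sub_self v).symm ▸ zero_mem _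
  mul_mem' {φ ψ} hφ hψ V h v := by
    have := add_mem (hφ V h (ψ.1.app V h v)) (hψ V h v)
    rwa [sub_add_sub_cancel] at this
  inv_mem' {φ} hφ V h v := by
    have := neg_mem (hφ V h ((φ.1.app V h).symm v))
    rwa [neg_sub, LinearEquiv.apply_symm_apply] at this

instance (p : ℕ) (U : Opens X) : (autFilt E p U).Normal where
  conj_mem φ hφ a V h v := by
    have := (a.1.preserves_filt p V h _).2 (hφ V h ((a.1.app V h).symm v))
    rwa [map_sub, LinearEquiv.apply_symm_apply] at this

/-- The sheaf of groups `U ↦ Aut_(p) E(U)`. -/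
def autFiltSheaf (p : ℕ) : (Opens X)ᵒᵖ ⥤ GrpCat.{u} where
  obj U := GrpCat.of (autFilt E p U.unop)
  map f := GrpCat.ofHom (((SAut.res E (leOfHom f.unop)).comp
    (autFilt E p _).subtype).codRestrict (autFilt E p _) (fun φ W _ v => φ.2 W _ v))
  map_id _ := rfl
  map_comp _ _ := rfl

/-- The automorphisms of `E|_U` which preserve the `ℤ`-grading `D` of `E`. -/
def autDeg (D : ℕ → SubPsh E.sec) (U : Opens X) : Subgroup (SAut E U) where
  carrier := {φ | ∀ q, φ.1.Preserves (D q) (D q)}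
  one_mem' _ _ _ _ := Iff.rfl
  mul_mem' hφ hψ i := (hψ i).trans (hφ i)
  inv_mem' hφ i := (hφ i).symm

/-- The cocycle `a g_{ij} a⁻¹`, for a global automorphism `a` of `E`. -/
def Cocycle.conj {p : ℕ} (a : SAut E ⊤) (c : Cocycle (autFiltSheaf E p)) :
    Cocycle (autFiltSheaf E p) where
  ι := c.ι
  cov := c.cov
  iSup_cov := c.iSup_cov
  toCocycle :=
    { ev := fun i j T f g => MulAut.conjNormal (SAut.res E (le_top : T ≤ ⊤) a)
        (c.toCocycle.ev i j f g)
      ev_precomp := fun i j T T' f g h => by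
        rw [← c.toCocycle.ev_precomp i j f g h]
        rfl
      ev_trans := fun i j k T f g h => by
        rw [← c.toCocycle.ev_trans i j k f g h]
        exact (map_mul (MulAut.conjNormal (SAut.res E (le_top : T ≤ ⊤) a)) _ _).symm }

theorem Cocycle.conj_equiv {p : ℕ} (a : SAut E ⊤) {c d : Cocycle (autFiltSheaf E p)}
    (h : Cocycle.Equiv _ c d) : Cocycle.Equiv _ (c.conj E a) (d.conj E a) := by
  obtain ⟨κ, W, hW, r, s, h, h', α, hα⟩ := h
  refine ⟨κ, W, hW, r, s, h, h',
    fun k => MulAut.conjNormal (SAut.res E (le_top : W k ≤ ⊤) a) (α k), fun i j T f g => ?_⟩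
  have := congrArg (MulAut.conjNormal (SAut.res E (le_top : T ≤ ⊤) a)) (hα i j f g)
  exact ((map_mul (MulAut.conjNormal (SAut.res E (le_top : T ≤ ⊤) a)) _ _).symm.trans this).trans
    (map_mul (MulAut.conjNormal (SAut.res E (le_top : T ≤ ⊤) a)) _ _)

/-- The action of the global automorphisms of `E` on `H¹(X, Aut_(p) E)` by conjugation. -/
instance (p : ℕ) : MulAction (SAut E ⊤) (H1 (autFiltSheaf E p)) where
  smul a := Quot.map (Cocycle.conj E a) (fun _ _ => Cocycle.conj_equiv E a)
  one_smul := by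
    rintro ⟨c⟩
    refine congrArg (Quot.mk _) ?_
    obtain ⟨ι, U, hU, ⟨⟨g, h⟩, h'⟩⟩ := c
    exact rfl
  mul_smul a b := by
    rintro ⟨c⟩
    refine congrArg (Quot.mk _) ?_
    obtain ⟨ι, U, hU, ⟨⟨g, h⟩, h'⟩⟩ := c
    exact rfl

end Aut

section Classes

open CategoryTheory Opposite

variable {X : Type u} [TopologicalSpace X] {F : Opens X → Type u} [∀ U, CommRing (F U)]
  [RingPsh F] [SuperRing F] [PurelyEven F] (G : ModSheaf F) (S : SuperModSheaf F)

/-- The locally free sheaves of `O`-modules `E` with `gr E ≃ E_gr`. -/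
def WithRetract : Type (u + 1) :=
  { E : SuperModSheaf (Shf (Ext G)) // (∃ p q, E.IsLocallyFree p q) ∧ Nonempty (GrIso E S) }

/-- Isomorphism of `ℤ/2`-graded sheaves of `O`-modules. -/
instance WithRetract.setoid : Setoid (WithRetract G S) where
  r E E' := E.1.Iso E'.1
  iseqv := SuperModSheaf.Iso.equivalence.comap Subtype.val

/-- The set of the isomorphism classes of locally free sheaves of `O`-modules `E` with
`gr E ≃ E_gr`. -/
def ClassesWithRetract : Type (u + 1) := Quotient (WithRetract.setoid G S)

/-- The sheaf of groups `Aut_(1) E_gr`. -/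
abbrev autOne : (Opens X)ᵒᵖ ⥤ GrpCat.{u} := autFiltSheaf (Egr G S) 1

/-- The group `H⁰(X, Aut_0 E_gr)` of the automorphisms of `E_gr` preserving its `ℤ`-grading. -/
abbrev autZero : Subgroup (SAut (Egr G S) ⊤) := autDeg (Egr G S) (EgrDeg G S) ⊤

/-- The cocycle `c` with values in `Aut_(1) E_gr` is a system of transition functions of `E`:
there are an isomorphism `θ : gr E ≃ E_gr`, and isomorphisms `δ_i : E|_{U_i} → E_gr|_{U_i}` over
the covering of `c` which induce `θ` on the associated graded sheaves, such that
`c_{ij} = δ_i ∘ δ_j⁻¹`. -/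
def IsTransition (E : WithRetract G S) (c : Cocycle (autOne G S)) : Prop :=
  ∃ (θ : GrIso E.1 S) (δ : ∀ i, IsoOn E.1.toModSheaf (Egr G S).toModSheaf (c.cov i)),
    (∀ i k, (δ i).Preserves (E.1.par k) ((Egr G S).par k)) ∧
    (∀ (i : c.ι) (V : Opens X) (h : V ≤ c.cov i) (q : ℕ) (v : filt E.1.toModSheaf q V),
      (δ i).app V h v.1 - θ.iso.app V le_top (symbol v) ∈
        filt (Egr G S).toModSheaf (q + 1) V) ∧
    ∀ (i j : c.ι) (T : Opens X) (a : T ⟶ c.cov i) (b : T ⟶ c.cov j),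
      (c.toCocycle.ev i j a b).1.1 =
        ((δ j).restrict (leOfHom b)).symm.trans ((δ i).restrict (leOfHom a))

end Classes

section Holomorphic

variable (n : ℕ) (M : Type u) [TopologicalSpace M]
  [ChartedSpace (EuclideanSpace ℂ (Fin n)) M]

/-- The sheaf `F` of holomorphic functions on the `n`-dimensional complex manifold `M`. -/
def Hol (U : Opens M) : Type u :=
  C^ω⟮𝓘(ℂ, EuclideanSpace ℂ (Fin n)), U; 𝓘(ℂ, ℂ), ℂ⟯

instance (U : Opens M) : CommRing (Hol n M U) :=
  inferInstanceAs (CommRing C^ω⟮𝓘(ℂ, EuclideanSpace ℂ (Fin n)), U; 𝓘(ℂ, ℂ), ℂ⟯)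

instance : RingPsh (Hol n M) where
  res h := (ContMDiffMap.restrictRingHom 𝓘(ℂ, EuclideanSpace ℂ (Fin n)) 𝓘(ℂ, ℂ) ℂ
    (n := ω) h).toAddMonoidHom
  res_self _ := rfl
  res_res _ _ _ := rfl
  res_one _ := rfl
  res_mul _ _ _ := rfl

/-- All holomorphic functions are even. -/
instance : SuperRing (Hol n M) where
  par i := ⟨fun _ => if i = 0 then ⊤ else ⊥, fun h a ha => by
    split_ifs at ha ⊢
    · exact AddSubgroup.mem_top _
    · rw [AddSubgroup.mem_bot] at ha ⊢
      rw [ha, map_zero]⟩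
  isCompl U := isCompl_top_bot
  one_mem U := AddSubgroup.mem_top _
  mul_mem {U i j a b} ha hb := by
    have key : ∀ i j : ZMod 2, i = 0 ∧ j = 0 ∧ i + j = 0 ∨ i = 1 ∨ j = 1 := by decide
    change a ∈ (if i = 0 then ⊤ else ⊥ : AddSubgroup (Hol n M U)) at ha
    change b ∈ (if j = 0 then ⊤ else ⊥ : AddSubgroup (Hol n M U)) at hb
    change a * b ∈ (if i + j = 0 then ⊤ else ⊥ : AddSubgroup (Hol n M U))
    rcases key i j with ⟨_, _, h⟩ | rfl | rfl
    · rw [if_pos h]; exact AddSubgroup.mem_top _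
    · rw [if_neg one_ne_zero, AddSubgroup.mem_bot] at ha
      rw [ha, zero_mul]; exact zero_mem _
    · rw [if_neg one_ne_zero, AddSubgroup.mem_bot] at hb
      rw [hb, mul_zero]; exact zero_mem _

instance : PurelyEven (Hol n M) := ⟨fun _ => AddSubgroup.mem_top _⟩

end Holomorphic

end SuperSheaf

end

/-! The theorem is the non-abelian Čech description of the sheaves that are locally isomorphic to
`E_gr`, with the structure group cut down to `Aut_(1)` by rigidifying the associated graded sheaf.

Everything rests on one local fact (`GrIso.exists_isoOn`): an isomorphism `θ : gr E → E_gr` is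
locally induced by an isomorphism `E → E_gr`. Take a homogeneous basis `s_i` of `S`. The section of
`gr E` corresponding to `1 ⊗ s_i` has degree `0` and a definite parity, so it lifts locally to a
section `v_i` of `E` of the same parity. Since `G` has rank `m`, the powers `⋀^k G` with `k > m`
vanish and `J^(m+1) = 0`. Successive approximation along the finite filtration `E_(n)` then shows
that the `v_i` form a basis of `E` (`GrIso.isBasisOn_of_symbol`), and `v_i ↦ 1 ⊗ s_i` is the
required isomorphism. Two local isomorphisms inducing the same `θ` agree modulo `(E_gr)_(1)`, so
their transition functions lie in `Aut_(1)`.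

Conversely, let local isomorphisms `δ_i` have transition functions in `Aut_(1)`. For `v` in `E_(q)`
the degree `q` parts of the `δ_i v` agree on overlaps and define a global isomorphism `gr E → E_gr`
(`LocalIsos.grIso`). Hence the mention of `θ` in `IsTransition` can be dropped (`isTransition_iff`),
and what remains is the notion of `Transition`, which makes sense for any model sheaf.

A cocycle glues copies of `E_gr` to a sheaf having it as transition functions (`Transition.glued`);
two sheaves with the same transition functions are isomorphic (`Transition.nonempty_iso`); the
cocycles belonging to `E` are stable under equivalence and under conjugation by global
automorphisms. For fixed `θ`, different choices of the `δ_i` change the cocycle within its class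
(`Transition.equiv`); replacing `θ` by `θ'` conjugates by `θ' θ⁻¹`, which lies in `Aut_0`
(`exists_smul_eq`). So the cocycles belonging to `E` are exactly those whose classes fill one orbit.
-/

noncomputable section

namespace SuperSheaf

/-! ### Gluing of sections, and maps between associated sheaves. -/

section SheafGluing

variable {X : Type u} [TopologicalSpace X]
  {P : Opens X → Type u} [∀ U, AddCommGroup (P U)] [AddPsh P]

/-- Gluing along a covering, for families of sections over all small open sets. -/
theorem IsSheaf.existsUnique_glue (hP : IsSheaf P) {ι : Type u} (U : ι → Opens X) {V : Opens X}
    (hV : V ≤ ⨆ i, U i) (s : ∀ (i : ι) (W : Opens X), W ≤ V → W ≤ U i → P W)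
    (hres : ∀ (i : ι) (W Z : Opens X) (hWV : W ≤ V) (hWU : W ≤ U i) (hZ : Z ≤ W),
      res P hZ (s i W hWV hWU) = s i Z (hZ.trans hWV) (hZ.trans hWU))
    (hs : ∀ (i j : ι) (W : Opens X) (hWV : W ≤ V) (hi : W ≤ U i) (hj : W ≤ U j),
      s i W hWV hi = s j W hWV hj) :
    ∃! t : P V, ∀ (i : ι) (W : Opens X) (hWV : W ≤ V) (hi : W ≤ U i),
      res P hWV t = s i W hWV hi := by
  have hW : (⨆ i, V ⊓ U i) = V := by rw [← inf_iSup_eq, inf_eq_left.2 hV]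
  -- The sheaf axiom yields a section over `⨆ i, V ⊓ U i`, which is only propositionally equal to
  -- `V`; generalising to `T` allows the equality to be substituted.
  have key : ∀ (T : Opens X) (hT : (⨆ i, V ⊓ U i) = T),
      ∃! t : P T, ∀ i, res P (show V ⊓ U i ≤ T from hT ▸ le_iSup (fun i => V ⊓ U i) i) t =
        s i (V ⊓ U i) inf_le_left inf_le_right := by
    rintro _ rfl
    refine hP (fun i => V ⊓ U i) (fun i => s i _ inf_le_left inf_le_right) fun i j => ?_
    rw [hres, hres]
    exact hs _ _ _ _ _ _
  obtain ⟨t, ht, hu⟩ := key V hW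
  refine ⟨t, fun i W hWV hi => ?_, fun t' ht' => hu t' fun i => ht' _ _ _ _⟩
  have := congrArg (res P (le_inf hWV hi)) (ht i)
  rwa [hres, res_res] at this

/-- This is the uniqueness half of gluing, for the covering of `U` indexed by its own points; `X`
and the index types of `IsSheaf` lie in the same universe. -/
theorem IsSheaf.ext_of_local (hP : IsSheaf P) {U : Opens X} {s t : P U}
    (h : ∀ x ∈ U, ∃ (V : Opens X) (_ : x ∈ V) (hV : V ≤ U), res P hV s = res P hV t) : s = t := by
  choose V hx hV e using h
  refine (hP.existsUnique_glue (fun x : U => V x x.2) (V := U)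
    (fun x hxU => Opens.mem_iSup.2 ⟨⟨x, hxU⟩, hx x hxU⟩) (fun _ W hW _ => res P hW t)
    (fun _ _ _ _ _ _ => res_res _ _ _ _) (fun _ _ _ _ _ _ => rfl)).unique
    (fun x W hW hWx => ?_) (fun _ _ _ _ => rfl)
  have := congrArg (res P hWx) (e x x.2)
  rwa [res_res, res_res] at this

namespace Shf

variable {Q : Opens X → Type u} [∀ U, AddCommGroup (Q U)] [AddPsh Q]

/-- Claims about an associated sheaf are reduced to the presheaf in this way: near each point the
section is the image of a single element, which can be chosen in `A`. -/
theorem exists_res_eq_mk {A : SubPsh P} {U : Opens X} {s : Shf P U} (hs : s ∈ sub A U) {x : X}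
    (hx : x ∈ U) : ∃ (V : Opens X) (_ : x ∈ V) (h : V ≤ U) (a : P V),
      a ∈ A V ∧ res (Shf P) h s = mk V a := by
  obtain ⟨V, hxV, h, a, ha, e⟩ := hs ⟨x, hx⟩
  exact ⟨V, hxV, h, a, ha, ext fun y => e y y.2⟩

theorem mem_sub_whole {U : Opens X} (s : Shf P U) : s ∈ sub (SubPsh.whole P) U := s.2

theorem mk_mem_sub {A : SubPsh P} {U : Opens X} {a : P U} (ha : a ∈ A U) : mk U a ∈ sub A U :=
  fun x => ⟨U, x.2, le_rfl, a, ha, fun _ _ => rfl⟩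

theorem mem_sub_of_local {A : SubPsh P} {U : Opens X} {s : Shf P U}
    (h : ∀ x ∈ U, ∃ (V : Opens X) (_ : x ∈ V) (hV : V ≤ U), res (Shf P) hV s ∈ sub A V) :
    s ∈ sub A U := by
  intro x
  obtain ⟨V, hx, hV, m⟩ := h x x.2
  obtain ⟨W, hxW, hW, a, ha, e⟩ := m ⟨x, hx⟩
  exact ⟨W, hxW, hW.trans hV, a, ha, e⟩

theorem sub_mono {A B : SubPsh P} (h : ∀ U, A U ≤ B U) (U : Opens X) : sub A U ≤ sub B U := by
  intro s hs x
  obtain ⟨V, hx, hV, a, ha, e⟩ := hs x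
  exact ⟨V, hx, hV, a, h V ha, e⟩

/-- The map induced on stalks by a map from a presheaf to an associated sheaf. -/
def stalkLift (f : ∀ U, P U →+ Shf Q U)
    (hf : ∀ {U V : Opens X} (h : V ≤ U) (a : P U), res (Shf Q) h (f U a) = f V (res P h a))
    (x : X) : Stalk P x → Stalk Q x :=
  DirectLimit.lift (F := nhdSec P x) (nhdRes P x)
    (fun V a => (f _ a).1 ⟨x, (OrderDual.ofDual V).mem'⟩)
    (fun _ W h a => by
      rw [← hf]
      rfl)

/-- The extension to the associated sheaf of a map of presheaves to an associated sheaf. -/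
def lift (f : ∀ U, P U →+ Shf Q U)
    (hf : ∀ {U V : Opens X} (h : V ≤ U) (a : P U), res (Shf Q) h (f U a) = f V (res P h a))
    (U : Opens X) : Shf P U →+ Shf Q U where
  toFun s := ⟨fun x => stalkLift f hf x (s.1 x), fun x => by
    obtain ⟨V, hx, h, a, _, e⟩ := s.2 x
    obtain ⟨W, hxW, hW, b, _, e'⟩ := (f V a).2 ⟨x, hx⟩
    refine ⟨W, hxW, hW.trans h, b, AddSubgroup.mem_top _, fun y hy => ?_⟩
    exact (congrArg (stalkLift f hf y) (e y (hW hy))).trans (e' y hy)⟩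
  map_zero' := by
    refine ext fun x => ?_
    change stalkLift f hf x 0 = 0
    rw [← germ_zero x.2]
    change (f U 0).1 x = 0
    rw [map_zero]
    rfl
  map_add' s t := by
    refine ext fun x => ?_
    change stalkLift f hf x (s.1 x + t.1 x) = stalkLift f hf x (s.1 x) + stalkLift f hf x (t.1 x)
    obtain ⟨V, hx, a, b, ea, eb⟩ := exists_germ₂ (s.1 x) (t.1 x)
    rw [ea, eb, ← germ_add]
    change (f V (a + b)).1 ⟨x, hx⟩ = (f V a).1 ⟨x, hx⟩ + (f V b).1 ⟨x, hx⟩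
    rw [map_add]
    rfl

variable {f : ∀ U, P U →+ Shf Q U}
    {hf : ∀ {U V : Opens X} (h : V ≤ U) (a : P U), res (Shf Q) h (f U a) = f V (res P h a)}

theorem lift_mk {U : Opens X} (a : P U) : lift f hf U (mk U a) = f U a := rfl

theorem res_lift {U V : Opens X} (h : V ≤ U) (s : Shf P U) :
    res (Shf Q) h (lift f hf U s) = lift f hf V (res (Shf P) h s) := rfl

theorem lift_mem {A : SubPsh P} {B : SubPsh Q} (h : ∀ (U : Opens X), ∀ a ∈ A U, f U a ∈ sub B U)
    {U : Opens X} {s : Shf P U} (hs : s ∈ sub A U) : lift f hf U s ∈ sub B U := by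
  refine mem_sub_of_local fun x hx => ?_
  obtain ⟨V, hxV, hV, a, ha, e⟩ := exists_res_eq_mk hs hx
  exact ⟨V, hxV, hV, by rw [res_lift, e, lift_mk]; exact h V a ha⟩

variable {R : Opens X → Type u} [∀ U, Ring (R U)] [RingPsh R]
variable [∀ U, Module (R U) (P U)] [ModPsh R P] [∀ U, Module (R U) (Q U)] [ModPsh R Q]

theorem lift_smul (hlin : ∀ (U : Opens X) (r : R U) (a : P U), f U (r • a) = mkRing U r • f U a)
    {U : Opens X} (r : Shf R U) (s : Shf P U) : lift f hf U (r • s) = r • lift f hf U s := by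
  refine isSheaf.ext_of_local fun x hx => ?_
  obtain ⟨V, hxV, hV, a, -, ea⟩ := exists_res_eq_mk (mem_sub_whole r) hx
  obtain ⟨W, hxW, hW, b, -, eb⟩ := exists_res_eq_mk (mem_sub_whole s) hx
  have ea' := congrArg (res (Shf R) (inf_le_left : V ⊓ W ≤ V)) ea
  have eb' := congrArg (res (Shf P) (inf_le_right : V ⊓ W ≤ W)) eb
  rw [res_res, res_mk] at ea' eb'
  refine ⟨V ⊓ W, ⟨hxV, hxW⟩, inf_le_left.trans hV, ?_⟩
  rw [res_lift, ModPsh.res_smul (R := Shf R), ModPsh.res_smul (R := Shf R), res_lift, ea', eb',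
    lift_mk]
  exact (congrArg (lift f hf _) (mk_smul (R := R) _ _).symm).trans
    ((lift_mk (hf := hf) _).trans (hlin _ _ _))

end Shf

end SheafGluing

/-! ### Isomorphisms of sheaves of modules: local criteria, gluing and bases. -/

section IsoGluing

variable {X : Type u} [TopologicalSpace X] {R : Opens X → Type u} [∀ U, Ring (R U)] [RingPsh R]
  {E E' : ModSheaf R} {U : Opens X}

/-- A morphism of sheaves of modules over `U` which is injective and locally surjective is an
isomorphism. -/
def IsoOn.ofInjective (f : ∀ V : Opens X, V ≤ U → E.sec V →ₗ[R V] E'.sec V)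
    (hf : ∀ {V W : Opens X} (hV : V ≤ U) (h : W ≤ V) (v : E.sec V),
      res E'.sec h (f V hV v) = f W (h.trans hV) (res E.sec h v))
    (hinj : ∀ (V : Opens X) (hV : V ≤ U) (v : E.sec V), f V hV v = 0 → v = 0)
    (hsurj : ∀ (V : Opens X) (hV : V ≤ U) (w : E'.sec V), ∀ x ∈ V,
      ∃ (W : Opens X) (_ : x ∈ W) (h : W ≤ V) (v : E.sec W),
        f W (h.trans hV) v = res E'.sec h w) : IsoOn E E' U where
  app V hV := LinearEquiv.ofBijective (f V hV)
    ⟨(injective_iff_map_eq_zero _).2 (hinj V hV), fun w => by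
      -- Surjectivity on sections over `V`: injectivity forces the local preimages to agree on
      -- overlaps, so they glue.
      choose W hx h v hv using hsurj V hV w
      obtain ⟨t, ht, -⟩ := IsSheaf.existsUnique_glue (P := E.sec) E.isSheaf (fun x : V => W x x.2) (V := V)
        (fun x hxV => Opens.mem_iSup.2 ⟨⟨x, hxV⟩, hx x hxV⟩)
        (fun x Z _ hZ => res E.sec hZ (v x x.2)) (fun _ _ _ _ _ _ => res_res _ _ _ _)
        (fun x y Z hZ h₁ h₂ => by
          rw [← sub_eq_zero]
          refine hinj Z (hZ.trans hV) _ ?_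
          rw [map_sub, ← hf ((h x x.2).trans hV), ← hf ((h y y.2).trans hV), hv, hv, res_res,
            res_res, sub_self])
      refine ⟨t, IsSheaf.ext_of_local (P := E'.sec) E'.isSheaf fun x hxV => ⟨W x hxV, hx x hxV, h x hxV, ?_⟩⟩
      rw [hf, ht ⟨x, hxV⟩ _ (h x hxV) le_rfl, res_self, hv]⟩
  res_app hV h v := hf hV h v

/-- Isomorphisms over the members of a covering which agree on the intersections glue. -/
theorem IsoOn.exists_glue {ι : Type u} (U : ι → Opens X) (hU : ⨆ i, U i = ⊤)
    (φ : ∀ i, IsoOn E E' (U i))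
    (hφ : ∀ (i j : ι) (V : Opens X) (hi : V ≤ U i) (hj : V ≤ U j) (v : E.sec V),
      (φ i).app V hi v = (φ j).app V hj v) :
    ∃ φ' : IsoOn E E' ⊤, ∀ (i : ι) (V : Opens X) (hi : V ≤ U i) (v : E.sec V),
      φ'.app V le_top v = (φ i).app V hi v := by
  -- The image of `v` is characterised by its restrictions to all small open sets; linearity and
  -- compatibility with restriction then follow from uniqueness.
  have glue : ∀ (V : Opens X) (v : E.sec V), ∃! t : E'.sec V,
      ∀ (i : ι) (W : Opens X) (hWV : W ≤ V) (hi : W ≤ U i),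
        res E'.sec hWV t = (φ i).app W hi (res E.sec hWV v) := fun V v =>
    IsSheaf.existsUnique_glue (P := E'.sec) E'.isSheaf U (hU ▸ le_top)
      (fun i W hW hi => (φ i).app W hi (res E.sec hW v))
      (fun i W Z hW hi hZ => by rw [(φ i).res_app, res_res])
      (fun i j W hW hi hj => hφ i j W hi hj _)
  choose f hf hf' using glue
  have mem : ∀ x : X, ∃ i, x ∈ U i := fun x => Opens.mem_iSup.1 (hU ▸ Opens.mem_top x)
  have hloc : ∀ (i : ι) (V : Opens X) (hi : V ≤ U i) (v : E.sec V), f V v = (φ i).app V hi v :=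
    fun i V hi v => by
      have := hf V v i V le_rfl hi
      rwa [res_self, res_self] at this
  refine ⟨IsoOn.ofInjective
    (fun V _ =>
      { toFun := f V
        map_add' := fun v w => (hf' V _ _ fun i W hW hi => by
          rw [map_add, map_add, map_add, hf V v i W hW hi, hf V w i W hW hi]).symm
        map_smul' := fun r v => (hf' V _ _ fun i W hW hi => by
          rw [RingHom.id_apply, ModPsh.res_smul (R := R), ModPsh.res_smul (R := R), map_smul,
            hf V v i W hW hi]).symm })
    (fun {V W} hV h v => hf' W _ _ fun i Z hZ hi => ?_)
    (fun V _ v hv => IsSheaf.ext_of_local (P := E.sec) E.isSheaf fun x hx => ?_)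
    (fun V _ w x hx => ?_), fun i V hi v => hloc i V hi v⟩
  · rw [res_res, res_res]
    exact hf V v i Z _ hi
  · obtain ⟨i, hi⟩ := mem x
    refine ⟨V ⊓ U i, ⟨hx, hi⟩, inf_le_left, ?_⟩
    have := hf V v i (V ⊓ U i) inf_le_left inf_le_right
    rw [show f V v = 0 from hv, map_zero] at this
    rw [map_zero]
    exact (LinearEquiv.map_eq_zero_iff _).1 this.symm
  · obtain ⟨i, hi⟩ := mem x
    exact ⟨V ⊓ U i, ⟨hx, hi⟩, inf_le_left,
      ((φ i).app _ inf_le_right).symm (res E'.sec inf_le_left w),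
      (hloc i _ inf_le_right _).trans (LinearEquiv.apply_symm_apply _ _)⟩

/-- The basis of the module of sections over a smaller open set. -/
def IsBasisOn.toBasis {ι : Type} [Fintype ι] {e : ι → E.sec U} (he : IsBasisOn E e) {V : Opens X}
    (h : V ≤ U) : Module.Basis ι (R V) (E.sec V) :=
  Module.Basis.ofEquivFun (LinearEquiv.ofBijective
    (Fintype.linearCombination (R V) (fun i => res E.sec h (e i))) (he V h)).symm

theorem IsBasisOn.toBasis_apply {ι : Type} [Fintype ι] {e : ι → E.sec U} (he : IsBasisOn E e)
    {V : Opens X} (h : V ≤ U) (i : ι) : he.toBasis h i = res E.sec h (e i) := by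
  classical
  exact (congrFun (Module.Basis.coe_ofEquivFun _) i).trans
    ((Fintype.linearCombination_apply_single (R V) _ i 1).trans (one_smul _ _))

/-- The linear equivalence carrying a basis to a basis. -/
def IsBasisOn.linearEquiv {ι : Type} [Fintype ι] {e : ι → E.sec U} {e' : ι → E'.sec U}
    (he : IsBasisOn E e) (he' : IsBasisOn E' e') (V : Opens X) (h : V ≤ U) :
    E.sec V ≃ₗ[R V] E'.sec V :=
  (LinearEquiv.ofBijective (Fintype.linearCombination (R V) (fun i => res E.sec h (e i)))
    (he V h)).symm.trans
  (LinearEquiv.ofBijective (Fintype.linearCombination (R V) (fun i => res E'.sec h (e' i)))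
    (he' V h))

theorem IsBasisOn.linearEquiv_apply {ι : Type} [Fintype ι] {e : ι → E.sec U} {e' : ι → E'.sec U}
    (he : IsBasisOn E e) (he' : IsBasisOn E' e') (V : Opens X) (h : V ≤ U) (c : ι → R V) :
    he.linearEquiv he' V h (∑ i, c i • res E.sec h (e i)) = ∑ i, c i • res E'.sec h (e' i) :=
  congrArg (Fintype.linearCombination (R V) (fun i => res E'.sec h (e' i)))
    ((LinearEquiv.ofBijective (Fintype.linearCombination (R V)
      (fun i => res E.sec h (e i))) (he V h)).symm_apply_apply c)

theorem res_sum_smul_res (E : ModSheaf R) {ι : Type} [Fintype ι] (e : ι → E.sec U)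
    {V W : Opens X} (hV : V ≤ U) (h : W ≤ V) (c : ι → R V) :
    res E.sec h (∑ i, c i • res E.sec hV (e i)) =
      ∑ i, res R h (c i) • res E.sec (h.trans hV) (e i) := by
  rw [map_sum]
  exact Finset.sum_congr rfl fun i _ => by rw [ModPsh.res_smul (R := R), res_res]

/-- The isomorphism carrying a basis to a basis. -/
def IsoOn.ofBases {ι : Type} [Fintype ι] {e : ι → E.sec U} {e' : ι → E'.sec U}
    (he : IsBasisOn E e) (he' : IsBasisOn E' e') : IsoOn E E' U where
  app V h := he.linearEquiv he' V h
  res_app {V W} hV h v := by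
    obtain ⟨c, rfl⟩ := (he V hV).2 v
    beta_reduce
    rw [he.linearEquiv_apply he', res_sum_smul_res, res_sum_smul_res, he.linearEquiv_apply he']

theorem IsoOn.ofBases_app {ι : Type} [Fintype ι] {e : ι → E.sec U} {e' : ι → E'.sec U}
    (he : IsBasisOn E e) (he' : IsBasisOn E' e') (V : Opens X) (h : V ≤ U) (c : ι → R V) :
    (IsoOn.ofBases he he').app V h (∑ i, c i • res E.sec h (e i)) =
      ∑ i, c i • res E'.sec h (e' i) :=
  he.linearEquiv_apply he' V h c

/-- A basis is carried to a basis by an isomorphism. -/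
theorem IsBasisOn.map {ι : Type} [Fintype ι] {e : ι → E.sec U} (he : IsBasisOn E e)
    (φ : IsoOn E E' U) : IsBasisOn E' (fun i => φ.app U le_rfl (e i)) := by
  intro V h
  have : (fun c : ι → R V => ∑ i, c i • res E'.sec h (φ.app U le_rfl (e i))) =
      φ.app V h ∘ fun c : ι → R V => ∑ i, c i • res E.sec h (e i) := by
    funext c
    rw [Function.comp_apply, map_sum]
    exact Finset.sum_congr rfl fun i _ => by rw [map_smul, φ.res_app]
  rw [this]
  exact (φ.app V h).bijective.comp (he V h)

theorem IsBasisOn.restrict {ι : Type} [Fintype ι] {e : ι → E.sec U} (he : IsBasisOn E e)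
    {V : Opens X} (h : V ≤ U) : IsBasisOn E (fun i => res E.sec h (e i)) := by
  intro W hW
  have := he W (hW.trans h)
  simpa only [res_res] using this

end IsoGluing

/-! ### Homogeneous sections and parity-preserving isomorphisms. -/

section Parity

variable {X : Type u} [TopologicalSpace X] {R : Opens X → Type u} [∀ U, Ring (R U)] [RingPsh R]
  [SuperRing R] {E E' : SuperModSheaf R} {U : Opens X}

/-- Writing the other parity as `k + 1` treats both cases at once. -/
theorem SuperModSheaf.disjoint_par (E : SuperModSheaf R) (k : ZMod 2) {V : Opens X} {v : E.sec V}
    (h : v ∈ E.par k V) (h' : v ∈ E.par (k + 1) V) : v = 0 := by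
  have : ∀ k : ZMod 2, k = 0 ∨ k = 1 := by decide
  rcases this k with rfl | rfl
  · exact AddSubgroup.disjoint_def.1 (E.isCompl V).disjoint h h'
  · exact AddSubgroup.disjoint_def.1 (E.isCompl V).disjoint h' h

theorem SuperModSheaf.exists_par_add (E : SuperModSheaf R) (k : ZMod 2) {V : Opens X}
    (v : E.sec V) : ∃ a ∈ E.par k V, ∃ b ∈ E.par (k + 1) V, a + b = v := by
  have : ∀ k : ZMod 2, k = 0 ∨ k = 1 := by decide
  obtain ⟨a, ha, b, hb, e⟩ := AddSubgroup.mem_sup.1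
    ((E.isCompl V).codisjoint.top_le (AddSubgroup.mem_top v))
  rcases this k with rfl | rfl
  · exact ⟨a, ha, b, hb, e⟩
  · exact ⟨b, hb, a, ha, (add_comm _ _).trans e⟩

/-- A morphism of additive groups carrying the homogeneous sections of `E` to homogeneous sections
of `E'` of the same parity, and injective, reflects the parity. -/
theorem IsoOn.preserves_par_of_mem {φ : IsoOn E.toModSheaf E'.toModSheaf U}
    (h : ∀ (k : ZMod 2) (V : Opens X) (hV : V ≤ U), ∀ v ∈ E.par k V, φ.app V hV v ∈ E'.par k V)
    (k : ZMod 2) : φ.Preserves (E.par k) (E'.par k) := by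
  refine fun V hV v => ⟨fun hv => ?_, h k V hV v⟩
  obtain ⟨a, ha, b, hb, rfl⟩ := E.exists_par_add k v
  -- The image of the summand `b` of the other parity lies in both homogeneous parts, so it
  -- vanishes; by injectivity `b = 0`.
  have hb' := h _ V hV b hb
  have : φ.app V hV b ∈ E'.par k V := by
    have := sub_mem hv (h _ V hV a ha)
    rwa [map_add, add_sub_cancel_left] at this
  rw [(LinearEquiv.map_eq_zero_iff _).1 (E'.disjoint_par k this hb'), add_zero]
  exact ha

end Parity

/-! ### Local nature of the filtration by powers of the odd ideal. -/

section FiltrationLocal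

variable {X : Type u} [TopologicalSpace X] {R : Opens X → Type u} [∀ U, Ring (R U)] [RingPsh R]
  [SuperRing R]

theorem mem_filt_of_local {E : ModSheaf R} {p : ℕ} {U : Opens X} {v : E.sec U}
    (h : ∀ x ∈ U, ∃ (V : Opens X) (_ : x ∈ V) (hV : V ≤ U), res E.sec hV v ∈ filt E p V) :
    v ∈ filt E p U := by
  intro x hx
  obtain ⟨V, hxV, hV, m⟩ := h x hx
  obtain ⟨W, hxW, hW, m'⟩ := m x hxV
  exact ⟨W, hxW, hW.trans hV, by rwa [res_res] at m'⟩

theorem mem_filt_zero {E : ModSheaf R} {U : Opens X} (v : E.sec U) : v ∈ filt E 0 U := by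
  refine fun x hx => ⟨U, hx, le_rfl, ?_⟩
  rw [Submodule.pow_zero, Ideal.one_eq_top, Submodule.top_smul]
  exact Submodule.mem_top

theorem filt_succ_le {E : ModSheaf R} {p : ℕ} {U : Opens X} : filt E (p + 1) U ≤ filt E p U := by
  intro v hv x hx
  obtain ⟨V, hxV, hV, m⟩ := hv x hx
  refine ⟨V, hxV, hV, ?_⟩
  rw [Submodule.pow_succ, Submodule.mul_smul] at m
  exact Submodule.smul_mono le_rfl le_top m

/-- An endomorphism congruent to the identity modulo `E_(1)` acts trivially on the quotients
`E_(q) / E_(q+1)`. -/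
theorem IsoOn.app_sub_mem_filt {E E' : ModSheaf R} {U V : Opens X} {φ ψ : IsoOn E E' U}
    (hV : V ≤ U)
    (h : ∀ (W : Opens X) (hW : W ≤ V) (v : E.sec W),
      φ.app W (hW.trans hV) v - ψ.app W (hW.trans hV) v ∈ filt E' 1 W)
    {q : ℕ} {v : E.sec V} (hv : v ∈ filt E q V) :
    φ.app V hV v - ψ.app V hV v ∈ filt E' (q + 1) V := by
  refine mem_filt_of_local fun x hx => ?_
  obtain ⟨W, hxW, hW, m⟩ := hv x hx
  refine ⟨W, hxW, hW, ?_⟩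
  rw [map_sub, φ.res_app, ψ.res_app]
  refine Submodule.smul_induction_on m (fun f hf w _ => ?_) (fun a b ha hb => ?_)
  -- For `f` in `J^q` the difference on `f • w` is `f • (φ w - ψ w)`, which lies in `J^q E'_(1)`,
  -- hence in `E'_(q+1)`.
  · rw [map_smul, map_smul, ← smul_sub]
    exact smul_mem_filt E' hf (h W hW w)
  · rw [map_add, map_add, add_sub_add_comm]
    exact add_mem ha hb

end FiltrationLocal

/-! ### Products of sections of subsheaves. -/

section SheafSMul

variable {X : Type u} [TopologicalSpace X]
  {P : Opens X → Type u} [∀ U, AddCommGroup (P U)] [AddPsh P]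
  {R : Opens X → Type u} [∀ U, Ring (R U)] [RingPsh R] [∀ U, Module (R U) (P U)] [ModPsh R P]

namespace Shf

theorem smul_mem_sub {A : SubPsh R} {B C : SubPsh P}
    (h : ∀ (U : Opens X), ∀ a ∈ A U, ∀ b ∈ B U, a • b ∈ C U) {U : Opens X} {r : Shf R U}
    {s : Shf P U} (hr : r ∈ sub A U) (hs : s ∈ sub B U) : r • s ∈ sub C U := by
  intro x
  obtain ⟨V, hx, h₁, a, ha, e⟩ := hr x
  obtain ⟨V', hx', h₁', a', ha', e'⟩ := hs x
  refine ⟨V ⊓ V', ⟨hx, hx'⟩, inf_le_left.trans h₁,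
    res R (inf_le_left : V ⊓ V' ≤ V) a • res P (inf_le_right : V ⊓ V' ≤ V') a',
    h _ _ (A.res_mem _ ha) _ (B.res_mem _ ha'), fun y hy => ?_⟩
  rw [germ_smul', germ_res (inf_le_left : V ⊓ V' ≤ V) hy a,
    germ_res (inf_le_right : V ⊓ V' ≤ V') hy a', ← e y hy.1, ← e' y hy.2]
  rfl

theorem mul_mem_sub {A B C : SubPsh R}
    (h : ∀ (U : Opens X), ∀ a ∈ A U, ∀ b ∈ B U, a * b ∈ C U) {U : Opens X} {r s : Shf R U}
    (hr : r ∈ sub A U) (hs : s ∈ sub B U) : r * s ∈ sub C U :=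
  smul_mem_sub (P := R) h hr hs

end Shf

end SheafSMul

/-! ### The degree filtration of `⋀ G` and of `E_gr`, and nilpotency of the odd ideal. -/

section Degree

variable {X : Type u} [TopologicalSpace X] {F : Opens X → Type u} [∀ U, CommRing (F U)]
  [RingPsh F] (G : ModSheaf F)

/-- The sum of the exterior powers of degree at least `q`. -/
def extGE (q : ℕ) : SubPsh (Ext G) where
  carrier U := AddSubgroup.closure {a | ∃ k, q ≤ k ∧ a ∈ extPow G k U}
  res_mem {U V} h a ha := by
    induction ha using AddSubgroup.closure_induction with
    | mem v hv =>
      obtain ⟨k, hk, ha⟩ := hv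
      exact AddSubgroup.subset_closure ⟨k, hk, extRes_mem_extPow G h k ha⟩
    | zero => rw [map_zero]; exact zero_mem _
    | add v w _ _ hv hw => rw [map_add]; exact add_mem hv hw
    | neg v _ hv => rw [map_neg]; exact neg_mem hv

variable {G}

theorem extPow_le_extGE {U : Opens X} {q k : ℕ} (h : q ≤ k) {a : Ext G U} (ha : a ∈ extPow G k U) :
    a ∈ extGE G q U := AddSubgroup.subset_closure ⟨k, h, ha⟩

theorem mem_extGE_zero {U : Opens X} (a : Ext G U) : a ∈ extGE G 0 U := by
  induction a using DirectSum.Decomposition.inductionOn (fun p => extPow G p U) with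
  | zero => exact zero_mem _
  | add a b ha hb => exact add_mem ha hb
  | @homogeneous p a => exact extPow_le_extGE (Nat.zero_le p) a.2

theorem mul_mem_extGE {U : Opens X} {p q : ℕ} {a b : Ext G U} (ha : a ∈ extGE G p U)
    (hb : b ∈ extGE G q U) : a * b ∈ extGE G (p + q) U := by
  induction ha using AddSubgroup.closure_induction with
  | mem a ha =>
    obtain ⟨k, hk, ha⟩ := ha
    induction hb using AddSubgroup.closure_induction with
    | mem b hb =>
      obtain ⟨l, hl, hb⟩ := hb
      exact extPow_le_extGE (add_le_add hk hl)
        (SetLike.mul_mem_graded (A := fun p => extPow G p U) ha hb)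
    | zero => rw [mul_zero]; exact zero_mem _
    | add v w _ _ hv hw => rw [mul_add]; exact add_mem hv hw
    | neg v _ hv => rw [mul_neg]; exact neg_mem hv
  | zero => rw [zero_mul]; exact zero_mem _
  | add v w _ _ hv hw => rw [add_mul]; exact add_mem hv hw
  | neg v _ hv => rw [neg_mul]; exact neg_mem hv

theorem extPar_induction {U : Opens X} {i : ZMod 2} {C : Ext G U → Prop} (h₀ : C 0)
    (h₁ : ∀ k : ℕ, (k : ZMod 2) = i → ∀ a ∈ extPow G k U, C a)
    (h₂ : ∀ a b, C a → C b → C (a + b)) {a : Ext G U} (ha : a ∈ extPar G i U) : C a := by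
  have ha' : a ∈ ⨆ j : { n : ℕ // (n : ZMod 2) = i }, extPow G j U := ha
  induction ha' using Submodule.iSup_induction' with
  | mem j x hx => exact h₁ j j.2 x hx
  | zero => exact h₀
  | add x y _ _ hx hy => exact h₂ x y (hx ‹_›) (hy ‹_›)

theorem extPow_le_extPar {U : Opens X} {k : ℕ} {a : Ext G U} (ha : a ∈ extPow G k U) :
    a ∈ extPar G (k : ZMod 2) U :=
  Submodule.mem_iSup_of_mem (p := fun j : { n : ℕ // (n : ZMod 2) = k } => extPow G j U)
    ⟨k, rfl⟩ ha

theorem extPar_one_le {U : Opens X} {a : Ext G U} (ha : a ∈ extPar G 1 U) : a ∈ extGE G 1 U := by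
  refine extPar_induction (C := fun a => a ∈ extGE G 1 U) (zero_mem _) (fun k hk a ha => ?_)
    (fun a b => add_mem) ha
  refine extPow_le_extGE (Nat.one_le_iff_ne_zero.2 ?_) ha
  rintro rfl
  exact zero_ne_one hk

/-- Odd elements have degree at least `1` and degrees add under multiplication. Together with
`mkRing_mem_oddIdeal_pow` this compares the `J`-adic filtration with the one by degree. -/
theorem mem_sub_extGE_of_mem_oddIdeal_pow {U : Opens X} (p : ℕ) {f : Shf (Ext G) U}
    (hf : f ∈ oddIdeal (Shf (Ext G)) U ^ p) : f ∈ Shf.sub (extGE G p) U := by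
  induction p generalizing f with
  | zero => exact Shf.sub_mono (fun _ a _ => mem_extGE_zero a) U (Shf.mem_sub_whole f)
  | succ p ih =>
    have mul : ∀ p q r : ℕ, p + q = r → ∀ {f g : Shf (Ext G) U}, f ∈ Shf.sub (extGE G p) U →
        g ∈ Shf.sub (extGE G q) U → f * g ∈ Shf.sub (extGE G r) U := by
      rintro p q _ rfl f g
      exact Shf.mul_mem_sub fun _ a ha b hb => mul_mem_extGE ha hb
    have odd : ∀ g ∈ oddIdeal (Shf (Ext G)) U, g ∈ Shf.sub (extGE G 1) U := by
      intro g hg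
      refine Submodule.span_induction (fun x hx => ?_) (zero_mem _)
        (fun x y _ _ hx hy => add_mem hx hy) (fun r x _ hx => ?_) hg
      · exact Shf.sub_mono (fun _ a ha => extPar_one_le ha) U hx
      · exact mul 0 1 1 rfl
          (Shf.sub_mono (fun _ a _ => mem_extGE_zero a) U (Shf.mem_sub_whole r)) hx
    rw [Submodule.pow_succ] at hf
    exact Submodule.mul_induction_on hf (fun a ha b hb => mul p 1 _ rfl (ih ha) (odd b hb))
      (fun a b => add_mem)

/-- An alternating map of `k` variables is determined by its values on injective families of basis
vectors, and for `k > m` there are none; the products of `k` vectors span the exterior power. -/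
theorem extPow_eq_zero {U : Opens X} {m k : ℕ} {e : Fin m → G.sec U} (he : IsBasisOn G e)
    (hk : m < k) {a : Ext G U} (ha : a ∈ extPow G k U) : a = 0 := by
  have h : (ExteriorAlgebra.ιMulti (F U) k :
      G.sec U [⋀^Fin k]→ₗ[F U] ExteriorAlgebra (F U) (G.sec U)) = 0 := by
    refine Module.Basis.ext_alternating (he.toBasis le_rfl) fun v hv => absurd (Fintype.card_le_of_injective v hv) ?_
    simpa using hk
  have ha' : a ∈ (⋀[F U]^k (G.sec U) : Submodule (F U) (ExteriorAlgebra (F U) (G.sec U))) := ha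
  rw [← ExteriorAlgebra.ιMulti_span_fixedDegree, h] at ha'
  have hs : (Set.range ((0 : G.sec U [⋀^Fin k]→ₗ[F U] ExteriorAlgebra (F U) (G.sec U)))) ⊆ {0} := by
    rintro _ ⟨x, rfl⟩
    rfl
  exact (Submodule.mem_bot (F U)).1 ((Submodule.span_le (p := ⊥)).2 hs ha')

/-- The ideal generated by the odd elements is nilpotent. -/
theorem eq_zero_of_mem_oddIdeal_pow {m : ℕ} (hG : G.IsLocallyFree m) {U : Opens X}
    {f : Shf (Ext G) U} (hf : f ∈ oddIdeal (Shf (Ext G)) U ^ (m + 1)) : f = 0 := by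
  refine Shf.isSheaf.ext_of_local fun x hx => ?_
  obtain ⟨V, hxV, hV, a, ha, e⟩ :=
    Shf.exists_res_eq_mk (mem_sub_extGE_of_mem_oddIdeal_pow _ hf) hx
  obtain ⟨W, hxW, b, hb⟩ := hG x
  have hb' := hb.restrict (inf_le_right : V ⊓ W ≤ W)
  have hz : ∀ c ∈ extGE G (m + 1) (V ⊓ W), c = 0 := by
    intro c hc
    induction hc using AddSubgroup.closure_induction with
    | mem v hv =>
      obtain ⟨k, hk, hv⟩ := hv
      exact extPow_eq_zero hb' hk hv
    | zero => rfl
    | add v w _ _ hv hw => rw [hv, hw, add_zero]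
    | neg v _ hv => rw [hv, neg_zero]
  refine ⟨V ⊓ W, ⟨hxV, hxW⟩, inf_le_left.trans hV, ?_⟩
  have e' := congrArg (res (Shf (Ext G)) (inf_le_left : V ⊓ W ≤ V)) e
  rw [res_res, Shf.res_mk, hz _ ((extGE G (m + 1)).res_mem _ ha), map_zero] at e'
  rw [e', map_zero]

/-- Nilpotency of `J` makes the filtration of every sheaf of modules finite, so arguments by
successive approximation stop after `m + 1` steps. -/
theorem eq_zero_of_mem_filt {m : ℕ} (hG : G.IsLocallyFree m) {E : ModSheaf (Shf (Ext G))}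
    {U : Opens X} {v : E.sec U} (hv : v ∈ filt E (m + 1) U) : v = 0 := by
  refine IsSheaf.ext_of_local (P := E.sec) E.isSheaf fun x hx => ?_
  obtain ⟨V, hxV, hV, hm⟩ := hv x hx
  refine ⟨V, hxV, hV, ?_⟩
  rw [map_zero]
  refine Submodule.smul_induction_on hm (fun f hf w _ => ?_) (fun a b ha hb => ?_)
  · rw [eq_zero_of_mem_oddIdeal_pow hG hf, zero_smul]
  · rw [ha, hb, add_zero]

theorem proj_eq {U : Opens X} {q k : ℕ} {a : Ext G U} (ha : a ∈ extPow G k U) :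
    GradedAlgebra.proj (fun p => extPow G p U) q a = if k = q then a else 0 := by
  rw [GradedAlgebra.proj_apply, DirectSum.decompose_of_mem (fun p => extPow G p U) ha,
    DirectSum.coe_of_apply]
  split_ifs <;> rfl

variable [SuperRing F] (G) (S : SuperModSheaf F)

/-- The sum of the homogeneous parts of degree at least `q` of the presheaf of tensor products. -/
def tenGE (q : ℕ) : SubPsh (Ten G S) where
  carrier U := AddSubgroup.closure {v | ∃ k, q ≤ k ∧ ∃ a ∈ extPow G k U, ∃ s, v = tmul a s}
  res_mem {U V} h a ha := by
    induction ha using AddSubgroup.closure_induction with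
    | mem v hv =>
      obtain ⟨k, hk, a, ha, s, rfl⟩ := hv
      exact AddSubgroup.subset_closure ⟨k, hk, _, extRes_mem_extPow G h k ha, _,
        res_tmul G S h a s⟩
    | zero => rw [map_zero]; exact zero_mem _
    | add v w _ _ hv hw => rw [map_add]; exact add_mem hv hw
    | neg v _ hv => rw [map_neg]; exact neg_mem hv

variable {G S}

theorem zero_tmul {U : Opens X} (s : S.sec U) : (tmul 0 s : Ten G S U) = 0 :=
  TensorProduct.zero_tmul _ _

theorem add_tmul {U : Opens X} (a b : Ext G U) (s : S.sec U) :
    tmul (a + b) s = (tmul a s + tmul b s : Ten G S U) := TensorProduct.add_tmul _ _ _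

theorem neg_tmul {U : Opens X} (a : Ext G U) (s : S.sec U) :
    tmul (-a) s = (-tmul a s : Ten G S U) := TensorProduct.neg_tmul _ _

theorem tmul_mem_tenGE {U : Opens X} {q : ℕ} {a : Ext G U} (ha : a ∈ extGE G q U) (s : S.sec U) :
    tmul a s ∈ tenGE G S q U := by
  induction ha using AddSubgroup.closure_induction with
  | mem a ha =>
    obtain ⟨k, hk, ha⟩ := ha
    exact AddSubgroup.subset_closure ⟨k, hk, a, ha, s, rfl⟩
  | zero => rw [zero_tmul]; exact zero_mem _
  | add v w _ _ hv hw => rw [add_tmul]; exact add_mem hv hw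
  | neg v _ hv => rw [neg_tmul]; exact neg_mem hv

theorem smul_mem_tenGE {U : Opens X} {q : ℕ} {a : Ext G U} (ha : a ∈ extGE G q U)
    (v : Ten G S U) : a • v ∈ tenGE G S q U := by
  induction v using ten_induction with
  | h₀ => rw [smul_zero]; exact zero_mem _
  | h₁ b s =>
    rw [smul_tmul]
    exact tmul_mem_tenGE (mul_mem_extGE ha (mem_extGE_zero b)) s
  | h₂ v w hv hw => rw [smul_add]; exact add_mem hv hw

/-- Every element of the tensor product is a sum of homogeneous pure tensors. -/
theorem ten_induction_homogeneous {U : Opens X} {C : Ten G S U → Prop} (h₀ : C 0)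
    (h₁ : ∀ (k : ℕ), ∀ a ∈ extPow G k U, ∀ s, C (tmul a s))
    (h₂ : ∀ v w, C v → C w → C (v + w)) (v : Ten G S U) : C v := by
  induction v using ten_induction with
  | h₀ => exact h₀
  | h₁ a s =>
    induction a using DirectSum.Decomposition.inductionOn (fun p => extPow G p U) with
    | zero => rw [zero_tmul]; exact h₀
    | add a b ha hb => rw [add_tmul]; exact h₂ _ _ ha hb
    | @homogeneous p a => exact h₁ p a.1 a.2 s
  | h₂ v w hv hw => exact h₂ v w hv hw

variable (G S) in
/-- The projection of the tensor product to its part of degree `q`. -/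
def tenProj (q : ℕ) (U : Opens X) : Ten G S U →+ Ten G S U :=
  (TensorProduct.map (GradedAlgebra.proj (fun p => extPow G p U) q)
    (LinearMap.id : S.sec U →ₗ[F U] S.sec U)).toAddMonoidHom

theorem tenProj_tmul (q : ℕ) {U : Opens X} (a : Ext G U) (s : S.sec U) :
    tenProj G S q U (tmul a s) = tmul (GradedAlgebra.proj (fun p => extPow G p U) q a) s := rfl

theorem tenProj_tmul_of_mem (q : ℕ) {U : Opens X} {k : ℕ} {a : Ext G U} (ha : a ∈ extPow G k U)
    (s : S.sec U) : tenProj G S q U (tmul a s) = if k = q then tmul a s else 0 := by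
  rw [tenProj_tmul, proj_eq ha]
  split_ifs
  · rfl
  · exact zero_tmul s

theorem res_tenProj (q : ℕ) {U V : Opens X} (h : V ≤ U) (v : Ten G S U) :
    res (Ten G S) h (tenProj G S q U v) = tenProj G S q V (res (Ten G S) h v) := by
  induction v using ten_induction_homogeneous with
  | h₀ => simp only [map_zero]
  | h₁ k a ha s =>
    have ha' : res (Ext G) h a ∈ extPow G k V := extRes_mem_extPow G h k ha
    rw [tenProj_tmul_of_mem q ha, res_tmul, tenProj_tmul_of_mem q ha']
    split_ifs
    · rw [res_tmul]
    · exact map_zero _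
  | h₂ v w hv hw => simp only [map_add, hv, hw]

theorem res_mk_tenProj (q : ℕ) {U V : Opens X} (h : V ≤ U) (v : Ten G S U) :
    res (Shf (Ten G S)) h ((Shf.mk U).comp (tenProj G S q U) v) =
      (Shf.mk V).comp (tenProj G S q V) (res (Ten G S) h v) :=
  (Shf.res_mk h _).trans (congrArg (Shf.mk V) (res_tenProj q h v))

theorem tenProj_mem_tenDeg (q : ℕ) {U : Opens X} (v : Ten G S U) :
    tenProj G S q U v ∈ tenDeg G S q U := by
  induction v using ten_induction_homogeneous with
  | h₀ => rw [map_zero]; exact zero_mem _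
  | h₁ k a ha s =>
    rw [tenProj_tmul_of_mem q ha]
    split_ifs with h
    · subst h
      exact AddSubgroup.subset_closure ⟨a, ha, s, rfl⟩
    · exact zero_mem _
  | h₂ v w hv hw => rw [map_add]; exact add_mem hv hw

/-- The parity of `⋀^k G` is the class of `k`, so the even and odd parts are sums of full degrees,
and each summand is either kept or killed. -/
theorem tenProj_mem_tenPar (q : ℕ) {k : ZMod 2} {U : Opens X} {v : Ten G S U}
    (hv : v ∈ tenPar G S k U) : tenProj G S q U v ∈ tenPar G S k U := by
  induction hv using AddSubgroup.closure_induction with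
  | mem v hv =>
    obtain ⟨i, j, hk, a, ha, s, hs, rfl⟩ := hv
    rw [tenProj_tmul]
    refine AddSubgroup.subset_closure ⟨i, j, hk, _, ?_, s, hs, rfl⟩
    refine extPar_induction
      (C := fun a => GradedAlgebra.proj (fun p => extPow G p U) q a ∈ extPar G i U)
      (by rw [map_zero]; exact zero_mem _) (fun k hk a ha => ?_)
      (fun a b ha hb => by rw [map_add]; exact add_mem ha hb) ha
    rw [proj_eq ha]
    split_ifs
    · exact hk ▸ extPow_le_extPar ha
    · exact zero_mem _
  | zero => rw [map_zero]; exact zero_mem _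
  | add v w _ _ hv hw => rw [map_add]; exact add_mem hv hw
  | neg v _ hv => rw [map_neg]; exact neg_mem hv

/-- Together with `tenProj_eq_zero` this says that on degrees at least `q` the projection to degree
`q` has kernel the part of degree at least `q + 1`; it therefore represents the quotient of
consecutive filtration steps. -/
theorem sub_tenProj_mem {q : ℕ} {U : Opens X} {v : Ten G S U} (hv : v ∈ tenGE G S q U) :
    v - tenProj G S q U v ∈ tenGE G S (q + 1) U := by
  induction hv using AddSubgroup.closure_induction with
  | mem v hv =>
    obtain ⟨k, hk, a, ha, s, rfl⟩ := hv
    rw [tenProj_tmul_of_mem q ha]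
    split_ifs with h
    · rw [sub_self]; exact zero_mem _
    · rw [sub_zero]
      exact AddSubgroup.subset_closure ⟨k, lt_of_le_of_ne hk (Ne.symm h), a, ha, s, rfl⟩
  | zero => rw [map_zero, sub_zero]; exact zero_mem _
  | add v w _ _ hv hw => rw [map_add, add_sub_add_comm]; exact add_mem hv hw
  | neg v _ hv => rw [map_neg, ← neg_sub']; exact neg_mem hv

theorem tenProj_eq_zero {q : ℕ} {U : Opens X} {v : Ten G S U} (hv : v ∈ tenGE G S (q + 1) U) :
    tenProj G S q U v = 0 := by
  induction hv using AddSubgroup.closure_induction with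
  | mem v hv =>
    obtain ⟨k, hk, a, ha, s, rfl⟩ := hv
    rw [tenProj_tmul_of_mem q ha, if_neg (by omega)]
  | zero => exact map_zero _
  | add v w _ _ hv hw => rw [map_add, hv, hw, add_zero]
  | neg v _ hv => rw [map_neg, hv, neg_zero]

theorem tenProj_of_mem_tenDeg {q r : ℕ} {U : Opens X} {v : Ten G S U}
    (hv : v ∈ tenDeg G S r U) : tenProj G S q U v = if r = q then v else 0 := by
  induction hv using AddSubgroup.closure_induction with
  | mem v hv =>
    obtain ⟨a, ha, s, rfl⟩ := hv
    exact tenProj_tmul_of_mem q ha s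
  | zero => rw [map_zero, ite_self]
  | add v w _ _ hv hw => rw [map_add, hv, hw]; split_ifs <;> simp
  | neg v _ hv => rw [map_neg, hv]; split_ifs <;> simp

theorem tenDeg_le_tenGE {q : ℕ} {U : Opens X} : tenDeg G S q U ≤ tenGE G S q U := by
  refine (AddSubgroup.closure_le _).2 ?_
  rintro _ ⟨a, ha, s, rfl⟩
  exact AddSubgroup.subset_closure ⟨q, le_rfl, a, ha, s, rfl⟩

theorem smul_mem_tenDeg {p q : ℕ} {U : Opens X} {a : Ext G U} (ha : a ∈ extPow G p U)
    {v : Ten G S U} (hv : v ∈ tenDeg G S q U) : a • v ∈ tenDeg G S (p + q) U := by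
  induction hv using AddSubgroup.closure_induction with
  | mem v hv =>
    obtain ⟨b, hb, s, rfl⟩ := hv
    rw [smul_tmul]
    exact AddSubgroup.subset_closure
      ⟨a * b, SetLike.mul_mem_graded (A := fun p => extPow G p U) ha hb, s, rfl⟩
  | zero => rw [smul_zero]; exact zero_mem _
  | add v w _ _ hv hw => rw [smul_add]; exact add_mem hv hw
  | neg v _ hv => rw [smul_neg]; exact neg_mem hv

variable [PurelyEven F]

/-- The filtration of `E_gr` is the one defined by its `ℤ`-grading. -/
theorem filt_Egr (q : ℕ) (U : Opens X) :
    filt (Egr G S).toModSheaf q U = Shf.sub (tenGE G S q) U := by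
  refine le_antisymm (fun v hv => ?_) (fun v hv => ?_)
  · refine Shf.mem_sub_of_local fun x hx => ?_
    obtain ⟨V, hxV, hV, m⟩ := hv x hx
    refine ⟨V, hxV, hV, ?_⟩
    refine Submodule.smul_induction_on m (fun f hf w _ => ?_) (fun a b => add_mem)
    exact Shf.smul_mem_sub (fun _ a ha b _ => smul_mem_tenGE ha b)
      (mem_sub_extGE_of_mem_oddIdeal_pow q hf) (Shf.mem_sub_whole w)
  · refine mem_filt_of_local fun x hx => ?_
    obtain ⟨V, hxV, hV, a, ha, e⟩ := Shf.exists_res_eq_mk hv hx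
    refine ⟨V, hxV, hV, ?_⟩
    refine Eq.subst (motive := fun z => z ∈ filt (Egr G S).toModSheaf q V) e.symm ?_
    clear e
    induction ha using AddSubgroup.closure_induction with
    | mem v hv =>
      obtain ⟨k, hk, a, ha, s, rfl⟩ := hv
      -- Here `a ⊗ s = a • (1 ⊗ s)`, and `a` of degree `k ≥ q` maps into `J^k ⊆ J^q`.
      have e : Shf.mk V (tmul a s : Ten G S V) =
          Shf.mkRing V a • (Shf.mk V (tmul 1 s : Ten G S V)) := by
        rw [← Shf.mk_smul, smul_tmul, mul_one]
      refine Eq.subst (motive := fun z => z ∈ filt (Egr G S).toModSheaf q V) e.symm ?_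
      exact smul_mem_filt (p := q) (q := 0) _
        (Ideal.pow_le_pow_right hk (mkRing_mem_oddIdeal_pow G ha)) (mem_filt_zero _)
    | zero => exact (map_zero (Shf.mk (P := Ten G S) V)).symm ▸ zero_mem _
    | add v w _ _ hv hw => exact (map_add (Shf.mk (P := Ten G S) V) v w).symm ▸ add_mem hv hw
    | neg v _ hv => exact (map_neg (Shf.mk (P := Ten G S) V) v).symm ▸ neg_mem hv

variable (G S) in
/-- The projection of `E_gr` to its part of degree `q`. -/
def egrProj (q : ℕ) (U : Opens X) : (Egr G S).sec U →+ (Egr G S).sec U :=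
  Shf.lift (P := Ten G S) (Q := Ten G S) (fun U => (Shf.mk U).comp (tenProj G S q U))
    (res_mk_tenProj q) U

theorem egrProj_mk {q : ℕ} {U : Opens X} (a : Ten G S U) :
    egrProj G S q U (Shf.mk U a) = Shf.mk U (tenProj G S q U a) := rfl

theorem res_egrProj {q : ℕ} {U V : Opens X} (h : V ≤ U) (w : (Egr G S).sec U) :
    res (Egr G S).sec h (egrProj G S q U w) = egrProj G S q V (res (Egr G S).sec h w) := rfl

theorem egrProj_mem_deg {q : ℕ} {U : Opens X} (w : (Egr G S).sec U) :
    egrProj G S q U w ∈ EgrDeg G S q U :=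
  Shf.lift_mem (P := Ten G S) (Q := Ten G S) (A := SubPsh.whole (Ten G S)) (B := tenDeg G S q)
    (f := fun U => (Shf.mk U).comp (tenProj G S q U)) (hf := res_mk_tenProj q)
    (fun _ a _ => Shf.mk_mem_sub (tenProj_mem_tenDeg q a)) (Shf.mem_sub_whole w)

theorem egrProj_mem_par {q : ℕ} {k : ZMod 2} {U : Opens X} {w : (Egr G S).sec U}
    (hw : w ∈ (Egr G S).par k U) : egrProj G S q U w ∈ (Egr G S).par k U :=
  Shf.lift_mem (P := Ten G S) (Q := Ten G S) (A := tenPar G S k) (B := tenPar G S k)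
    (f := fun U => (Shf.mk U).comp (tenProj G S q U)) (hf := res_mk_tenProj q)
    (fun _ _ ha => Shf.mk_mem_sub (tenProj_mem_tenPar q ha)) hw

theorem sub_egrProj_mem {q : ℕ} {U : Opens X} {w : (Egr G S).sec U}
    (hw : w ∈ filt (Egr G S).toModSheaf q U) :
    w - egrProj G S q U w ∈ filt (Egr G S).toModSheaf (q + 1) U := by
  rw [filt_Egr] at hw ⊢
  refine Shf.mem_sub_of_local fun x hx => ?_
  obtain ⟨V, hxV, hV, a, ha, e⟩ := Shf.exists_res_eq_mk hw hx
  refine ⟨V, hxV, hV, ?_⟩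
  have : res (Egr G S).sec hV (w - egrProj G S q U w) = Shf.mk V (a - tenProj G S q V a) := by
    rw [map_sub, res_egrProj, map_sub, ← egrProj_mk]
    exact congrArg (fun z => z - egrProj G S q V z) e
  exact Eq.subst (motive := fun z => z ∈ Shf.sub (tenGE G S (q + 1)) V) this.symm
    (Shf.mk_mem_sub (sub_tenProj_mem ha))

theorem egrProj_eq_zero {q : ℕ} {U : Opens X} {w : (Egr G S).sec U}
    (hw : w ∈ filt (Egr G S).toModSheaf (q + 1) U) : egrProj G S q U w = 0 := by
  rw [filt_Egr] at hw
  refine IsSheaf.ext_of_local (P := (Egr G S).sec) (Egr G S).isSheaf fun x hx => ?_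
  obtain ⟨V, hxV, hV, a, ha, e⟩ := Shf.exists_res_eq_mk hw hx
  refine ⟨V, hxV, hV, ?_⟩
  rw [res_egrProj, map_zero]
  refine (congrArg (egrProj G S q V) e).trans ?_
  rw [egrProj_mk, tenProj_eq_zero ha]
  exact map_zero _

theorem egrProj_of_mem_deg {q r : ℕ} {U : Opens X} {w : (Egr G S).sec U}
    (hw : w ∈ EgrDeg G S r U) : egrProj G S q U w = if r = q then w else 0 := by
  refine IsSheaf.ext_of_local (P := (Egr G S).sec) (Egr G S).isSheaf fun x hx => ?_
  obtain ⟨V, hxV, hV, a, ha, e⟩ := Shf.exists_res_eq_mk hw hx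
  refine ⟨V, hxV, hV, ?_⟩
  rw [res_egrProj]
  refine (congrArg (egrProj G S q V) e).trans ?_
  rw [egrProj_mk, tenProj_of_mem_tenDeg ha]
  split_ifs
  · exact e.symm
  · exact (map_zero (Shf.mk (P := Ten G S) V)).trans (map_zero (res (Egr G S).sec hV)).symm

theorem egrDeg_le_filt {q : ℕ} {U : Opens X} :
    EgrDeg G S q U ≤ filt (Egr G S).toModSheaf q U := by
  rw [filt_Egr]
  exact Shf.sub_mono (fun _ => tenDeg_le_tenGE) U

/-- The projection to degree `q` is the identity on the first subgroup and zero on the second.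
Congruences between sections of degree `q` thereby become equalities. -/
theorem eq_zero_of_mem_egrDeg_of_mem_filt {q : ℕ} {U : Opens X} {w : (Egr G S).sec U}
    (hw : w ∈ EgrDeg G S q U) (hw' : w ∈ filt (Egr G S).toModSheaf (q + 1) U) : w = 0 := by
  rw [← egrProj_eq_zero hw', egrProj_of_mem_deg hw, if_pos rfl]

theorem smul_mem_egrDeg {p q : ℕ} {U : Opens X} {a : Ext G U} (ha : a ∈ extPow G p U)
    {w : (Egr G S).sec U} (hw : w ∈ EgrDeg G S q U) :
    Shf.mkRing U a • w ∈ EgrDeg G S (p + q) U :=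
  Shf.smul_mem_sub (A := extDeg G p) (fun _ _ ha _ hv => smul_mem_tenDeg ha hv)
    (Shf.mk_mem_sub (A := extDeg G p) ha) hw

/-- The section `w` may be replaced by its degree `q` part: the remainder lies in `E_(q+1)`, so its
product with `a` lies in `E_(p+q+1)` and is killed by the projection. -/
theorem egrProj_smul {p q : ℕ} {U : Opens X} {a : Ext G U} (ha : a ∈ extPow G p U)
    {w : (Egr G S).sec U} (hw : w ∈ filt (Egr G S).toModSheaf q U) :
    egrProj G S (p + q) U (Shf.mkRing U a • w) = Shf.mkRing U a • egrProj G S q U w := by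
  have h := egrProj_eq_zero (q := p + q)
    (smul_mem_filt (p := p) (q := q + 1) _ (mkRing_mem_oddIdeal_pow G ha) (sub_egrProj_mem hw))
  rw [smul_sub, map_sub, sub_eq_zero] at h
  rw [h, egrProj_of_mem_deg (smul_mem_egrDeg ha (egrProj_mem_deg w)), if_pos rfl]

end Degree

/-! ### Components of elements of the presheaf of graded pieces. -/

section GradedPieces

variable {X : Type u} [TopologicalSpace X] {F : Opens X → Type u} [∀ U, CommRing (F U)]
  [RingPsh F] {G : ModSheaf F} {E : SuperModSheaf (Shf (Ext G))}

/-- The component of degree `q` of an element of `⨁_q E_(q) / E_(q+1)`. -/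
def grCoeff (q : ℕ) {V : Opens X} : GrPre E V →+ GrPiece E V q := DFinsupp.evalAddMonoidHom q

/-- The inclusion of `E_(q) / E_(q+1)` in the direct sum. -/
def grIncl (q : ℕ) {V : Opens X} : GrPiece E V q →+ GrPre E V := DirectSum.of (GrPiece E V) q

theorem grIncl_mk {q : ℕ} {V : Opens X} (v : filt E.toModSheaf q V) :
    grIncl q (GrPiece.mk v) = grOf v := rfl

theorem grCoeff_grOf {q : ℕ} {V : Opens X} (v : filt E.toModSheaf q V) :
    grCoeff q (grOf v) = GrPiece.mk v := DirectSum.of_eq_same q (GrPiece.mk v)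

theorem grCoeff_grOf_of_ne {q r : ℕ} {V : Opens X} (v : filt E.toModSheaf r V) (h : r ≠ q) :
    grCoeff q (grOf v) = 0 := DirectSum.of_eq_of_ne r q _ (Ne.symm h)

/-- The map from the presheaf `⨁_q E_(q) / E_(q+1)` to the associated sheaf `gr E`. -/
def grMk (V : Opens X) : GrPre E V →+ (grSheaf E).sec V := Shf.mk V

theorem symbol_eq {q : ℕ} {V : Opens X} (v : filt E.toModSheaf q V) :
    symbol v = grMk V (grOf v) := rfl

theorem res_grMk {V W : Opens X} (h : W ≤ V) (w : GrPre E V) :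
    res (grSheaf E).sec h (grMk V w) = grMk W (res (GrPre E) h w) := Shf.res_mk h w

end GradedPieces

/-! ### Local isomorphisms congruent modulo `(E_gr)_(1)` induce `gr E ≃ E_gr`. -/

section LocalIsos

variable {X : Type u} [TopologicalSpace X] {F : Opens X → Type u} [∀ U, CommRing (F U)]
  [RingPsh F] [SuperRing F] [PurelyEven F] {G : ModSheaf F}

/-- Parity preserving isomorphisms `δ_i : E|_{U_i} → E_gr|_{U_i}` over a covering, which agree
modulo `(E_gr)_(1)` on the intersections. -/
structure LocalIsos (E : SuperModSheaf (Shf (Ext G))) (S : SuperModSheaf F) where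
  ι : Type u
  cov : ι → Opens X
  iSup_cov : ⨆ i, cov i = ⊤
  iso : ∀ i, IsoOn E.toModSheaf (Egr G S).toModSheaf (cov i)
  preserves_par : ∀ i k, (iso i).Preserves (E.par k) ((Egr G S).par k)
  sub_mem : ∀ (i j : ι) (V : Opens X) (hi : V ≤ cov i) (hj : V ≤ cov j) (v : E.sec V),
    (iso i).app V hi v - (iso j).app V hj v ∈ filt (Egr G S).toModSheaf 1 V

namespace LocalIsos

variable {E : SuperModSheaf (Shf (Ext G))} {S : SuperModSheaf F} (A : LocalIsos E S)

theorem exists_mem_cov (x : X) : ∃ i, x ∈ A.cov i :=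
  Opens.mem_iSup.1 (A.iSup_cov ▸ Opens.mem_top x)

/-- For `v` in `E_(q)` the images `δ_i v` and `δ_j v` differ by a section of `(E_gr)_(q+1)`, because
agreement modulo `(E_gr)_(1)` improves by `q` on `J^q E`. Their degree `q` parts therefore coincide
on overlaps and glue. -/
theorem existsUnique_component (q : ℕ) (V : Opens X) (v : filt E.toModSheaf q V) :
    ∃! t : (Egr G S).sec V, ∀ (i : A.ι) (W : Opens X) (hW : W ≤ V) (hi : W ≤ A.cov i),
      res (Egr G S).sec hW t = egrProj G S q W ((A.iso i).app W hi (res E.sec hW v.1)) := by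
  refine IsSheaf.existsUnique_glue (P := (Egr G S).sec) (Egr G S).isSheaf A.cov
    (A.iSup_cov ▸ le_top)
    (fun i W hW hi => egrProj G S q W ((A.iso i).app W hi (res E.sec hW v.1)))
    (fun i W Z hW hi hZ => ?_) (fun i j W hW hi hj => ?_)
  · rw [res_egrProj, (A.iso i).res_app, res_res]
  · rw [← sub_eq_zero, ← map_sub]
    -- Both isomorphisms are restricted to `W`, so that they live over one open set and can be
    -- compared.
    let φ := (A.iso i).restrict hi
    let ψ := (A.iso j).restrict hj
    exact egrProj_eq_zero (IsoOn.app_sub_mem_filt (φ := φ) (ψ := ψ) le_rfl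
      (fun Z hZ w => A.sub_mem i j Z (hZ.trans hi) (hZ.trans hj) w)
      ((filt E.toModSheaf q).res_mem hW v.2))

/-- The degree `q` part of the images under the `δ_i` of a section of `E_(q)`. -/
def component (q : ℕ) (V : Opens X) : filt E.toModSheaf q V →+ (Egr G S).sec V :=
  AddMonoidHom.mk' (fun v => (A.existsUnique_component q V v).choose) fun v w =>
    (A.existsUnique_component q V (v + w)).unique
      (A.existsUnique_component q V (v + w)).choose_spec.1 fun i W hW hi => by
        rw [map_add, (A.existsUnique_component q V v).choose_spec.1 i W hW hi,
          (A.existsUnique_component q V w).choose_spec.1 i W hW hi, ← map_add, ← map_add,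
          ← map_add]
        rfl

theorem res_component_eq {q : ℕ} {V : Opens X} (v : filt E.toModSheaf q V) (i : A.ι)
    {W : Opens X} (hW : W ≤ V) (hi : W ≤ A.cov i) :
    res (Egr G S).sec hW (A.component q V v) =
      egrProj G S q W ((A.iso i).app W hi (res E.sec hW v.1)) :=
  (A.existsUnique_component q V v).choose_spec.1 i W hW hi

theorem component_unique {q : ℕ} {V : Opens X} (v : filt E.toModSheaf q V)
    {t : (Egr G S).sec V} (h : ∀ (i : A.ι) (W : Opens X) (hW : W ≤ V) (hi : W ≤ A.cov i),
      res (Egr G S).sec hW t = egrProj G S q W ((A.iso i).app W hi (res E.sec hW v.1))) :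
    A.component q V v = t :=
  (A.existsUnique_component q V v).unique (A.existsUnique_component q V v).choose_spec.1 h

theorem component_eq {q : ℕ} {V : Opens X} (v : filt E.toModSheaf q V) (i : A.ι)
    (hi : V ≤ A.cov i) :
    A.component q V v = egrProj G S q V ((A.iso i).app V hi v.1) := by
  have := A.res_component_eq v i le_rfl hi
  rwa [res_self, res_self] at this

theorem res_component {q : ℕ} {V W : Opens X} (h : W ≤ V) (v : filt E.toModSheaf q V) :
    res (Egr G S).sec h (A.component q V v) =
      A.component q W ⟨res E.sec h v.1, (filt E.toModSheaf q).res_mem h v.2⟩ :=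
  (A.component_unique _ fun i Z hZ hi => by
    rw [res_res, A.res_component_eq v i (hZ.trans h) hi, res_res]).symm

theorem component_mem_deg {q : ℕ} {V : Opens X} (v : filt E.toModSheaf q V) :
    A.component q V v ∈ EgrDeg G S q V := by
  refine Shf.mem_sub_of_local fun x hx => ?_
  obtain ⟨i, hi⟩ := A.exists_mem_cov x
  refine ⟨V ⊓ A.cov i, ⟨hx, hi⟩, inf_le_left, ?_⟩
  exact Eq.subst (motive := fun z => z ∈ EgrDeg G S q (V ⊓ A.cov i))
    (A.res_component_eq v i inf_le_left inf_le_right).symm (egrProj_mem_deg _)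

theorem component_mem_par {q : ℕ} {k : ZMod 2} {V : Opens X} (v : filt E.toModSheaf q V)
    (hv : v.1 ∈ E.par k V) : A.component q V v ∈ (Egr G S).par k V := by
  refine Shf.mem_sub_of_local fun x hx => ?_
  obtain ⟨i, hi⟩ := A.exists_mem_cov x
  refine ⟨V ⊓ A.cov i, ⟨hx, hi⟩, inf_le_left, ?_⟩
  exact Eq.subst (motive := fun z => z ∈ (Egr G S).par k (V ⊓ A.cov i))
    (A.res_component_eq v i inf_le_left inf_le_right).symm
    (egrProj_mem_par ((A.preserves_par i k _ _ _).2 ((E.par k).res_mem _ hv)))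

theorem component_smul {p q : ℕ} {V : Opens X} {a : Ext G V} (ha : a ∈ extPow G p V)
    (v : filt E.toModSheaf q V) :
    A.component (p + q) V ⟨Shf.mkRing V a • v.1,
      smul_mem_filt _ (mkRing_mem_oddIdeal_pow G ha) v.2⟩ =
      Shf.mkRing V a • A.component q V v := by
  refine A.component_unique _ fun i W hW hi => ?_
  have e : res (Shf (Ext G)) hW (Shf.mkRing V a) = Shf.mkRing W (res (Ext G) hW a) :=
    Shf.res_mk hW a
  have ha' : res (Ext G) hW a ∈ extPow G p W := extRes_mem_extPow G hW p ha
  rw [ModPsh.res_smul (R := Shf (Ext G)), ModPsh.res_smul (R := Shf (Ext G)), map_smul, e,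
    egrProj_smul ha'
      ((IsoOn.preserves_filt _ q W hi _).2 ((filt E.toModSheaf q).res_mem hW v.2)),
    A.res_component_eq v i hW hi]

/-- Locally the component is the degree `q` part of `δ_i v`, which lies in `(E_gr)_(q)`; it vanishes
exactly when `δ_i v` is in `(E_gr)_(q+1)`, and `δ_i` preserves and reflects the filtration. The
induced map on `E_(q) / E_(q+1)` is thus well defined and injective. -/
theorem component_eq_zero_iff {q : ℕ} {V : Opens X} (v : filt E.toModSheaf q V) :
    A.component q V v = 0 ↔ v.1 ∈ filt E.toModSheaf (q + 1) V := by
  refine ⟨fun h => mem_filt_of_local fun x hx => ?_, fun h => A.component_unique _ ?_⟩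
  · obtain ⟨i, hi⟩ := A.exists_mem_cov x
    refine ⟨V ⊓ A.cov i, ⟨hx, hi⟩, inf_le_left, ?_⟩
    have h₁ := A.res_component_eq v i inf_le_left (inf_le_right : V ⊓ A.cov i ≤ A.cov i)
    rw [h, map_zero] at h₁
    have h₂ := sub_egrProj_mem (((A.iso i).preserves_filt q (V ⊓ A.cov i) inf_le_right _).2
      ((filt E.toModSheaf q).res_mem inf_le_left v.2))
    rw [← h₁, sub_zero] at h₂
    exact ((A.iso i).preserves_filt (q + 1) _ _ _).1 h₂
  · intro i W hW hi
    rw [map_zero, egrProj_eq_zero]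
    exact ((A.iso i).preserves_filt (q + 1) _ _ _).2 ((filt E.toModSheaf (q + 1)).res_mem hW h)

/-- Local surjectivity in each degree: `δ_i⁻¹ w` lies in `E_(n)`, and it inherits every parity of
`w`. The parity is recorded with the same preimage because both gradings have to be reflected. -/
theorem exists_component_eq {n : ℕ} {V : Opens X} {i : A.ι} (hi : V ≤ A.cov i)
    {w : (Egr G S).sec V} (hw : w ∈ EgrDeg G S n V) :
    ∃ v : filt E.toModSheaf n V, A.component n V v = w ∧
      ∀ k, w ∈ (Egr G S).par k V → v.1 ∈ E.par k V := by
  have e := ((A.iso i).app V hi).apply_symm_apply w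
  refine ⟨⟨((A.iso i).app V hi).symm w, ?_⟩, ?_, fun k hk => ?_⟩
  · rw [← (A.iso i).preserves_filt n V hi, e]
    exact egrDeg_le_filt hw
  · rw [A.component_eq _ i hi, e, egrProj_of_mem_deg hw, if_pos rfl]
  · rwa [← A.preserves_par i k V hi, e]

/-- The map `⨁_q E_(q) / E_(q+1) → E_gr` whose components are given by `component`. -/
def grMap (V : Opens X) : GrPre E V →+ Shf (Ten G S) V :=
  DirectSum.toAddMonoid fun q => QuotientAddGroup.lift
    ((filt E.toModSheaf (q + 1) V).addSubgroupOf (filt E.toModSheaf q V)) (A.component q V)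
    fun v hv => (A.component_eq_zero_iff v).2 hv

theorem grMap_grOf {V : Opens X} {q : ℕ} (v : filt E.toModSheaf q V) :
    A.grMap V (grOf v) = A.component q V v :=
  DirectSum.toAddMonoid_of _ _ _

theorem res_grMap {V W : Opens X} (h : W ≤ V) (w : GrPre E V) :
    res (Shf (Ten G S)) h (A.grMap V w) = A.grMap W (res (GrPre E) h w) := by
  induction w using grPre_induction with
  | h₀ => simp only [map_zero]
  | h₁ q v => rw [grMap_grOf, res_grOf, grMap_grOf]; exact A.res_component h v
  | h₂ v w hv hw => simp only [map_add, hv, hw]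

theorem grMap_smul {V : Opens X} (f : Ext G V) (w : GrPre E V) :
    A.grMap V (f • w) = Shf.mkRing V f • A.grMap V w := by
  induction w using grPre_induction with
  | h₀ => rw [smul_zero, map_zero, smul_zero]
  | h₂ v w hv hw => rw [smul_add, map_add, map_add, smul_add, hv, hw]
  | h₁ q v =>
    induction f using DirectSum.Decomposition.inductionOn (fun p => extPow G p V) with
    | zero => rw [zero_smul, map_zero, map_zero, zero_smul]
    | add a b ha hb => rw [add_smul, map_add, map_add, add_smul, ha, hb]
    | @homogeneous p a =>
      rw [smul_grOf, grMap_grOf, grMap_grOf]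
      exact A.component_smul a.2 v

/-- Each component lands in its own degree, so projecting the image selects one summand. Injectivity
of `grMap` is thereby reduced to that of the components. -/
theorem egrProj_grMap (q : ℕ) {V : Opens X} (w : GrPre E V) :
    egrProj G S q V (A.grMap V w) = A.grMap V (grIncl q (grCoeff q w)) := by
  induction w using grPre_induction with
  | h₀ => exact (map_zero (egrProj G S q V)).trans (by simp only [map_zero]; rfl)
  | h₁ r v =>
    rw [grMap_grOf]
    refine (egrProj_of_mem_deg (A.component_mem_deg v)).trans ?_
    split_ifs with h
    · subst h
      rw [grCoeff_grOf, grIncl_mk, grMap_grOf]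
    · rw [grCoeff_grOf_of_ne v h, map_zero, map_zero]
      rfl
  | h₂ v w hv hw =>
    rw [map_add]
    refine (map_add (egrProj G S q V) _ _).trans ((congrArg₂ (· + ·) hv hw).trans ?_)
    simp only [map_add]
    rfl

theorem grMap_eq_zero {V : Opens X} {w : GrPre E V} (h : A.grMap V w = 0) : w = 0 := by
  refine DFinsupp.ext fun q => ?_
  have h₁ := A.egrProj_grMap q w
  rw [h] at h₁
  obtain ⟨v, hv⟩ := QuotientAddGroup.mk_surjective (grCoeff q w)
  have h₂ : A.component q V v = 0 := by
    rw [← grMap_grOf, ← grIncl_mk]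
    refine Eq.trans ?_ (h₁.symm.trans (map_zero _))
    exact congrArg (fun z => A.grMap V (grIncl q z)) hv
  exact hv.symm.trans ((QuotientAddGroup.eq_zero_iff v).2 ((A.component_eq_zero_iff v).1 h₂))

theorem exists_grMap_eq_of_tenDeg {V : Opens X} {i : A.ι} (hi : V ≤ A.cov i) {q : ℕ}
    {b : Ten G S V} (hb : b ∈ tenDeg G S q V) :
    ∃ w ∈ grSub E q (SubPsh.whole E.sec) V, A.grMap V w = Shf.mk V b := by
  obtain ⟨v, hv, -⟩ := A.exists_component_eq hi (Shf.mk_mem_sub (A := tenDeg G S q) hb)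
  exact ⟨grOf v, AddSubgroup.subset_closure ⟨v, AddSubgroup.mem_top _, rfl⟩,
    (A.grMap_grOf v).trans hv⟩

/-- The exterior factor of a tensor of parity `k` is split further into degrees `n` of the right
parity; each resulting tensor is homogeneous for both gradings, so that `exists_component_eq`
applies. -/
theorem exists_grMap_eq_of_tenPar {V : Opens X} {i : A.ι} (hi : V ≤ A.cov i) {k : ZMod 2}
    {b : Ten G S V} (hb : b ∈ tenPar G S k V) :
    ∃ w ∈ grPrePar E k V, A.grMap V w = Shf.mk V b := by
  induction hb using AddSubgroup.closure_induction with
  | mem b hb =>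
    obtain ⟨r, j, hk, a, ha, s, hs, rfl⟩ := hb
    refine extPar_induction
      (C := fun a => ∃ w ∈ grPrePar E k V, A.grMap V w = Shf.mk V (tmul a s)) ?_
      (fun n hn a ha => ?_) ?_ ha
    · exact ⟨0, zero_mem _, by rw [map_zero, zero_tmul, map_zero]⟩
    · obtain ⟨v, hv, hp⟩ := A.exists_component_eq hi (Shf.mk_mem_sub (A := tenDeg G S n)
        (AddSubgroup.subset_closure ⟨a, ha, s, rfl⟩))
      refine ⟨grOf v, AddSubgroup.mem_iSup_of_mem n (AddSubgroup.subset_closure ⟨v, hp k ?_, rfl⟩),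
        (A.grMap_grOf v).trans hv⟩
      exact Shf.mk_mem_sub (A := tenPar G S k)
        (AddSubgroup.subset_closure ⟨r, j, hk, a, hn ▸ extPow_le_extPar ha, s, hs, rfl⟩)
    · rintro a b ⟨v, hv, e⟩ ⟨w, hw, e'⟩
      exact ⟨v + w, add_mem hv hw, by rw [map_add, e, e', add_tmul, map_add]⟩
  | zero => exact ⟨0, zero_mem _, by rw [map_zero, map_zero]⟩
  | add b c _ _ hb hc =>
    obtain ⟨v, hv, e⟩ := hb
    obtain ⟨w, hw, e'⟩ := hc
    exact ⟨v + w, add_mem hv hw, by rw [map_add, map_add, e, e']⟩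
  | neg b _ hb =>
    obtain ⟨v, hv, e⟩ := hb
    exact ⟨-v, neg_mem hv, by rw [map_neg, map_neg, e]⟩

theorem exists_grMap_eq {V : Opens X} {i : A.ι} (hi : V ≤ A.cov i) (b : Ten G S V) :
    ∃ w, A.grMap V w = Shf.mk V b := by
  obtain ⟨b₀, h₀, b₁, h₁, rfl⟩ := AddSubgroup.mem_sup.1
    ((tenPar_isCompl G S V).codisjoint.top_le (AddSubgroup.mem_top b))
  obtain ⟨w₀, -, e₀⟩ := A.exists_grMap_eq_of_tenPar hi h₀
  obtain ⟨w₁, -, e₁⟩ := A.exists_grMap_eq_of_tenPar hi h₁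
  exact ⟨w₀ + w₁, by rw [map_add, map_add, e₀, e₁]⟩

/-- The map `gr E → E_gr` defined by `grMap`. -/
def grLift (V : Opens X) : (grSheaf E).sec V →ₗ[Shf (Ext G) V] (Egr G S).sec V :=
  { Shf.lift A.grMap A.res_grMap V with
    map_smul' := fun r s => Shf.lift_smul (fun _ r a => A.grMap_smul r a) r s }

theorem grLift_mk {V : Opens X} (w : GrPre E V) : A.grLift V (grMk V w) = A.grMap V w := rfl

theorem res_grLift {V W : Opens X} (h : W ≤ V) (s : (grSheaf E).sec V) :
    res (Egr G S).sec h (A.grLift V s) = A.grLift W (res (grSheaf E).sec h s) := rfl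

/-- The map `grMap` is injective over every open set, and injectivity of a map of presheaves passes
to the associated sheaf. -/
theorem grLift_eq_zero {V : Opens X} {s : (grSheaf E).sec V} (hs : A.grLift V s = 0) : s = 0 := by
  refine IsSheaf.ext_of_local (P := (grSheaf E).sec) (grSheaf E).isSheaf fun x hx => ?_
  obtain ⟨W, hxW, hW, a, -, e⟩ := Shf.exists_res_eq_mk (Shf.mem_sub_whole (P := GrPre E) s) hx
  refine ⟨W, hxW, hW, ?_⟩
  have h := A.res_grLift hW s
  rw [hs, map_zero] at h
  have h' : A.grMap W a = 0 := (h.trans (congrArg (A.grLift W) e)).symm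
  rw [map_zero]
  exact e.trans ((congrArg (Shf.mk W) (A.grMap_eq_zero h')).trans (map_zero _))

/-- Sections of `gr E` whose images are locally in a subpresheaf `B` covered by `C` are in the
subsheaf generated by `C`. -/
theorem mem_sub_of_grLift_mem {B : SubPsh (Ten G S)} {C : SubPsh (GrPre E)}
    (h : ∀ (i : A.ι) (V : Opens X), V ≤ A.cov i → ∀ b ∈ B V, ∃ w ∈ C V, A.grMap V w = Shf.mk V b)
    {V : Opens X} {s : (grSheaf E).sec V} (hs : A.grLift V s ∈ Shf.sub B V) :
    s ∈ Shf.sub C V := by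
  refine Shf.mem_sub_of_local fun x hx => ?_
  obtain ⟨i, hi⟩ := A.exists_mem_cov x
  obtain ⟨W, hxW, hW, b, hb, e⟩ := Shf.exists_res_eq_mk hs hx
  have hWV : W ⊓ A.cov i ≤ V := inf_le_left.trans hW
  obtain ⟨w, hw, e'⟩ := h i (W ⊓ A.cov i) inf_le_right _ (B.res_mem inf_le_left hb)
  refine ⟨W ⊓ A.cov i, ⟨hxW, hi⟩, hWV, ?_⟩
  have key : res (grSheaf E).sec hWV s = grMk _ w := by
    refine sub_eq_zero.1 (A.grLift_eq_zero ?_)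
    rw [map_sub, ← A.res_grLift, sub_eq_zero]
    refine Eq.trans ?_ (e'.symm.trans (A.grLift_mk w).symm)
    have := congrArg (res (Shf (Ten G S)) (inf_le_left : W ⊓ A.cov i ≤ W)) e
    exact (res_res (Shf (Ten G S)) hW inf_le_left _).symm.trans (this.trans (Shf.res_mk _ _))
  exact Eq.subst (motive := fun z => z ∈ Shf.sub C (W ⊓ A.cov i)) key.symm (Shf.mk_mem_sub hw)

/-- The isomorphism `gr E ≃ E_gr` induced by the `δ_i`. -/
def grIso : GrIso E S where
  iso := IsoOn.ofInjective (fun V _ => A.grLift V) (fun _ h s => A.res_grLift h s)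
    (fun V _ s hs => A.grLift_eq_zero hs) (fun V _ t x hx => by
      obtain ⟨i, hi⟩ := A.exists_mem_cov x
      obtain ⟨W, hxW, hW, b, -, e⟩ :=
        Shf.exists_res_eq_mk (Shf.mem_sub_whole (P := Ten G S) t) hx
      obtain ⟨w, hw⟩ := A.exists_grMap_eq (inf_le_right : W ⊓ A.cov i ≤ A.cov i)
        (res (Ten G S) inf_le_left b)
      refine ⟨W ⊓ A.cov i, ⟨hxW, hi⟩, inf_le_left.trans hW, grMk _ w, ?_⟩
      refine (A.grLift_mk w).trans (hw.trans ?_)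
      have := congrArg (res (Shf (Ten G S)) (inf_le_left : W ⊓ A.cov i ≤ W)) e
      exact ((res_res (Shf (Ten G S)) hW inf_le_left t).symm.trans
        (this.trans (Shf.res_mk _ _))).symm)
  preserves_deg q V hV s := by
    refine ⟨fun h => A.mem_sub_of_grLift_mem
      (fun i V hi b hb => A.exists_grMap_eq_of_tenDeg hi hb) h, fun h => ?_⟩
    refine Shf.lift_mem (A := grSub E q (SubPsh.whole E.sec)) (B := tenDeg G S q) (f := A.grMap)
      (hf := A.res_grMap) (fun W w hw => ?_) h
    induction hw using AddSubgroup.closure_induction with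
    | mem w hw =>
      obtain ⟨v, -, rfl⟩ := hw
      rw [grMap_grOf]
      exact A.component_mem_deg v
    | zero => rw [map_zero]; exact zero_mem _
    | add v w _ _ hv hw => rw [map_add]; exact add_mem hv hw
    | neg v _ hv => rw [map_neg]; exact neg_mem hv
  preserves_par k V hV s := by
    refine ⟨fun h => A.mem_sub_of_grLift_mem
      (fun i V hi b hb => A.exists_grMap_eq_of_tenPar hi hb) h, fun h => ?_⟩
    refine Shf.lift_mem (A := grPrePar E k) (B := tenPar G S k) (f := A.grMap)
      (hf := A.res_grMap) (fun W w hw => ?_) h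
    have hle : (⨆ q, grSub E q (E.par k) W) ≤
        (Shf.sub (tenPar G S k) W).comap (A.grMap W) := by
      refine iSup_le fun q => (AddSubgroup.closure_le _).2 ?_
      rintro _ ⟨v, hv, rfl⟩
      change A.grMap W (grOf v) ∈ Shf.sub (tenPar G S k) W
      rw [grMap_grOf]
      exact A.component_mem_par v hv
    exact hle hw

theorem grIso_symbol {V : Opens X} {q : ℕ} (v : filt E.toModSheaf q V) :
    A.grIso.iso.app V le_top (symbol v) = A.component q V v :=
  A.grMap_grOf v

/-- The isomorphism `grIso` sends the class of `v` to the degree `q` part of `δ_i v`, and the terms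
left over have degree at least `q + 1`. So every `δ_i` induces `grIso`, which is what `IsTransition`
demands of `θ`. -/
theorem app_sub_grIso_mem (i : A.ι) {V : Opens X} (hi : V ≤ A.cov i) {q : ℕ}
    (v : filt E.toModSheaf q V) :
    (A.iso i).app V hi v.1 - A.grIso.iso.app V le_top (symbol v) ∈
      filt (Egr G S).toModSheaf (q + 1) V := by
  rw [grIso_symbol, A.component_eq v i hi]
  exact sub_egrProj_mem (((A.iso i).preserves_filt q V hi _).2 v.2)

end LocalIsos

end LocalIsos

/-! ### Recognising bases and parities locally. -/

section LocalBases

variable {X : Type u} [TopologicalSpace X]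

/-- Finitely many conditions which hold on small neighbourhoods of `x` hold on a common one. -/
theorem exists_common_nhd {ι : Type} [Fintype ι] {x : X} {U : Opens X}
    (hU : x ∈ U) {p : ι → Opens X → Prop}
    (hp : ∀ (i : ι) (V W : Opens X), W ≤ V → p i V → p i W)
    (h : ∀ i, ∃ V : Opens X, x ∈ V ∧ p i V) :
    ∃ V : Opens X, x ∈ V ∧ V ≤ U ∧ ∀ i, p i V := by
  choose V hx hV using h
  refine ⟨U ⊓ Finset.univ.inf V, ⟨hU, ?_⟩, inf_le_left,
    fun i => hp i _ _ (inf_le_right.trans (Finset.inf_le (Finset.mem_univ i))) (hV i)⟩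
  rw [Opens.coe_finset_inf]
  simpa using hx

theorem Shf.exists_res_eq_of_mk_eq {P : Opens X → Type u} [∀ U, AddCommGroup (P U)] [AddPsh P]
    {V : Opens X} {a b : P V} (h : mk V a = mk V b) {x : X} (hx : x ∈ V) :
    ∃ (W : Opens X) (_ : x ∈ W) (hW : W ≤ V), res P hW a = res P hW b := by
  obtain ⟨Z, hZ, h₁, _, e⟩ := germ_eq (congrArg (fun s : Shf P V => s.1 ⟨x, hx⟩) h)
  exact ⟨Z, hZ, h₁, e⟩

variable {R : Opens X → Type u} [∀ U, Ring (R U)] [RingPsh R]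

/-- Injectivity over every open set makes local coordinates unique, so they agree on overlaps and
glue in the sheaf `R`. -/
theorem isBasisOn_of_local (hR : IsSheaf R) {E : ModSheaf R} {ι : Type} [Fintype ι] {U : Opens X}
    {e : ι → E.sec U}
    (hinj : ∀ (V : Opens X) (h : V ≤ U) (c : ι → R V), ∑ i, c i • res E.sec h (e i) = 0 → c = 0)
    (hsurj : ∀ (V : Opens X) (h : V ≤ U) (w : E.sec V), ∀ x ∈ V,
      ∃ (W : Opens X) (_ : x ∈ W) (hW : W ≤ V) (c : ι → R W),
        ∑ i, c i • res E.sec (hW.trans h) (e i) = res E.sec hW w) : IsBasisOn E e := by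
  have inj : ∀ (V : Opens X) (h : V ≤ U) (c d : ι → R V),
      ∑ i, c i • res E.sec h (e i) = ∑ i, d i • res E.sec h (e i) → c = d := by
    intro V h c d hcd
    refine sub_eq_zero.1 (hinj V h _ ?_)
    simp only [Pi.sub_apply, sub_smul, Finset.sum_sub_distrib]
    exact sub_eq_zero.2 hcd
  refine fun V h => ⟨fun c d => inj V h c d, fun w => ?_⟩
  choose W hx hW c hc using hsurj V h w
  have glue : ∀ i, ∃ t : R V, ∀ (x : V), res R (hW x x.2) t = c x x.2 i := by
    intro i
    obtain ⟨t, ht, -⟩ := IsSheaf.existsUnique_glue hR (fun x : V => W x x.2) (V := V)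
      (fun x hxV => Opens.mem_iSup.2 ⟨⟨x, hxV⟩, hx x hxV⟩)
      (fun x Z _ hZ => res R hZ (c x x.2 i)) (fun _ _ _ _ _ _ => res_res _ _ _ _)
      (fun x y Z hZ h₁ h₂ => by
        have key : ∀ (x : V) (h₁ : Z ≤ W x x.2),
            ∑ i, res R h₁ (c x x.2 i) • res E.sec (hZ.trans h) (e i) = res E.sec hZ w := by
          intro x h₁
          rw [← res_res E.sec (hW x x.2) h₁ w, ← hc,
            res_sum_smul_res E e ((hW x x.2).trans h) h₁ (c x x.2)]
        exact congrFun (inj Z (hZ.trans h) _ _ ((key x h₁).trans (key y h₂).symm)) i)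
    exact ⟨t, fun x => (ht x _ (hW x x.2) le_rfl).trans (res_self R _)⟩
  choose t ht using glue
  refine ⟨t, IsSheaf.ext_of_local (P := E.sec) E.isSheaf fun x hxV =>
    ⟨W x hxV, hx x hxV, hW x hxV, ?_⟩⟩
  beta_reduce
  rw [res_sum_smul_res E e h (hW x hxV) t, ← hc]
  exact Finset.sum_congr rfl fun i _ => by rw [ht i ⟨x, hxV⟩]

/-- The homogeneous parts are only assumed to be complementary subpresheaves. They are nevertheless
subsheaves: the component of the other parity vanishes locally, hence globally. -/
theorem SuperModSheaf.mem_par_of_local [SuperRing R] {E : SuperModSheaf R} {k : ZMod 2}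
    {U : Opens X} {v : E.sec U}
    (h : ∀ x ∈ U, ∃ (V : Opens X) (_ : x ∈ V) (hV : V ≤ U), res E.sec hV v ∈ E.par k V) :
    v ∈ E.par k U := by
  obtain ⟨a, ha, b, hb, rfl⟩ := E.exists_par_add k v
  have : b = 0 := by
    refine IsSheaf.ext_of_local (P := E.sec) E.isSheaf fun x hx => ?_
    obtain ⟨V, hxV, hV, m⟩ := h x hx
    refine ⟨V, hxV, hV, ?_⟩
    rw [map_zero]
    refine E.disjoint_par k ?_ ((E.par (k + 1)).res_mem hV hb)
    have := sub_mem m ((E.par k).res_mem hV ha)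
    rwa [map_add, add_sub_cancel_left] at this
  rw [this, add_zero]
  exact ha

end LocalBases

/-! ### Bases of `O ⊗ S` obtained from bases of `S`. -/

section EgrBasis

variable {X : Type u} [TopologicalSpace X] {F : Opens X → Type u} [∀ U, CommRing (F U)]
  [RingPsh F] {G : ModSheaf F}

theorem algebraMap_mem_par_zero {U : Opens X} (f : F U) :
    algebraMap (F U) (Ext G U) f ∈ extPar G 0 U := by
  have := extPow_le_extPar (SetLike.algebraMap_mem_graded (fun p => extPow G p U) f)
  rwa [Nat.cast_zero] at this

variable [SuperRing F] {S : SuperModSheaf F}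

theorem tmul_sum_smul {ι : Type} [Fintype ι] {U : Opens X} (a : Ext G U) (c : ι → F U)
    (s : ι → S.sec U) :
    (tmul a (∑ i, c i • s i) : Ten G S U) = ∑ i, (c i • a) • tmul 1 (s i) := by
  refine (TensorProduct.tmul_sum a Finset.univ _).trans (Finset.sum_congr rfl fun i _ => ?_)
  rw [smul_tmul, mul_one]
  exact (TensorProduct.smul_tmul (c i) a (s i)).symm

/-- This is base change of a basis from `F(V)` to `⋀ G(V)`, before sheafification. -/
theorem bijective_sum_smul_tmul {ι : Type} [Fintype ι] {U V : Opens X} {s : ι → S.sec U}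
    (hs : IsBasisOn S.toModSheaf s) (h : V ≤ U) :
    Function.Bijective (fun c : ι → Ext G V => (∑ i, c i • tmul 1 (res S.sec h (s i)) : Ten G S V)) := by
  let B : Module.Basis ι (ExteriorAlgebra (F V) (G.sec V))
    (ExteriorAlgebra (F V) (G.sec V) ⊗[F V] S.sec V) := Algebra.TensorProduct.basis _ (hs.toBasis h)
  have hB : ∀ i, B i = (1 : ExteriorAlgebra (F V) (G.sec V)) ⊗ₜ[F V] res S.sec h (s i) := fun i => by
    rw [Algebra.TensorProduct.basis_apply, IsBasisOn.toBasis_apply]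
  have : (fun c : ι → Ext G V => (∑ i, c i • tmul 1 (res S.sec h (s i)) : Ten G S V)) =
      B.equivFun.symm := by
    funext c
    refine Eq.trans (Finset.sum_congr rfl fun i _ => ?_)
      (Module.Basis.equivFun_symm_apply B c).symm
    exact congrArg (fun z : Ten G S V => c i • z) (hB i).symm
  rw [this]
  exact B.equivFun.symm.bijective

/-- The sections of degree at least `q` have coordinates of degree at least `q`. -/
theorem exists_coords_of_mem_tenGE {ι : Type} [Fintype ι] {U V : Opens X} {s : ι → S.sec U}
    (hs : IsBasisOn S.toModSheaf s) (h : V ≤ U) {q : ℕ} {b : Ten G S V}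
    (hb : b ∈ tenGE G S q V) : ∃ a : ι → Ext G V, (∀ i, a i ∈ extGE G q V) ∧
      b = ∑ i, a i • tmul 1 (res S.sec h (s i)) := by
  induction hb using AddSubgroup.closure_induction with
  | mem b hb =>
    obtain ⟨k, hk, a, ha, t, rfl⟩ := hb
    obtain ⟨c, rfl⟩ := (hs V h).2 t
    exact ⟨fun i => c i • a, fun i => extPow_le_extGE hk (Submodule.smul_mem _ _ ha),
      tmul_sum_smul _ _ _⟩
  | zero => exact ⟨0, fun _ => zero_mem _, by simp⟩
  | add b c _ _ hb hc =>
    obtain ⟨a, ha, rfl⟩ := hb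
    obtain ⟨a', ha', rfl⟩ := hc
    exact ⟨a + a', fun i => add_mem (ha i) (ha' i), by
      simp only [Pi.add_apply, add_smul, Finset.sum_add_distrib]⟩
  | neg b _ hb =>
    obtain ⟨a, ha, rfl⟩ := hb
    exact ⟨-a, fun i => neg_mem (ha i), by
      simp only [Pi.neg_apply, neg_smul, Finset.sum_neg_distrib]⟩

variable [PurelyEven F]

/-- The section `1 ⊗ s` of `E_gr`. -/
def oneTmul {U : Opens X} (s : S.sec U) : (Egr G S).sec U := Shf.mk U (tmul 1 s : Ten G S U)

theorem res_oneTmul {U V : Opens X} (h : V ≤ U) (s : S.sec U) :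
    res (Egr G S).sec h (oneTmul s) = oneTmul (res S.sec h s) := by
  refine (Shf.res_mk h _).trans ?_
  rw [res_tmul, RingPsh.res_one]
  rfl

theorem mk_sum_smul_tmul {ι : Type} [Fintype ι] {U : Opens X} (a : ι → Ext G U)
    (s : ι → S.sec U) :
    Shf.mk U (∑ i, a i • tmul 1 (s i) : Ten G S U) =
      (∑ i, Shf.mkRing U (a i) • oneTmul (s i) : (Egr G S).sec U) := by
  refine (map_sum (Shf.mk (P := Ten G S) U) _ _).trans (Finset.sum_congr rfl fun i _ => ?_)
  exact Shf.mk_smul _ _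

/-- A basis of `S` is a basis of `E_gr = O ⊗ S` over `O`. -/
theorem isBasisOn_oneTmul {ι : Type} [Fintype ι] {U : Opens X} {s : ι → S.sec U}
    (hs : IsBasisOn S.toModSheaf s) :
    IsBasisOn (Egr G S).toModSheaf (fun i => (oneTmul (s i) : (Egr G S).sec U)) := by
  refine isBasisOn_of_local (Shf.isSheaf (P := Ext G)) (fun V h c hc => ?_) (fun V h w x hx => ?_)
  · refine funext fun i => Shf.isSheaf.ext_of_local fun x hx => ?_
    -- The finitely many coordinates come from the presheaf on one common neighbourhood. The
    -- relation then holds in the presheaf after shrinking once more, where the coordinates are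
    -- known to vanish.
    obtain ⟨W, hxW, hWV', hW⟩ := exists_common_nhd hx
      (p := fun i W => ∃ (hW : W ≤ V) (a : Ext G W), res (Shf (Ext G)) hW (c i) = Shf.mk W a)
      (fun i W Z hZ ⟨hW, a, e⟩ => ⟨hZ.trans hW, res (Ext G) hZ a, by
        rw [← Shf.res_mk, ← e, res_res]⟩)
      (fun i => by
        obtain ⟨W, hxW, hW, a, -, e⟩ := Shf.exists_res_eq_mk (Shf.mem_sub_whole (c i)) hx
        exact ⟨W, hxW, hW, a, e⟩)
    choose hWV a e using hW
    have h₁ := congrArg (res (Egr G S).sec hWV') hc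
    rw [res_sum_smul_res (Egr G S).toModSheaf (fun i => oneTmul (s i)) h hWV' c, map_zero] at h₁
    have h₂ : Shf.mk W (∑ i, a i • tmul 1 (res S.sec (hWV'.trans h) (s i)) : Ten G S W) =
        Shf.mk W 0 := by
      rw [mk_sum_smul_tmul, map_zero]
      refine Eq.trans (Finset.sum_congr rfl fun i _ => ?_) h₁
      rw [res_oneTmul]
      exact congrArg (fun z : Shf (Ext G) W => z • (oneTmul _ : (Egr G S).sec W)) (e i).symm
    obtain ⟨Z, hxZ, hZ, h₃⟩ := Shf.exists_res_eq_of_mk_eq h₂ hxW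
    have h₄ : (fun i => res (Ext G) hZ (a i)) = 0 := by
      refine (bijective_sum_smul_tmul hs (hZ.trans (hWV'.trans h))).1 ?_
      beta_reduce
      rw [map_sum, map_zero] at h₃
      simp only [Pi.zero_apply, zero_smul, Finset.sum_const_zero]
      refine Eq.trans (Finset.sum_congr rfl fun i _ => ?_) h₃
      rw [ModPsh.res_smul (R := Ext G), res_tmul, RingPsh.res_one, res_res]
    refine ⟨Z, hxZ, hZ.trans hWV', ?_⟩
    rw [← res_res (Shf (Ext G)) hWV' hZ, e i, Shf.res_mk, congrFun h₄ i, Pi.zero_apply,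
      Pi.zero_apply, map_zero, map_zero]
  · obtain ⟨W, hxW, hW, b, -, e⟩ := Shf.exists_res_eq_mk (Shf.mem_sub_whole (P := Ten G S) w) hx
    obtain ⟨a, rfl⟩ := (bijective_sum_smul_tmul hs (hW.trans h)).2 b
    refine ⟨W, hxW, hW, fun i => Shf.mkRing W (a i), ?_⟩
    refine Eq.trans ?_ ((mk_sum_smul_tmul _ _).symm.trans e.symm)
    exact Finset.sum_congr rfl fun i _ => by rw [res_oneTmul]

/-- The coefficients are even, so the terms with `π i ≠ j` have the other parity; their sum is also
of parity `j`, hence zero. A homogeneous section can thus be written using only basis vectors of its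
own parity. -/
theorem sum_filter_parity {ι : Type} [Fintype ι] {U V : Opens X} {s : ι → S.sec U} {π : ι → ZMod 2}
    (hπ : ∀ i, s i ∈ S.par (π i) U) (h : V ≤ U) {j : ZMod 2} (c : ι → F V)
    (hc : ∑ i, c i • res S.sec h (s i) ∈ S.par j V) :
    ∑ i, c i • res S.sec h (s i) =
      ∑ i, (if π i = j then c i else 0) • res S.sec h (s i) := by
  have two : ∀ i j : ZMod 2, i ≠ j → i = j + 1 := by decide
  have hm : ∀ i, c i • res S.sec h (s i) ∈ S.par (π i) V := fun i => by
    have := S.smul_mem (PurelyEven.mem_zero (c i)) ((S.par (π i)).res_mem h (hπ i))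
    rwa [zero_add] at this
  have h₁ : ∑ i, (if π i = j then c i else 0) • res S.sec h (s i) ∈ S.par j V := by
    refine sum_mem fun i _ => ?_
    split_ifs with hi
    · exact hi ▸ hm i
    · rw [zero_smul]; exact zero_mem _
  refine sub_eq_zero.1 (S.disjoint_par j (sub_mem hc h₁) ?_)
  rw [← Finset.sum_sub_distrib]
  refine sum_mem fun i _ => ?_
  rw [← sub_smul]
  split_ifs with hi
  · rw [sub_self, zero_smul]; exact zero_mem _
  · rw [sub_zero]; exact two _ _ hi ▸ hm i

/-- The isomorphism `E_gr|_U → E|_U` which sends a homogeneous basis of `S` to a basis of `E` of the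
same parities preserves the parity. -/
theorem ofBases_preserves_par {E : SuperModSheaf (Shf (Ext G))} {ι : Type} [Fintype ι]
    {U : Opens X} {s : ι → S.sec U} {π : ι → ZMod 2} (hs : IsBasisOn S.toModSheaf s)
    (hπ : ∀ i, s i ∈ S.par (π i) U) {v : ι → E.sec U} (hv : IsBasisOn E.toModSheaf v)
    (hvπ : ∀ i, v i ∈ E.par (π i) U) (k : ZMod 2) :
    (IsoOn.ofBases (isBasisOn_oneTmul (G := G) hs) hv).Preserves ((Egr G S).par k) (E.par k) := by
  refine IsoOn.preserves_par_of_mem (fun k V hV w hw => ?_) k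
  refine SuperModSheaf.mem_par_of_local fun x hx => ?_
  obtain ⟨W, hxW, hW, b, hb, e⟩ := Shf.exists_res_eq_mk hw hx
  refine ⟨W, hxW, hW, ?_⟩
  rw [IsoOn.res_app]
  have hWU := hW.trans hV
  let φ : (Egr G S).sec W →+ E.sec W :=
    ((IsoOn.ofBases (isBasisOn_oneTmul (G := G) hs) hv).app W hWU).toAddEquiv.toAddMonoidHom
  suffices hφ : tenPar G S k W ≤ (E.par k W).comap (φ.comp (Shf.mk W)) from
    Eq.subst (motive := fun z => φ z ∈ E.par k W) e.symm (hφ hb)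
  refine (AddSubgroup.closure_le _).2 ?_
  rintro _ ⟨i, j, rfl, a, ha, t, ht, rfl⟩
  obtain ⟨c, rfl⟩ := (hs W hWU).2 t
  beta_reduce at ht ⊢
  -- After discarding the basis vectors of parity other than `j`, every remaining term is an even
  -- scalar times `a`, of parity `i`, applied to a basis vector of parity `j`.
  rw [sum_filter_parity hπ hWU c ht, tmul_sum_smul]
  change φ (Shf.mk W _) ∈ E.par (i + j) W
  rw [mk_sum_smul_tmul]
  have : φ (∑ l, Shf.mkRing W ((if π l = j then c l else 0) • a) • oneTmul (res S.sec hWU (s l))) =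
      ∑ l, Shf.mkRing W ((if π l = j then c l else 0) • a) • res E.sec hWU (v l) := by
    refine Eq.trans (congrArg φ (Finset.sum_congr rfl fun l _ => ?_))
      (IsoOn.ofBases_app (isBasisOn_oneTmul (G := G) hs) hv W hWU _)
    rw [res_oneTmul]
  rw [this]
  refine sum_mem fun l _ => ?_
  split_ifs with hl
  · subst hl
    refine E.smul_mem (Shf.mk_mem_sub (A := extPar G i) ?_) ((E.par _).res_mem hWU (hvπ l))
    rw [Algebra.smul_def]
    have := SetLike.mul_mem_graded (A := fun i => extEO G i W)
      (algebraMap_mem_par_zero (G := G) (c l)) ha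
    rwa [zero_add] at this
  · rw [zero_smul, map_zero, zero_smul]
    exact zero_mem _

/-- `E_gr` is locally free if `S` is. -/
theorem Egr_isLocallyFree {p q : ℕ} (hS : S.IsLocallyFree p q) :
    (Egr G S).IsLocallyFree p q := by
  intro x
  obtain ⟨U, hx, s, h₀, h₁, hs⟩ := hS x
  have hm : ∀ (k : ZMod 2) (t : S.sec U), t ∈ S.par k U →
      (oneTmul t : (Egr G S).sec U) ∈ (Egr G S).par k U := fun k t ht =>
    Shf.mk_mem_sub (A := tenPar G S k) (AddSubgroup.subset_closure
      ⟨0, k, zero_add k, 1, SetLike.one_mem_graded (fun i => extEO G i U), t, ht, rfl⟩)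
  exact ⟨U, hx, fun i => oneTmul (s i), fun i => hm 0 _ (h₀ i), fun i => hm 1 _ (h₁ i),
    isBasisOn_oneTmul hs⟩

end EgrBasis

/-! ### Classes in `gr E` of sections of `E`. -/

section Symbols

variable {X : Type u} [TopologicalSpace X] {F : Opens X → Type u} [∀ U, CommRing (F U)]
  [RingPsh F] {G : ModSheaf F} {E : SuperModSheaf (Shf (Ext G))} {q : ℕ} {V : Opens X}

theorem grOf_add (v w : filt E.toModSheaf q V) : grOf (v + w) = grOf v + grOf w :=
  map_add (grIncl q) (GrPiece.mk v) (GrPiece.mk w)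

theorem grOf_neg (v : filt E.toModSheaf q V) : grOf (-v) = -grOf v :=
  map_neg (grIncl q) (GrPiece.mk v)

theorem symbol_add (v w : filt E.toModSheaf q V) : symbol (v + w) = symbol v + symbol w :=
  (congrArg (grMk V) (grOf_add v w)).trans (map_add (grMk V) _ _)

theorem symbol_neg (v : filt E.toModSheaf q V) : symbol (-v) = -symbol v :=
  (congrArg (grMk V) (grOf_neg v)).trans (map_neg (grMk V) _)

theorem symbol_sub (v w : filt E.toModSheaf q V) : symbol (v - w) = symbol v - symbol w := by
  rw [sub_eq_add_neg, sub_eq_add_neg, symbol_add, symbol_neg]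

theorem grMk_piece_eq_zero {v : filt E.toModSheaf q V} (h : v.1 ∈ filt E.toModSheaf (q + 1) V) :
    GrPiece.mk v = 0 := (QuotientAddGroup.eq_zero_iff v).2 h

/-- Vanishing in the associated sheaf means local vanishing in the presheaf quotients; since
membership in `filt` is a local condition, no information is lost. -/
theorem symbol_eq_zero_iff (v : filt E.toModSheaf q V) :
    symbol v = 0 ↔ v.1 ∈ filt E.toModSheaf (q + 1) V := by
  refine ⟨fun h => mem_filt_of_local fun x hx => ?_, fun h => ?_⟩
  · have h' : Shf.mk V (grOf v) = Shf.mk V (0 : GrPre E V) := h.trans (map_zero _).symm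
    obtain ⟨W, hxW, hW, e⟩ := Shf.exists_res_eq_of_mk_eq h' hx
    rw [res_grOf, map_zero] at e
    have e' := congrArg (grCoeff q) e
    rw [grCoeff_grOf, map_zero] at e'
    exact ⟨W, hxW, hW, (QuotientAddGroup.eq_zero_iff
      (⟨res E.sec hW v.1, (filt E.toModSheaf q).res_mem hW v.2⟩ : filt E.toModSheaf q W)).1 e'⟩
  · rw [symbol_eq, ← grIncl_mk, grMk_piece_eq_zero h, map_zero, map_zero]

theorem res_symbol {W : Opens X} (h : W ≤ V) (v : filt E.toModSheaf q V) :
    res (grSheaf E).sec h (symbol v) =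
      symbol (⟨res E.sec h v.1, (filt E.toModSheaf q).res_mem h v.2⟩ : filt E.toModSheaf q W) := by
  rw [symbol_eq, symbol_eq, res_grMk, res_grOf]

theorem symbol_mem_deg (v : filt E.toModSheaf q V) : symbol v ∈ grDeg E q V :=
  Shf.mk_mem_sub (A := grSub E q (SubPsh.whole E.sec))
    (AddSubgroup.subset_closure ⟨v, AddSubgroup.mem_top _, rfl⟩)

theorem symbol_smul {p r : ℕ} (hr : p + q = r) {a : Ext G V} (ha : a ∈ extPow G p V)
    (v : filt E.toModSheaf q V) (hm : Shf.mkRing V a • v.1 ∈ filt E.toModSheaf r V) :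
    symbol ⟨Shf.mkRing V a • v.1, hm⟩ = Shf.mkRing V a • symbol v := by
  subst hr
  exact (congrArg (grMk V) (smul_grOf E ⟨a, ha⟩ v).symm).trans (Shf.mk_smul a (grOf v))

/-- A section of `gr E` of degree `0` and parity `k` is locally the class of a section of parity
`k`. -/
theorem exists_symbol_eq {k : ZMod 2} {t : (grSheaf E).sec V} (h₀ : t ∈ grDeg E 0 V)
    (hk : t ∈ grPar E k V) {x : X} (hx : x ∈ V) :
    ∃ (W : Opens X) (_ : x ∈ W) (hW : W ≤ V) (v : E.sec W), v ∈ E.par k W ∧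
      res (grSheaf E).sec hW t = symbol ⟨v, mem_filt_zero v⟩ := by
  obtain ⟨V₁, hx₁, hV₁, a, ha, ea⟩ := Shf.exists_res_eq_mk h₀ hx
  obtain ⟨V₂, hx₂, hV₂, b, hb, eb⟩ := Shf.exists_res_eq_mk hk hx
  have ea' := congrArg (res (Shf (GrPre E)) (inf_le_left : V₁ ⊓ V₂ ≤ V₁)) ea
  have eb' := congrArg (res (Shf (GrPre E)) (inf_le_right : V₁ ⊓ V₂ ≤ V₂)) eb
  rw [Shf.res_mk] at ea' eb'
  -- The degree condition and the parity condition supply two presheaf representatives `a` and `b`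
  -- of the same section; they coincide after shrinking.
  have eab := (ea'.symm.trans ((res_res (Shf (GrPre E)) hV₁ inf_le_left t).trans
    (res_res (Shf (GrPre E)) hV₂ inf_le_right t).symm)).trans eb'
  obtain ⟨W, hxW, hW, e⟩ := Shf.exists_res_eq_of_mk_eq eab ⟨hx₁, hx₂⟩
  rw [res_res, res_res] at e
  have hW₁ : W ≤ V₁ := hW.trans inf_le_left
  have hW₂ : W ≤ V₂ := hW.trans inf_le_right
  have ha' := (grSub E 0 (SubPsh.whole E.sec)).res_mem hW₁ ha
  have hb' : res (GrPre E) hW₂ b ∈ ⨆ q, grSub E q (E.par k) W := (grPrePar E k).res_mem hW₂ hb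
  have h₁ : ∀ c ∈ grSub E 0 (SubPsh.whole E.sec) W, grIncl 0 (grCoeff 0 c) = c := by
    intro c hc
    induction hc using AddSubgroup.closure_induction with
    | mem c hc =>
      obtain ⟨v, -, rfl⟩ := hc
      rw [grCoeff_grOf, grIncl_mk]
    | zero => simp only [map_zero]
    | add c d _ _ hc hd => simp only [map_add, hc, hd]
    | neg c _ hc => simp only [map_neg, hc]
  -- `H` consists of the elements whose degree `0` coefficient is the class of a section of parity
  -- `k`. It contains the generators in every degree, since those of nonzero degree have coefficient
  -- `0`.
  let H : AddSubgroup (GrPre E W) :=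
    { carrier := {c | ∃ v ∈ E.par k W, grCoeff 0 c = GrPiece.mk ⟨v, mem_filt_zero v⟩}
      zero_mem' := ⟨0, zero_mem _, map_zero _⟩
      add_mem' := by
        rintro c d ⟨v, hv, e⟩ ⟨w, hw, e'⟩
        exact ⟨v + w, add_mem hv hw, by rw [map_add, e, e']; rfl⟩
      neg_mem' := by
        rintro c ⟨v, hv, e⟩
        exact ⟨-v, neg_mem hv, by rw [map_neg, e]; rfl⟩ }
  have h₂ : (⨆ q, grSub E q (E.par k) W) ≤ H := by
    refine iSup_le fun q => (AddSubgroup.closure_le _).2 ?_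
    rintro _ ⟨v, hv, rfl⟩
    by_cases hq : q = 0
    · subst hq
      exact ⟨v.1, hv, grCoeff_grOf v⟩
    · exact ⟨0, zero_mem _, grCoeff_grOf_of_ne v hq⟩
  obtain ⟨v, hv, e₃⟩ := h₂ hb'
  refine ⟨W, hxW, hW₁.trans hV₁, v, hv, ?_⟩
  have e₄ : res (GrPre E) hW₁ a = grOf ⟨v, mem_filt_zero v⟩ := by
    rw [← h₁ _ ha', e, e₃, grIncl_mk]
  have e₅ := congrArg (res (Shf (GrPre E)) hW₁) ea
  rw [Shf.res_mk, e₄] at e₅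
  exact (res_res (Shf (GrPre E)) hV₁ hW₁ t).symm.trans e₅

end Symbols

/-! ### Lifting `gr E ≃ E_gr` locally to an isomorphism `E ≃ E_gr`. -/

section Lifting

variable {X : Type u} [TopologicalSpace X] {F : Opens X → Type u} [∀ U, CommRing (F U)]
  [RingPsh F] [SuperRing F] [PurelyEven F] {G : ModSheaf F} {S : SuperModSheaf F}
  {E : SuperModSheaf (Shf (Ext G))}

namespace GrIso

variable (θ : GrIso E S)

/-- The section `u` of `E_(q)` has the class `w` in `E_gr` modulo `(E_gr)_(q+1)`, under the
isomorphism `θ`. -/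
def HasClass (q : ℕ) {V : Opens X} (u : E.sec V) (w : (Egr G S).sec V) : Prop :=
  ∃ h : u ∈ filt E.toModSheaf q V,
    θ.iso.app V le_top (symbol ⟨u, h⟩) - w ∈ filt (Egr G S).toModSheaf (q + 1) V

variable {θ} {q : ℕ} {V : Opens X}

theorem hasClass_zero : θ.HasClass q (0 : E.sec V) 0 := by
  refine ⟨zero_mem _, ?_⟩
  rw [(symbol_eq_zero_iff _).2 (zero_mem _), map_zero, sub_zero]
  exact zero_mem _

theorem HasClass.add {u u' : E.sec V} {w w' : (Egr G S).sec V} (h : θ.HasClass q u w)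
    (h' : θ.HasClass q u' w') : θ.HasClass q (u + u') (w + w') := by
  obtain ⟨m, e⟩ := h
  obtain ⟨m', e'⟩ := h'
  refine ⟨add_mem m m', ?_⟩
  have := add_mem e e'
  rwa [← add_sub_add_comm, ← map_add, ← symbol_add] at this

theorem HasClass.neg {u : E.sec V} {w : (Egr G S).sec V} (h : θ.HasClass q u w) :
    θ.HasClass q (-u) (-w) := by
  obtain ⟨m, e⟩ := h
  refine ⟨neg_mem m, ?_⟩
  have := neg_mem e
  rwa [neg_sub', ← map_neg, ← symbol_neg] at this

theorem HasClass.sum {ι : Type} {s : Finset ι} {u : ι → E.sec V} {w : ι → (Egr G S).sec V}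
    (h : ∀ i ∈ s, θ.HasClass q (u i) (w i)) :
    θ.HasClass q (∑ i ∈ s, u i) (∑ i ∈ s, w i) := by
  classical
  induction s using Finset.induction_on with
  | empty => exact hasClass_zero
  | insert i s hi ih =>
    rw [Finset.sum_insert hi, Finset.sum_insert hi]
    exact (h i (Finset.mem_insert_self i s)).add
      (ih fun j hj => h j (Finset.mem_insert_of_mem hj))

theorem hasClass_of_local {u : E.sec V} {w : (Egr G S).sec V}
    (h : ∀ x ∈ V, ∃ (W : Opens X) (_ : x ∈ W) (hW : W ≤ V),
      θ.HasClass q (res E.sec hW u) (res (Egr G S).sec hW w)) : θ.HasClass q u w := by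
  have m : u ∈ filt E.toModSheaf q V := mem_filt_of_local fun x hx => by
    obtain ⟨W, hxW, hW, m, -⟩ := h x hx
    exact ⟨W, hxW, hW, m⟩
  refine ⟨m, mem_filt_of_local fun x hx => ?_⟩
  obtain ⟨W, hxW, hW, m', e⟩ := h x hx
  refine ⟨W, hxW, hW, ?_⟩
  rw [map_sub, θ.iso.res_app, res_symbol]
  exact e

/-- Homogeneous `a` of degree exactly `q` multiplies classes, the error growing from `(E_gr)_(1)` to
`(E_gr)_(q+1)`. If `a` has degree above `q`, both products already lie in step `q + 1` and have
class zero. -/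
theorem HasClass.smul {u : E.sec V} {w : (Egr G S).sec V} (h : θ.HasClass 0 u w) {a : Ext G V}
    (ha : a ∈ extGE G q V) : θ.HasClass q (Shf.mkRing V a • u) (Shf.mkRing V a • w) := by
  obtain ⟨m, e⟩ := h
  induction ha using AddSubgroup.closure_induction with
  | mem a ha =>
    obtain ⟨k, hk, ha⟩ := ha
    have hJ := mkRing_mem_oddIdeal_pow G ha
    rcases hk.eq_or_lt with rfl | hk
    · have hm : Shf.mkRing V a • u ∈ filt E.toModSheaf q V :=
        smul_mem_filt (p := q) (q := 0) _ hJ m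
      refine ⟨hm, ?_⟩
      rw [symbol_smul (add_zero q) ha ⟨u, m⟩ hm, map_smul, ← smul_sub]
      exact smul_mem_filt (p := q) (q := 1) _ hJ e
    · have hJ' := Ideal.pow_le_pow_right (Nat.succ_le_of_lt hk) hJ
      have m' : Shf.mkRing V a • u ∈ filt E.toModSheaf (q + 1) V :=
        smul_mem_filt (p := q + 1) (q := 0) _ hJ' m
      refine ⟨filt_succ_le m', ?_⟩
      rw [(symbol_eq_zero_iff _).2 m', map_zero, zero_sub]
      exact neg_mem (smul_mem_filt (p := q + 1) (q := 0) _ hJ' (mem_filt_zero w))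
  | zero => rw [map_zero, zero_smul, zero_smul]; exact hasClass_zero
  | add a b _ _ ha hb => rw [map_add, add_smul, add_smul]; exact ha.add hb
  | neg a _ ha => rw [map_neg, neg_smul, neg_smul]; exact ha.neg

theorem app_symbol_mem_deg (v : filt E.toModSheaf q V) :
    θ.iso.app V le_top (symbol v) ∈ EgrDeg G S q V :=
  (θ.preserves_deg q V le_top _).2 (symbol_mem_deg v)

variable {ι : Type} [Fintype ι] {U : Opens X} {s : ι → S.sec U} {v : ι → E.sec U}

/-- A combination of the `1 ⊗ s_i` lying in `(E_gr)_(q)` has coordinates that are locally of degree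
at least `q`. The same combination of the lifts `v_i` therefore lies in `E_(q)` and has the same
leading term, by `HasClass.smul` applied to each summand. -/
theorem hasClass_sum_smul (hs : IsBasisOn S.toModSheaf s)
    (hv : ∀ i, θ.iso.app U le_top (symbol ⟨v i, mem_filt_zero (v i)⟩) = oneTmul (s i))
    (h : V ≤ U) {c : ι → Shf (Ext G) V}
    (hw : ∑ i, c i • res (Egr G S).sec h (oneTmul (s i)) ∈ filt (Egr G S).toModSheaf q V) :
    θ.HasClass q (∑ i, c i • res E.sec h (v i))
      (∑ i, c i • res (Egr G S).sec h (oneTmul (s i))) := by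
  refine hasClass_of_local fun x hx => ?_
  have hw' := hw
  rw [filt_Egr] at hw'
  obtain ⟨W, hxW, hW, b, hb, e⟩ := Shf.exists_res_eq_mk hw' hx
  obtain ⟨a, ha, rfl⟩ := exists_coords_of_mem_tenGE hs (hW.trans h) hb
  refine ⟨W, hxW, hW, ?_⟩
  -- Coordinates in the basis `1 ⊗ s_i` are unique, so the given ones restrict to those of degree at
  -- least `q`.
  have hc : (fun i => res (Shf (Ext G)) hW (c i)) = fun i => Shf.mkRing W (a i) := by
    refine (isBasisOn_oneTmul (G := G) hs W (hW.trans h)).1 ?_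
    beta_reduce
    rw [← res_sum_smul_res (Egr G S).toModSheaf (fun i => oneTmul (s i)) h hW c]
    refine e.trans ((mk_sum_smul_tmul _ _).trans (Finset.sum_congr rfl fun i _ => ?_))
    rw [res_oneTmul]
  rw [res_sum_smul_res E.toModSheaf v h hW c,
    res_sum_smul_res (Egr G S).toModSheaf (fun i => oneTmul (s i)) h hW c]
  refine HasClass.sum fun i _ => ?_
  have hi : res (Shf (Ext G)) hW (c i) = Shf.mkRing W (a i) := congrFun hc i
  rw [hi]
  refine HasClass.smul ⟨mem_filt_zero _, ?_⟩ (ha i)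
  have := congrArg (res (Egr G S).sec (hW.trans h)) (hv i)
  rw [θ.iso.res_app, res_symbol] at this
  exact Eq.subst (motive := fun z => z - res (Egr G S).sec (hW.trans h) (oneTmul (s i)) ∈
    filt (Egr G S).toModSheaf 1 W) this.symm (by rw [sub_self]; exact zero_mem _)

/-- Sections of `E` whose classes form a basis of `S` form a basis of `E`. -/
theorem isBasisOn_of_symbol {m : ℕ} (hG : G.IsLocallyFree m) (hs : IsBasisOn S.toModSheaf s)
    (hv : ∀ i, θ.iso.app U le_top (symbol ⟨v i, mem_filt_zero (v i)⟩) = oneTmul (s i)) :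
    IsBasisOn E.toModSheaf v := by
  have hE := isBasisOn_oneTmul (G := G) hs
  intro V h
  have inj : ∀ c : ι → Shf (Ext G) V, ∑ i, c i • res E.sec h (v i) = 0 → c = 0 := by
    intro c hc
    -- If the combination of the `1 ⊗ s_i` is in step `n`, it is the leading term of `∑ c_i v_i =
    -- 0`, so it lies in step `n + 1`. By nilpotency it is zero.
    have key : ∀ n, ∑ i, c i • res (Egr G S).sec h (oneTmul (s i)) ∈
        filt (Egr G S).toModSheaf n V := by
      intro n
      induction n with
      | zero => exact mem_filt_zero _
      | succ n ih =>
        obtain ⟨m, e⟩ := hasClass_sum_smul hs hv h ih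
        have hz : ∑ i, c i • res E.sec h (v i) ∈ filt E.toModSheaf (n + 1) V := by
          rw [hc]
          exact zero_mem _
        rw [(symbol_eq_zero_iff ⟨_, m⟩).2 hz, map_zero, zero_sub] at e
        exact neg_mem_iff.1 e
    refine (hE V h).1 ((eq_zero_of_mem_filt hG (key (m + 1))).trans ?_)
    simp only [Pi.zero_apply, zero_smul, Finset.sum_const_zero]
  refine ⟨fun c d hcd => sub_eq_zero.1 (inj _ ?_), fun u => ?_⟩
  · simp only [Pi.sub_apply, sub_smul, Finset.sum_sub_distrib]
    exact sub_eq_zero.2 hcd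
  -- Successive approximation: the leading term of the remainder has coordinates `c'` in the basis
  -- `1 ⊗ s_i`, and subtracting `∑ c'_i v_i` pushes the remainder one step further.
  · have key : ∀ n, ∃ c : ι → Shf (Ext G) V,
        u - ∑ i, c i • res E.sec h (v i) ∈ filt E.toModSheaf n V := by
      intro n
      induction n with
      | zero => exact ⟨0, mem_filt_zero _⟩
      | succ n ih =>
        obtain ⟨c, hc⟩ := ih
        have hw := app_symbol_mem_deg (θ := θ) ⟨_, hc⟩
        obtain ⟨c', hc'⟩ := (hE V h).2 (θ.iso.app V le_top (symbol ⟨_, hc⟩))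
        beta_reduce at hc'
        obtain ⟨m', e⟩ := hasClass_sum_smul (q := n) hs hv h (c := c')
          (hc' ▸ egrDeg_le_filt hw)
        rw [hc'] at e
        -- Both classes are homogeneous of degree `n`, so their congruence modulo step `n + 1` is an
        -- equality, which `θ` carries back to `gr E`.
        have z := sub_eq_zero.1 (eq_zero_of_mem_egrDeg_of_mem_filt
          (sub_mem (app_symbol_mem_deg ⟨_, m'⟩) hw) e)
        have z' := (θ.iso.app V le_top).injective z
        rw [eq_comm, ← sub_eq_zero, ← symbol_sub, symbol_eq_zero_iff] at z'
        refine ⟨c + c', ?_⟩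
        have e' : u - ∑ i, (c + c') i • res E.sec h (v i) =
            (u - ∑ i, c i • res E.sec h (v i)) - ∑ i, c' i • res E.sec h (v i) := by
          simp only [Pi.add_apply, add_smul, Finset.sum_add_distrib]
          abel
        rw [e']
        exact z'
    obtain ⟨c, hc⟩ := key (m + 1)
    exact ⟨c, (sub_eq_zero.1 (eq_zero_of_mem_filt hG hc)).symm⟩

variable (θ)

/-- Locally, the isomorphism `gr E ≃ E_gr` is induced by an isomorphism of `E` and `E_gr`. -/
theorem exists_isoOn {m p q : ℕ} (hG : G.IsLocallyFree m) (hS : S.IsLocallyFree p q) (x : X) :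
    ∃ (U : Opens X) (_ : x ∈ U) (δ : IsoOn E.toModSheaf (Egr G S).toModSheaf U),
      (∀ k, δ.Preserves (E.par k) ((Egr G S).par k)) ∧
      ∀ (V : Opens X) (h : V ≤ U) (q : ℕ) (v : filt E.toModSheaf q V),
        δ.app V h v.1 - θ.iso.app V le_top (symbol v) ∈ filt (Egr G S).toModSheaf (q + 1) V := by
  obtain ⟨U, hx, s, h₀, h₁, hs⟩ := hS x
  let π : Fin p ⊕ Fin q → ZMod 2 := Sum.elim (fun _ => 0) (fun _ => 1)
  have hπ : ∀ i, s i ∈ S.par (π i) U := by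
    rintro (i | i)
    · exact h₀ i
    · exact h₁ i
  obtain ⟨W, hxW, hWU', hW⟩ := exists_common_nhd hx
    (p := fun i W => ∃ (hW : W ≤ U) (v : E.sec W), v ∈ E.par (π i) W ∧
      θ.iso.app W le_top (symbol ⟨v, mem_filt_zero v⟩) = oneTmul (res S.sec hW (s i)))
    (fun i W Z hZ ⟨hW, v, hv, e⟩ => ⟨hZ.trans hW, res E.sec hZ v, (E.par (π i)).res_mem hZ hv, by
      have := congrArg (res (Egr G S).sec hZ) e
      rwa [θ.iso.res_app, res_symbol, res_oneTmul, res_res] at this⟩)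
    (fun i => by
      -- The section `t` of `gr E` matching `1 ⊗ s_i` has degree `0` and parity `π i`, as `θ`
      -- respects both gradings; hence it is locally the class of a section of `E` of that parity.
      let t := (θ.iso.app U le_top).symm (oneTmul (s i))
      have ht : θ.iso.app U le_top t = oneTmul (s i) := LinearEquiv.apply_symm_apply _ _
      have ht₀ : t ∈ grDeg E 0 U := by
        rw [← θ.preserves_deg 0 U le_top, ht]
        exact Shf.mk_mem_sub (A := tenDeg G S 0) (AddSubgroup.subset_closure
          ⟨1, SetLike.one_mem_graded (fun p => extPow G p U), s i, rfl⟩)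
      have htk : t ∈ grPar E (π i) U := by
        rw [← θ.preserves_par (π i) U le_top, ht]
        exact Shf.mk_mem_sub (A := tenPar G S (π i)) (AddSubgroup.subset_closure
          ⟨0, π i, zero_add _, 1, SetLike.one_mem_graded (fun i => extEO G i U), s i, hπ i, rfl⟩)
      obtain ⟨W, hxW, hW, v, hv, e⟩ := exists_symbol_eq ht₀ htk hx
      refine ⟨W, hxW, hW, v, hv, ?_⟩
      rw [← e, ← θ.iso.res_app le_top, ht, res_oneTmul])
  choose hWU v hvπ hv using hW
  have hs' := hs.restrict hWU'
  have hv' : IsBasisOn E.toModSheaf v := isBasisOn_of_symbol hG hs' hv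
  have hE := isBasisOn_oneTmul (G := G) hs'
  -- The isomorphism sends `v_i` to `1 ⊗ s_i`. That it induces `θ` in every degree is
  -- `hasClass_sum_smul` up to sign.
  refine ⟨W, hxW, (IsoOn.ofBases hE hv').symm, fun k => IsoOn.Preserves.symm
    (ofBases_preserves_par (π := π) hs' (fun i => (S.par (π i)).res_mem hWU' (hπ i)) hv' hvπ k),
    fun V h r u => ?_⟩
  obtain ⟨u, hu⟩ := u
  obtain ⟨c, rfl⟩ := (hv' V h).2 u
  have e := (LinearEquiv.symm_apply_eq ((IsoOn.ofBases hE hv').app V h)).2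
    (IsoOn.ofBases_app hE hv' V h c).symm
  have e' : (IsoOn.ofBases hE hv').symm.app V h (∑ i, c i • res E.sec h (v i)) =
    ∑ i, c i • res (Egr G S).sec h (oneTmul (res S.sec hWU' (s i))) := e
  have hw := (IsoOn.preserves_filt (IsoOn.ofBases hE hv').symm r V h _).2 hu
  rw [e'] at hw
  obtain ⟨_, e''⟩ := hasClass_sum_smul hs' hv h hw
  rw [e', ← neg_mem_iff, neg_sub]
  exact e''

end GrIso

end Lifting

/-! ### The sheaf glued from copies of `E` by a cocycle. -/

section Gluing

open CategoryTheory Opposite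

variable {X : Type u} [TopologicalSpace X] {R : Opens X → Type u} [∀ U, Ring (R U)] [RingPsh R]
  [SuperRing R] {E : SuperModSheaf R} {p : ℕ}

namespace Cocycle

variable (c : Cocycle (autFiltSheaf E p))

/-- The automorphism of `E(W)` given by the transition function `c_{ij}`. -/
def act (i j : c.ι) {W : Opens X} (hi : W ≤ c.cov i) (hj : W ≤ c.cov j) :
    E.sec W ≃ₗ[R W] E.sec W :=
  (c.toCocycle.ev i j (homOfLE hi) (homOfLE hj)).1.1.app W le_rfl

/-- Compatibility of the cocycle with restriction shows that its effect on `E(W)` depends only on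
`i`, `j` and `W`, not on the open set `T` where it is evaluated. -/
theorem app_ev (i j : c.ι) {T W : Opens X} (a : T ⟶ c.cov i) (b : T ⟶ c.cov j) (h : W ≤ T)
    (v : E.sec W) : (c.toCocycle.ev i j a b).1.1.app W h v =
      c.act i j (h.trans (leOfHom a)) (h.trans (leOfHom b)) v :=
  congrArg (fun g : autFilt E p W => g.1.1.app W le_rfl v)
    (c.toCocycle.ev_precomp i j (homOfLE h) a b)

theorem res_act (i j : c.ι) {W Z : Opens X} (hi : W ≤ c.cov i) (hj : W ≤ c.cov j) (h : Z ≤ W)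
    (v : E.sec W) :
    res E.sec h (c.act i j hi hj v) = c.act i j (h.trans hi) (h.trans hj) (res E.sec h v) := by
  rw [act, IsoOn.res_app, app_ev]

theorem act_act (i j k : c.ι) {W : Opens X} (hi : W ≤ c.cov i) (hj : W ≤ c.cov j)
    (hk : W ≤ c.cov k) (v : E.sec W) : c.act i j hi hj (c.act j k hj hk v) = c.act i k hi hk v :=
  congrArg (fun g : autFilt E p W => g.1.1.app W le_rfl v)
    (c.toCocycle.ev_trans i j k (homOfLE hi) (homOfLE hj) (homOfLE hk))

theorem act_self (i : c.ι) {W : Opens X} (hi : W ≤ c.cov i) (v : E.sec W) :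
    c.act i i hi hi v = v :=
  congrArg (fun g : autFilt E p W => g.1.1.app W le_rfl v)
    (PresheafOfGroups.OneCocycle.ev_refl _ _ c.toCocycle i (homOfLE hi))

theorem act_mem_par_iff (i j : c.ι) {W : Opens X} (hi : W ≤ c.cov i) (hj : W ≤ c.cov j)
    (k : ZMod 2) (v : E.sec W) : c.act i j hi hj v ∈ E.par k W ↔ v ∈ E.par k W :=
  (c.toCocycle.ev i j (homOfLE hi) (homOfLE hj)).1.2 k W le_rfl v

/-- Sections over `V` of the sheaf glued from copies of `E` by a cocycle. -/
def gluedSec (V : Opens X) :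
    AddSubgroup (∀ (i : c.ι) (W : {W : Opens X // W ≤ V ∧ W ≤ c.cov i}), E.sec W.1) where
  carrier := {s | (∀ (i : c.ι) (W Z : Opens X) (hV : W ≤ V) (hi : W ≤ c.cov i) (hZ : Z ≤ W),
      res E.sec hZ (s i ⟨W, hV, hi⟩) = s i ⟨Z, hZ.trans hV, hZ.trans hi⟩) ∧
    ∀ (i j : c.ι) (W : Opens X) (hV : W ≤ V) (hi : W ≤ c.cov i) (hj : W ≤ c.cov j),
      c.act i j hi hj (s j ⟨W, hV, hj⟩) = s i ⟨W, hV, hi⟩}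
  zero_mem' := ⟨fun _ _ _ _ _ _ => map_zero _, fun _ _ _ _ _ _ => map_zero _⟩
  add_mem' hs ht :=
    ⟨fun i W Z hV hi hZ => (map_add _ _ _).trans
      (congrArg₂ (· + ·) (hs.1 i W Z hV hi hZ) (ht.1 i W Z hV hi hZ)),
     fun i j W hV hi hj => (map_add _ _ _).trans
      (congrArg₂ (· + ·) (hs.2 i j W hV hi hj) (ht.2 i j W hV hi hj))⟩
  neg_mem' hs :=
    ⟨fun i W Z hV hi hZ => (map_neg _ _).trans (congrArg Neg.neg (hs.1 i W Z hV hi hZ)),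
     fun i j W hV hi hj => (map_neg _ _).trans (congrArg Neg.neg (hs.2 i j W hV hi hj))⟩

/-- The presheaf glued from copies of `E` by a cocycle. -/
def Glued (V : Opens X) : Type u := c.gluedSec V

namespace Glued

instance (V : Opens X) : AddCommGroup (c.Glued V) := inferInstanceAs (AddCommGroup (c.gluedSec V))

variable {c}

/-- The component of a section over a small open set. -/
def at' {V : Opens X} (s : c.Glued V) (i : c.ι) {W : Opens X} (hV : W ≤ V) (hi : W ≤ c.cov i) :
    E.sec W := s.1 i ⟨W, hV, hi⟩

@[ext] theorem ext {V : Opens X} {s t : c.Glued V}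
    (h : ∀ (i : c.ι) (W : Opens X) (hV : W ≤ V) (hi : W ≤ c.cov i), s.at' i hV hi = t.at' i hV hi) :
    s = t :=
  Subtype.ext (funext fun i => funext fun W => h i W.1 W.2.1 W.2.2)

theorem res_at' {V : Opens X} (s : c.Glued V) (i : c.ι) {W Z : Opens X} (hV : W ≤ V)
    (hi : W ≤ c.cov i) (hZ : Z ≤ W) :
    res E.sec hZ (s.at' i hV hi) = s.at' i (hZ.trans hV) (hZ.trans hi) := s.2.1 i W Z hV hi hZ

theorem act_at' {V : Opens X} (s : c.Glued V) (i j : c.ι) {W : Opens X} (hV : W ≤ V)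
    (hi : W ≤ c.cov i) (hj : W ≤ c.cov j) :
    c.act i j hi hj (s.at' j hV hj) = s.at' i hV hi := s.2.2 i j W hV hi hj

theorem add_at' {V : Opens X} (s t : c.Glued V) (i : c.ι) {W : Opens X} (hV : W ≤ V)
    (hi : W ≤ c.cov i) : (s + t).at' i hV hi = s.at' i hV hi + t.at' i hV hi := rfl

variable (c) in
/-- A section is given by compatible components. -/
def mk {V : Opens X} (s : ∀ (i : c.ι) (W : Opens X), W ≤ V → W ≤ c.cov i → E.sec W)
    (h₁ : ∀ (i : c.ι) (W Z : Opens X) (hV : W ≤ V) (hi : W ≤ c.cov i) (hZ : Z ≤ W),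
      res E.sec hZ (s i W hV hi) = s i Z (hZ.trans hV) (hZ.trans hi))
    (h₂ : ∀ (i j : c.ι) (W : Opens X) (hV : W ≤ V) (hi : W ≤ c.cov i) (hj : W ≤ c.cov j),
      c.act i j hi hj (s j W hV hj) = s i W hV hi) : c.Glued V :=
  ⟨fun i W => s i W.1 W.2.1 W.2.2, h₁, h₂⟩

theorem mk_at' {V : Opens X} {s : ∀ (i : c.ι) (W : Opens X), W ≤ V → W ≤ c.cov i → E.sec W}
    {h₁ h₂} (i : c.ι) {W : Opens X} (hV : W ≤ V) (hi : W ≤ c.cov i) :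
    (mk c s h₁ h₂).at' i hV hi = s i W hV hi := rfl

/-- A section carries its components on all open `W ≤ V` inside the members of the covering, not
only on `V ⊓ cov i`. Restriction merely forgets some of them, and the presheaf laws hold
definitionally. -/
instance : AddPsh c.Glued where
  res h :=
    { toFun := fun s => mk c (fun i _ hV hi => s.at' i (hV.trans h) hi)
        (fun i _ _ _ _ _ => s.res_at' i _ _ _) (fun i j _ _ _ _ => s.act_at' i j _ _ _)
      map_zero' := rfl
      map_add' := fun _ _ => rfl }
  res_self _ := rfl
  res_res _ _ _ := rfl

theorem res_at {V V' : Opens X} (h : V' ≤ V) (s : c.Glued V) (i : c.ι) {W : Opens X}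
    (hV : W ≤ V') (hi : W ≤ c.cov i) :
    (res c.Glued h s).at' i hV hi = s.at' i (hV.trans h) hi := rfl

instance (V : Opens X) : Module (R V) (c.Glued V) where
  smul r s := mk c (fun i W hV hi => res R hV r • s.at' i hV hi)
    (fun i W Z hV hi hZ => by rw [ModPsh.res_smul (R := R), res_res, s.res_at'])
    (fun i j W hV hi hj => by rw [map_smul, s.act_at'])
  one_smul s := ext fun i W hV hi => by
    change res R hV 1 • s.at' i hV hi = _
    rw [RingPsh.res_one, one_smul]
  mul_smul r r' s := ext fun i W hV hi => by
    change res R hV (r * r') • s.at' i hV hi = res R hV r • res R hV r' • s.at' i hV hi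
    rw [RingPsh.res_mul, mul_smul]
  smul_zero r := ext fun i W hV hi => smul_zero (res R hV r)
  smul_add r s t := ext fun i W hV hi =>
    smul_add (res R hV r) (s.at' i hV hi) (t.at' i hV hi)
  add_smul r r' s := ext fun i W hV hi => by
    change res R hV (r + r') • s.at' i hV hi =
      res R hV r • s.at' i hV hi + res R hV r' • s.at' i hV hi
    rw [map_add, add_smul]
  zero_smul s := ext fun i W hV hi => by
    change res R hV 0 • s.at' i hV hi = 0
    rw [map_zero, zero_smul]

theorem smul_at' {V : Opens X} (r : R V) (s : c.Glued V) (i : c.ι) {W : Opens X} (hV : W ≤ V)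
    (hi : W ≤ c.cov i) : (r • s).at' i hV hi = res R hV r • s.at' i hV hi := rfl

instance : ModPsh R c.Glued where
  res_smul h r s := ext fun i W hV hi => by
    rw [res_at, smul_at', smul_at', res_at, res_res]

/-- Each component is glued separately in `E`; the uniqueness of these gluings gives compatibility
with restriction and with the transition functions. -/
theorem isSheaf : IsSheaf c.Glued := by
  intro κ U s hs
  have compat : ∀ (k l : κ) (i : c.ι) (W : Opens X) (hk : W ≤ U k) (hl : W ≤ U l)
      (hi : W ≤ c.cov i), (s k).at' i hk hi = (s l).at' i hl hi := fun k l i W hk hl hi =>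
    congrArg (fun t : c.Glued (U k ⊓ U l) => t.at' i (le_inf hk hl) hi) (hs k l)
  have glue := fun (i : c.ι) (W : Opens X) (hV : W ≤ ⨆ k, U k) (hi : W ≤ c.cov i) =>
    IsSheaf.existsUnique_glue (P := E.sec) E.isSheaf U hV
      (fun k Z hZ hk => (s k).at' i hk (hZ.trans hi))
      (fun k Z Y hZ hk hY => (s k).res_at' i _ _ _)
      (fun k l Z hZ hk hl => compat k l i Z hk hl _)
  choose t ht hu using glue
  have hloc : ∀ (i : c.ι) (W : Opens X) (hV : W ≤ ⨆ k, U k) (hi : W ≤ c.cov i) (k : κ)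
      (hk : W ≤ U k), t i W hV hi = (s k).at' i hk hi := fun i W hV hi k hk =>
    (res_self E.sec _).symm.trans (ht i W hV hi k W le_rfl hk)
  refine ⟨mk c t (fun i W Z hV hi hZ => hu i Z _ _ _ fun k Y hY hk => ?_)
    (fun i j W hV hi hj => hu i W _ _ _ fun k Z hZ hk => ?_), fun k => ext fun i W hV hi => ?_,
    fun t' ht' => ext fun i W hV hi => hu i W _ _ _ fun k Z hZ hk => ?_⟩
  · rw [res_res]
    exact ht i W hV hi k Y _ hk
  · rw [res_act, ht j W hV hj k Z hZ hk, (s k).act_at']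
  · rw [res_at, mk_at']
    exact hloc _ _ _ _ _ _
  · rw [t'.res_at', ← ht' k]
    rfl

end Glued

/-- The sheaf of `ℤ/2`-graded modules glued from copies of `E` by a cocycle. -/
def glued : SuperModSheaf R where
  sec := c.Glued
  isSheaf := Glued.isSheaf
  par k :=
    { carrier := fun V =>
        { carrier := {s | ∀ (i : c.ι) (W : Opens X) (hV : W ≤ V) (hi : W ≤ c.cov i),
            s.at' i hV hi ∈ E.par k W}
          zero_mem' := fun _ _ _ _ => zero_mem _
          add_mem' := fun hs ht i W hV hi => add_mem (hs i W hV hi) (ht i W hV hi)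
          neg_mem' := fun hs i W hV hi => neg_mem (hs i W hV hi) }
      res_mem := fun h _ hs i W hV hi => hs i W (hV.trans h) hi }
  isCompl V := by
    constructor
    · rw [AddSubgroup.disjoint_def]
      exact fun {s} h₀ h₁ => Glued.ext fun i W hV hi =>
        AddSubgroup.disjoint_def.1 (E.isCompl W).disjoint (h₀ i W hV hi) (h₁ i W hV hi)
    · rw [codisjoint_iff_le_sup]
      intro s _
      have dec := fun (W : Opens X) (v : E.sec W) => E.exists_par_add 0 v
      choose a ha b hb e using dec
      -- Uniqueness of the parity decomposition makes it commute with restriction and with the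
      -- parity-preserving transition functions, so the even and odd parts of the components are
      -- again sections of the glued sheaf.
      have uniq : ∀ (W : Opens X) (v v₀ v₁ : E.sec W), v₀ ∈ E.par 0 W → v₁ ∈ E.par 1 W →
          v₀ + v₁ = v → v₀ = a W v ∧ v₁ = b W v := by
        intro W v v₀ v₁ h₀ h₁ h
        have e₁ : v₀ - a W v = b W v - v₁ := by
          rw [sub_eq_sub_iff_add_eq_add, h, add_comm (b W v), e]
        have e₂ : v₀ - a W v = 0 := E.disjoint_par 0 (sub_mem h₀ (ha W v))
          (e₁ ▸ sub_mem (hb W v) h₁)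
        exact ⟨sub_eq_zero.1 e₂, (sub_eq_zero.1 (e₁ ▸ e₂)).symm⟩
      have hres := fun {W Z : Opens X} (h : Z ≤ W) (v : E.sec W) =>
        uniq Z (res E.sec h v) _ _ ((E.par 0).res_mem h (ha W v)) ((E.par 1).res_mem h (hb W v))
          (by rw [← map_add, e])
      have hact := fun (i j : c.ι) {W : Opens X} (hi : W ≤ c.cov i) (hj : W ≤ c.cov j)
          (v : E.sec W) =>
        uniq W (c.act i j hi hj v) _ _ ((c.act_mem_par_iff i j hi hj 0 _).2 (ha W v))
          ((c.act_mem_par_iff i j hi hj 1 _).2 (hb W v)) (by rw [← map_add, e])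
      refine AddSubgroup.mem_sup.2
        ⟨Glued.mk c (fun i W hV hi => a W (s.at' i hV hi))
          (fun i W Z hV hi hZ => by rw [(hres hZ _).1, s.res_at'])
          (fun i j W hV hi hj => by rw [(hact i j hi hj _).1, s.act_at']),
        fun i W hV hi => ha W _,
        Glued.mk c (fun i W hV hi => b W (s.at' i hV hi))
          (fun i W Z hV hi hZ => by rw [(hres hZ _).2, s.res_at'])
          (fun i j W hV hi hj => by rw [(hact i j hi hj _).2, s.act_at']),
        fun i W hV hi => hb W _, Glued.ext fun i W hV hi => ?_⟩
      rw [Glued.add_at']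
      exact e W _
  smul_mem {U i j f v} hf hv k W hV hk :=
    E.smul_mem ((SuperRing.par i).res_mem hV hf) (hv k W hV hk)

/-- Over an open subset of a member of the covering, a section of the glued sheaf is determined by
one component. -/
def gluedEquiv (i : c.ι) {V : Opens X} (h : V ≤ c.cov i) : c.Glued V ≃ₗ[R V] E.sec V where
  toFun s := s.at' i le_rfl h
  map_add' _ _ := rfl
  map_smul' r s := by rw [Glued.smul_at', res_self, RingHom.id_apply]
  invFun v := Glued.mk c (fun j W hV hj => c.act j i hj (hV.trans h) (res E.sec hV v))
    (fun j W Z hV hj hZ => by rw [res_act, res_res])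
    (fun j k W hV hj hk => by rw [act_act])
  left_inv s := Glued.ext fun j W hV hj => by rw [Glued.mk_at', Glued.res_at', Glued.act_at']
  right_inv v := (c.act_self i h _).trans (res_self E.sec v)

/-- The tautological isomorphisms of the glued sheaf with `E` over the members of the covering. -/
def gluedIso (i : c.ι) : IsoOn c.glued.toModSheaf E.toModSheaf (c.cov i) where
  app _ h := c.gluedEquiv i h
  res_app hV h s := Glued.res_at' (c := c) s i le_rfl hV h

theorem gluedIso_preserves_par (i : c.ι) (k : ZMod 2) :
    (c.gluedIso i).Preserves (c.glued.par k) (E.par k) := by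
  refine IsoOn.preserves_par_of_mem (E := c.glued) (E' := E) (fun k V hV s hs => ?_) k
  exact hs i V le_rfl hV

end Cocycle

end Gluing

/-! ### Sheaves with prescribed transition functions, and their dependence on the cocycle. -/

section Transition

open CategoryTheory Opposite

variable {X : Type u} [TopologicalSpace X] {R : Opens X → Type u} [∀ U, Ring (R U)] [RingPsh R]
  [SuperRing R] {E₀ : SuperModSheaf R} {p : ℕ}

/-- Evaluating `c_ij = δ_i ∘ δ_j⁻¹` at `δ_j v` removes the inverse; this is the form recorded in
`Transition`. -/
theorem act_app_of_ev_eq {E : SuperModSheaf R} {c : Cocycle (autFiltSheaf E₀ p)}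
    {δ : ∀ i, IsoOn E.toModSheaf E₀.toModSheaf (c.cov i)}
    (h : ∀ (i j : c.ι) (T : Opens X) (a : T ⟶ c.cov i) (b : T ⟶ c.cov j),
      (c.toCocycle.ev i j a b).1.1 =
        ((δ j).restrict (leOfHom b)).symm.trans ((δ i).restrict (leOfHom a)))
    (i j : c.ι) (V : Opens X) (hi : V ≤ c.cov i) (hj : V ≤ c.cov j) (v : E.sec V) :
    c.act i j hi hj ((δ j).app V hj v) = (δ i).app V hi v := by
  have e := congrArg (fun φ : IsoOn E₀.toModSheaf E₀.toModSheaf V =>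
    φ.app V le_rfl ((δ j).app V hj v)) (h i j V (homOfLE hi) (homOfLE hj))
  exact e.trans (congrArg ((δ i).app V hi) (LinearEquiv.symm_apply_apply _ v))

/-- Parity preserving isomorphisms of `E` with the model `E₀` over a covering, with transition
functions given by the cocycle `c`. -/
structure Transition (E : SuperModSheaf R) (c : Cocycle (autFiltSheaf E₀ p)) where
  iso : ∀ i, IsoOn E.toModSheaf E₀.toModSheaf (c.cov i)
  preserves_par : ∀ i k, (iso i).Preserves (E.par k) (E₀.par k)
  act_app : ∀ (i j : c.ι) (V : Opens X) (hi : V ≤ c.cov i) (hj : V ≤ c.cov j) (v : E.sec V),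
    c.act i j hi hj ((iso j).app V hj v) = (iso i).app V hi v

namespace Transition

variable {E E' : SuperModSheaf R} {c d : Cocycle (autFiltSheaf E₀ p)}

theorem ev_eq (t : Transition E c) (i j : c.ι) (T : Opens X) (a : T ⟶ c.cov i)
    (b : T ⟶ c.cov j) : (c.toCocycle.ev i j a b).1.1 =
      ((t.iso j).restrict (leOfHom b)).symm.trans ((t.iso i).restrict (leOfHom a)) := by
  ext V h v
  obtain ⟨u, rfl⟩ := ((t.iso j).app V (h.trans (leOfHom b))).surjective v
  rw [c.app_ev, t.act_app]
  exact (congrArg ((t.iso i).app V _) (LinearEquiv.symm_apply_apply _ u)).symm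

/-- The glued sheaf has the given transition functions. -/
def glued (c : Cocycle (autFiltSheaf E₀ p)) : Transition c.glued c where
  iso := c.gluedIso
  preserves_par := c.gluedIso_preserves_par
  act_app i j _ hi hj v := Cocycle.Glued.act_at' (c := c) v i j le_rfl hi hj

/-- Two sheaves with the same transition functions are isomorphic. -/
theorem nonempty_iso (t : Transition E c) (t' : Transition E' c) : E.Iso E' := by
  -- The local isomorphisms `δ'_i⁻¹ ∘ δ_i` agree on overlaps, because the common transition function
  -- cancels.
  obtain ⟨φ, hφ⟩ := IsoOn.exists_glue c.cov c.iSup_cov (fun i => (t.iso i).trans (t'.iso i).symm)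
    (fun i j V hi hj v => by
      change ((t'.iso i).app V hi).symm ((t.iso i).app V hi v) =
        ((t'.iso j).app V hj).symm ((t.iso j).app V hj v)
      rw [LinearEquiv.symm_apply_eq, ← t'.act_app i j V hi hj, LinearEquiv.apply_symm_apply,
        t.act_app])
  refine ⟨φ, fun k => IsoOn.preserves_par_of_mem (fun k V _ v hv => ?_) k⟩
  refine SuperModSheaf.mem_par_of_local fun x hx => ?_
  obtain ⟨i, hi⟩ := Opens.mem_iSup.1 (c.iSup_cov ▸ Opens.mem_top x)
  refine ⟨V ⊓ c.cov i, ⟨hx, hi⟩, inf_le_left, ?_⟩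
  rw [φ.res_app, hφ i _ inf_le_right]
  exact ((t.preserves_par i k).trans (t'.preserves_par i k).symm _ _ _).2
    ((E.par k).res_mem inf_le_left hv)

/-- Transition functions of `E` are transition functions of every sheaf isomorphic to `E`. -/
theorem of_iso (t : Transition E c) (h : E'.Iso E) : Nonempty (Transition E' c) := by
  obtain ⟨φ, hφ⟩ := h
  exact ⟨{
    iso := fun i => (φ.restrict le_top).trans (t.iso i)
    preserves_par := fun i k V hV v => (t.preserves_par i k V hV _).trans (hφ k V le_top v)
    act_app := fun i j V hi hj v => t.act_app i j V hi hj _ }⟩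

/-- Composition with a global automorphism of the model conjugates the transition functions. -/
def conj (t : Transition E c) (a : SAut E₀ ⊤) : Transition E (c.conj E₀ a) where
  iso i := (t.iso i).trans (a.1.restrict le_top)
  preserves_par i k := (t.preserves_par i k).trans fun V _ v => a.2 k V le_top v
  act_app i j V hi hj v := by
    change a.1.app V le_top (c.act i j hi hj ((a.1.app V le_top).symm
      (a.1.app V le_top ((t.iso j).app V hj v)))) = a.1.app V le_top ((t.iso i).app V hi v)
    rw [LinearEquiv.symm_apply_apply]
    exact congrArg (a.1.app V le_top) (t.act_app i j V hi hj v)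

end Transition

/-- The pull-back of a cocycle along a refinement of the covering. -/
def Cocycle.refine (c : Cocycle (autFiltSheaf E₀ p)) {κ : Type u} (W : κ → Opens X)
    (hW : ⨆ k, W k = ⊤) (r : κ → c.ι) (h : ∀ k, W k ≤ c.cov (r k)) :
    Cocycle (autFiltSheaf E₀ p) := ⟨κ, W, hW, refineCocycle c.toCocycle W r h⟩

namespace Transition

variable {E E' : SuperModSheaf R} {c d : Cocycle (autFiltSheaf E₀ p)}

/-- Restriction to a refinement of the covering. -/
def refine (t : Transition E c) {κ : Type u} (W : κ → Opens X)
    (hW : ⨆ k, W k = ⊤) (r : κ → c.ι) (h : ∀ k, W k ≤ c.cov (r k)) :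
    Transition E (c.refine W hW r h) where
  iso k := (t.iso (r k)).restrict (h k)
  preserves_par i k V hV v := t.preserves_par (r i) k V (hV.trans (h i)) v
  act_app i j V hi hj v :=
    t.act_app (r i) (r j) V (hi.trans (h i)) (hj.trans (h j)) v

/-- Changing the isomorphisms by a `0`-cochain. -/
theorem of_isCohomologous {κ : Type u} {W : κ → Opens X} {hW : ⨆ k, W k = ⊤}
    {f g : PresheafOfGroups.OneCocycle (autFiltSheaf E₀ p) W} (h : f.IsCohomologous g)
    (t : Transition E ⟨κ, W, hW, f⟩) : Nonempty (Transition E ⟨κ, W, hW, g⟩) := by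
  obtain ⟨α, hα⟩ := h
  let α' : ∀ i, autFilt E₀ p (W i) := α
  exact ⟨{
    iso := fun i => (t.iso i).trans (α' i).1.1
    preserves_par := fun i k => (t.preserves_par i k).trans ((α' i).1.2 k)
    act_app := fun i j V hi hj v => by
      have e₁ := congrArg (fun a : autFilt E₀ p V => a.1.1.app V le_rfl ((t.iso j).app V hj v))
        (hα i j (homOfLE hi) (homOfLE hj))
      have e₂ := congrArg ((α' i).1.1.app V hi) (t.act_app i j V hi hj v)
      exact e₁.symm.trans e₂ }⟩

/-- Equivalent cocycles are cohomologous only after refinement, so `E` directly acquires a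
refinement of `d` as transition functions. The sheaf glued from `d` has this refinement too, hence
is isomorphic to `E`, and `d` itself is transported along the isomorphism. -/
theorem of_equiv (t : Transition E c) (h : Cocycle.Equiv _ c d) : Nonempty (Transition E d) := by
  obtain ⟨κ, W, hW, r, s, h₁, h₂, hcd⟩ := h
  obtain ⟨t'⟩ := of_isCohomologous (hW := hW) hcd (t.refine W hW r h₁)
  exact (glued d).of_iso (nonempty_iso t' ((glued d).refine W hW s h₂))

end Transition

theorem Cocycle.Equiv.symm {c d : Cocycle (autFiltSheaf E₀ p)} (h : Cocycle.Equiv _ c d) :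
    Cocycle.Equiv _ d c := by
  obtain ⟨κ, W, hW, r, s, h₁, h₂, hcd⟩ := h
  exact ⟨κ, W, hW, s, r, h₂, h₁,
    (PresheafOfGroups.OneCocycle.equivalence_isCohomologous _ _).symm hcd⟩

/-- Local isomorphisms which agree modulo `(E₀)_(p)` have equivalent transition functions. -/
theorem Transition.equiv {E : SuperModSheaf R} {c d : Cocycle (autFiltSheaf E₀ p)}
    (t : Transition E c) (t' : Transition E d)
    (h : ∀ (i : c.ι) (j : d.ι) (V : Opens X) (hi : V ≤ c.cov i) (hj : V ≤ d.cov j) (v : E.sec V),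
      (t'.iso j).app V hj v - (t.iso i).app V hi v ∈ filt E₀.toModSheaf p V) :
    Cocycle.Equiv _ c d := by
  let W : c.ι × d.ι → Opens X := fun k => c.cov k.1 ⊓ d.cov k.2
  have hW : ⨆ k, W k = ⊤ := by
    rw [iSup_prod]
    simp only [W, ← inf_iSup_eq, d.iSup_cov, inf_top_eq, c.iSup_cov]
  -- The `0`-cochain on the refinement by pairs is `δ'_j ∘ δ_i⁻¹` over `U_i ∩ U'_j`; the hypothesis
  -- `h` places it in `Aut_(p)`.
  let α : ∀ k, autFilt E₀ p (W k) := fun k =>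
    ⟨⟨((t.iso k.1).restrict inf_le_left).symm.trans ((t'.iso k.2).restrict inf_le_right),
      fun m => IsoOn.Preserves.trans (IsoOn.Preserves.symm
        (fun V hV v => t.preserves_par k.1 m V (hV.trans inf_le_left) v))
        (fun V hV v => t'.preserves_par k.2 m V (hV.trans inf_le_right) v)⟩,
      fun V hV v => by
        obtain ⟨u, rfl⟩ := ((t.iso k.1).app V (hV.trans inf_le_left)).surjective v
        have e : ((t.iso k.1).app V (hV.trans inf_le_left)).symm
          ((t.iso k.1).app V (hV.trans inf_le_left) u) = u := LinearEquiv.symm_apply_apply _ u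
        change (t'.iso k.2).app V (hV.trans inf_le_right) (((t.iso k.1).app V
          (hV.trans inf_le_left)).symm ((t.iso k.1).app V (hV.trans inf_le_left) u)) - _ ∈ _
        rw [e]
        exact h k.1 k.2 V _ _ u⟩
  have hα : ∀ k (V : Opens X) (hV : V ≤ W k) (u : E.sec V),
      (α k).1.1.app V hV ((t.iso k.1).app V (hV.trans inf_le_left) u) =
        (t'.iso k.2).app V (hV.trans inf_le_right) u := fun k V hV u =>
    congrArg ((t'.iso k.2).app V (hV.trans inf_le_right)) (LinearEquiv.symm_apply_apply _ u)
  refine ⟨c.ι × d.ι, W, hW, Prod.fst, Prod.snd, fun _ => inf_le_left, fun _ => inf_le_right,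
    α, fun k l T a b => ?_⟩
  have hk := leOfHom a
  have hl := leOfHom b
  refine Subtype.ext (Subtype.ext (IsoOn.ext (funext fun V => funext fun hV =>
    LinearEquiv.ext fun v => ?_)))
  obtain ⟨u, rfl⟩ := ((t.iso l.1).app V ((hV.trans hl).trans inf_le_left)).surjective v
  change (α k).1.1.app V (hV.trans hk) ((c.toCocycle.ev k.1 l.1 _ _).1.1.app V hV _) =
    (d.toCocycle.ev k.2 l.2 _ _).1.1.app V hV ((α l).1.1.app V (hV.trans hl) _)
  rw [hα, c.app_ev, d.app_ev, t.act_app, t'.act_app, hα]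

/-- The condition that the cocycles of a cohomology class are transition functions of `E`. -/
def IsTransitionClass (E : SuperModSheaf R) : H1 (autFiltSheaf E₀ p) → Prop :=
  Quot.lift (fun c => Nonempty (Transition E c)) fun _ _ h =>
    -- The predicate is constant along `Cocycle.Equiv`, so equality in the quotient can be exploited
    -- without proving that relation transitive.
    propext ⟨fun ⟨t⟩ => t.of_equiv h, fun ⟨t⟩ => t.of_equiv h.symm⟩

theorem isTransitionClass_smul {E : SuperModSheaf R} {x : H1 (autFiltSheaf E₀ p)} (a : SAut E₀ ⊤)
    (h : IsTransitionClass E x) : IsTransitionClass E (a • x) := by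
  obtain ⟨c, rfl⟩ := Quot.exists_rep x
  obtain ⟨t⟩ := h
  exact ⟨t.conj a⟩

/-- The class of the trivial cocycle is fixed by the automorphisms of `E₀`. -/
theorem smul_one_H1 (a : SAut E₀ ⊤) : a • (1 : H1 (autFiltSheaf E₀ p)) = 1 := by
  refine Quot.sound ⟨PUnit, fun _ => ⊤, iSup_const, id, id, fun _ => le_rfl, fun _ => le_rfl,
    1, fun i j T f g => ?_⟩
  exact (mul_one _).trans (map_one (MulAut.conjNormal (SAut.res E₀ (le_top : T ≤ ⊤) a)))

end Transition

/-! ### The bijection between isomorphism classes and orbits. -/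

section Classification

open CategoryTheory Opposite

variable {X : Type u} [TopologicalSpace X] {F : Opens X → Type u} [∀ U, CommRing (F U)]
  [RingPsh F] [SuperRing F] [PurelyEven F] {G : ModSheaf F} {S : SuperModSheaf F}

/-- The local isomorphisms underlying a system of transition functions. -/
def Transition.localIsos {E : SuperModSheaf (Shf (Ext G))} {c : Cocycle (autOne G S)}
    (t : Transition E c) : LocalIsos E S where
  ι := c.ι
  cov := c.cov
  iSup_cov := c.iSup_cov
  iso := t.iso
  preserves_par := t.preserves_par
  sub_mem i j V hi hj v := by
    rw [← t.act_app i j V hi hj]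
    exact (c.toCocycle.ev i j (homOfLE hi) (homOfLE hj)).2 V le_rfl _

/-- The transition functions `δ_i ∘ δ_j⁻¹`. -/
def LocalIsos.cocycle {E : SuperModSheaf (Shf (Ext G))} (A : LocalIsos E S) :
    Cocycle (autOne G S) where
  ι := A.ι
  cov := A.cov
  iSup_cov := A.iSup_cov
  toCocycle :=
    { ev := fun i j T a b =>
        ⟨⟨((A.iso j).restrict (leOfHom b)).symm.trans ((A.iso i).restrict (leOfHom a)),
          fun k => IsoOn.Preserves.trans (IsoOn.Preserves.symm
            (fun V hV v => A.preserves_par j k V (hV.trans (leOfHom b)) v))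
            (fun V hV v => A.preserves_par i k V (hV.trans (leOfHom a)) v)⟩,
          fun V hV v => by
            have e : (A.iso j).app V (hV.trans (leOfHom b))
                (((A.iso j).app V (hV.trans (leOfHom b))).symm v) = v :=
              LinearEquiv.apply_symm_apply _ v
            have := A.sub_mem i j V (hV.trans (leOfHom a)) (hV.trans (leOfHom b))
              (((A.iso j).app V (hV.trans (leOfHom b))).symm v)
            rw [e] at this
            exact this⟩
      ev_precomp := fun _ _ _ _ _ _ _ => rfl
      ev_trans := fun i j k T a b c => by
        refine Subtype.ext (Subtype.ext (IsoOn.ext (funext fun V => funext fun hV =>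
          LinearEquiv.ext fun v => ?_)))
        exact congrArg ((A.iso i).app V (hV.trans (leOfHom a)))
          (LinearEquiv.symm_apply_apply ((A.iso j).app V (hV.trans (leOfHom b))) _) }

/-- Local isomorphisms have their own transition functions. -/
def LocalIsos.transition {E : SuperModSheaf (Shf (Ext G))} (A : LocalIsos E S) :
    Transition E A.cocycle where
  iso := A.iso
  preserves_par := A.preserves_par
  act_app i _ V hi _ _ := congrArg ((A.iso i).app V hi) (LinearEquiv.symm_apply_apply _ _)

/-- The isomorphism `θ` need not be supplied: transition functions in `Aut_(1)` mean that the `δ_i`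
agree modulo `(E_gr)_(1)`, so they induce a global isomorphism of the associated graded sheaves by
themselves. -/
theorem isTransition_iff (E : WithRetract G S) (c : Cocycle (autOne G S)) :
    IsTransition G S E c ↔ Nonempty (Transition E.1 c) := by
  constructor
  · rintro ⟨θ, δ, hpar, -, h⟩
    exact ⟨⟨δ, hpar, act_app_of_ev_eq h⟩⟩
  · rintro ⟨t⟩
    exact ⟨t.localIsos.grIso, t.iso, t.preserves_par,
      fun i V h q v => t.localIsos.app_sub_grIso_mem i h v, t.ev_eq⟩

/-- A single `θ` is lifted near every point. The lifts over different neighbourhoods induce the same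
map on `gr E`, so by the case `q = 0` they agree modulo `(E_gr)_(1)`. -/
theorem exists_transition {m p q : ℕ} (hG : G.IsLocallyFree m) (hS : S.IsLocallyFree p q)
    (E : WithRetract G S) : ∃ c : Cocycle (autOne G S), Nonempty (Transition E.1 c) := by
  obtain ⟨θ⟩ := E.2.2
  choose U hx δ hpar hδ using fun x => θ.exists_isoOn hG hS x
  let A : LocalIsos E.1 S :=
    { ι := X
      cov := U
      iSup_cov := top_le_iff.1 fun x _ => Opens.mem_iSup.2 ⟨x, hx x⟩
      iso := δ
      preserves_par := hpar
      sub_mem := fun i j V hi hj v => by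
        have := sub_mem (hδ i V hi 0 ⟨v, mem_filt_zero v⟩) (hδ j V hj 0 ⟨v, mem_filt_zero v⟩)
        rwa [sub_sub_sub_cancel_right] at this }
  exact ⟨A.cocycle, ⟨A.transition⟩⟩

/-- The sheaf glued from copies of `E_gr` by a cocycle with values in `Aut_(1) E_gr`. -/
def gluedWithRetract {p q : ℕ} (hS : S.IsLocallyFree p q) (c : Cocycle (autOne G S)) :
    WithRetract G S :=
  ⟨c.glued, ⟨p, q, fun x => by
    obtain ⟨i, hi⟩ := Opens.mem_iSup.1 (c.iSup_cov ▸ Opens.mem_top x)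
    obtain ⟨U, hx, e, h₀, h₁, he⟩ := Egr_isLocallyFree (G := G) hS x
    let φ := ((c.gluedIso i).restrict (inf_le_right : U ⊓ c.cov i ≤ c.cov i)).symm
    have hφ : ∀ k, φ.Preserves ((Egr G S).par k) (c.glued.par k) := fun k =>
      IsoOn.Preserves.symm fun V hV v =>
        c.gluedIso_preserves_par i k V (hV.trans inf_le_right) v
    exact ⟨U ⊓ c.cov i, ⟨hx, hi⟩, fun l => φ.app _ le_rfl (res (Egr G S).sec inf_le_left (e l)),
      fun l => (hφ 0 _ _ _).2 (((Egr G S).par 0).res_mem _ (h₀ l)),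
      fun l => (hφ 1 _ _ _).2 (((Egr G S).par 1).res_mem _ (h₁ l)),
      (he.restrict inf_le_left).map φ⟩⟩,
    ⟨(Transition.glued c).localIsos.grIso⟩⟩

/-- Two systems of transition functions of `E` have classes in the same orbit. -/
theorem exists_smul_eq {E : WithRetract G S} {c d : Cocycle (autOne G S)}
    (hc : IsTransition G S E c) (hd : IsTransition G S E d) :
    ∃ a : autZero G S, a • c.cls = d.cls := by
  obtain ⟨θ, δ, hpar, hδ, h⟩ := hc
  obtain ⟨θ', δ', hpar', hδ', h'⟩ := hd
  -- The conjugating automorphism is `θ' ∘ θ⁻¹`. After composition with it the `δ_i` induce `θ'`, as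
  -- the `δ'_j` do, so the two systems agree modulo `(E_gr)_(1)` and `Transition.equiv` applies.
  let φ : IsoOn (Egr G S).toModSheaf (Egr G S).toModSheaf ⊤ := θ.iso.symm.trans θ'.iso
  let a : SAut (Egr G S) ⊤ := ⟨φ, fun k =>
    (θ.preserves_par k).symm.trans (θ'.preserves_par k)⟩
  have ha : a ∈ autZero G S := fun q => (θ.preserves_deg q).symm.trans (θ'.preserves_deg q)
  have haθ : ∀ (V : Opens X) (s : (grSheaf E.1).sec V),
      φ.app V le_top (θ.iso.app V le_top s) = θ'.iso.app V le_top s := fun V s =>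
    congrArg (θ'.iso.app V le_top) (LinearEquiv.symm_apply_apply _ s)
  let t : Transition E.1 c := ⟨δ, hpar, act_app_of_ev_eq h⟩
  let t' : Transition E.1 d := ⟨δ', hpar', act_app_of_ev_eq h'⟩
  refine ⟨⟨a, ha⟩, Quot.sound (Transition.equiv (t.conj a) t' fun i j V hi hj v => ?_)⟩
  change (δ' j).app V hj v - φ.app V le_top ((δ i).app V hi v) ∈ _
  have m₁ := hδ' j V hj 0 ⟨v, mem_filt_zero v⟩
  have m₂ := (φ.preserves_filt 1 V le_top _).2 (hδ i V hi 0 ⟨v, mem_filt_zero v⟩)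
  rw [map_sub, haθ] at m₂
  have := sub_mem m₁ m₂
  rwa [sub_sub_sub_cancel_right] at this

/-- Being transition functions of `E` is invariant under equivalence of cocycles and under
conjugation, so it depends only on the orbit of the class. -/
theorem isTransition_of_orbit {E : WithRetract G S} {c d : Cocycle (autOne G S)}
    (hc : IsTransition G S E c)
    (h : (Quotient.mk _ c.cls : MulAction.orbitRel.Quotient (autZero G S) (H1 (autOne G S))) =
      Quotient.mk _ d.cls) : IsTransition G S E d := by
  obtain ⟨a, ha⟩ := MulAction.orbitRel_apply.1 (Quotient.exact h.symm)
  rw [isTransition_iff] at hc ⊢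
  have := isTransitionClass_smul (x := c.cls) a.1 hc
  have ha' : a.1 • c.cls = d.cls := ha
  rw [ha'] at this
  exact this

/-- The orbit of cohomology classes determined by a sheaf with retract `E_gr`. -/
theorem exists_classification {m p q : ℕ} (hG : G.IsLocallyFree m) (hS : S.IsLocallyFree p q) :
    ∃ Φ : ClassesWithRetract G S ≃
        MulAction.orbitRel.Quotient (autZero G S) (H1 (autOne G S)),
      ∀ (E : WithRetract G S) (c : Cocycle (autOne G S)),
        Φ (Quotient.mk _ E) = Quotient.mk _ c.cls ↔ IsTransition G S E c := by
  choose γ hγ using fun E : WithRetract G S => exists_transition hG hS E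
  let f : WithRetract G S → MulAction.orbitRel.Quotient (autZero G S) (H1 (autOne G S)) :=
    fun E => Quotient.mk _ (γ E).cls
  -- This equivalence shows that `f` does not depend on the chosen cocycles `γ`. It also gives
  -- invariance under isomorphism, injectivity (sheaves in one orbit share a cocycle) and
  -- surjectivity (glue the given cocycle).
  have hf : ∀ E c, f E = Quotient.mk _ c.cls ↔ IsTransition G S E c := by
    refine fun E c => ⟨isTransition_of_orbit ((isTransition_iff E _).2 (hγ E)), fun h => ?_⟩
    obtain ⟨a, ha⟩ := exists_smul_eq h ((isTransition_iff E _).2 (hγ E))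
    exact Quotient.sound (MulAction.orbitRel_apply.2 ⟨a, ha⟩)
  have hiso : ∀ E E' : WithRetract G S, E.1.Iso E'.1 → f E = f E' := by
    intro E E' h
    refine (hf E _).2 ((isTransition_iff E _).2 ?_)
    obtain ⟨t⟩ := hγ E'
    exact t.of_iso h
  let f' : ClassesWithRetract G S →
      MulAction.orbitRel.Quotient (autZero G S) (H1 (autOne G S)) :=
    Quotient.lift f fun E E' h => hiso E E' h
  have hbij : Function.Bijective f' := by
    constructor
    · rintro ⟨E⟩ ⟨E'⟩ h
      obtain ⟨t⟩ := (isTransition_iff E _).1 ((hf E (γ E')).1 h)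
      obtain ⟨t'⟩ := hγ E'
      exact Quotient.sound (t.nonempty_iso t')
    · rintro ⟨⟨c⟩⟩
      refine ⟨Quotient.mk _ (gluedWithRetract hS c), ?_⟩
      exact (hf _ _).2 ((isTransition_iff _ _).2 ⟨Transition.glued c⟩)
  exact ⟨Equiv.ofBijective f' hbij, hf⟩

end Classification

end SuperSheaf

end


theorem theorem3 {n m p q : ℕ} {M : Type u} [TopologicalSpace M]
    [ChartedSpace (EuclideanSpace ℂ (Fin n)) M]
    [IsManifold 𝓘(ℂ, EuclideanSpace ℂ (Fin n)) ω M]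
    (G : SuperSheaf.ModSheaf (SuperSheaf.Hol n M)) (hG : G.IsLocallyFree m)
    (S : SuperSheaf.SuperModSheaf (SuperSheaf.Hol n M)) (hS : S.IsLocallyFree p q) :
    (∃ Φ : SuperSheaf.ClassesWithRetract G S ≃
        MulAction.orbitRel.Quotient (SuperSheaf.autZero G S)
          (SuperSheaf.H1 (SuperSheaf.autOne G S)),
      ∀ (E : SuperSheaf.WithRetract G S) (c : SuperSheaf.Cocycle (SuperSheaf.autOne G S)),
        Φ (Quotient.mk _ E) = Quotient.mk _ c.cls ↔ SuperSheaf.IsTransition G S E c) ∧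
    ∀ a : SuperSheaf.autZero G S, a • (1 : SuperSheaf.H1 (SuperSheaf.autOne G S)) = 1 :=
  ⟨SuperSheaf.exists_classification hG hS, fun a => SuperSheaf.smul_one_H1 a.1⟩
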